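/- Throughout, cubes of $\mathbb R^d$ ($d\ge 1$) are axis-parallel, $cQ$ is the concentric $c$-fold dilate of $Q$, $\langle f\rangle_{p,Q}=|Q|^{-1/p}\|f\mathbf 1_Q\|_p$ for scalar $f$ and $0<p\le\infty$, and $\mathrm M_pf(x)=\sup_{Q\ni x}\langle f\rangle_{p,Q}$. Dyadic cubes are the cubes of one of the $3^d$ canonical dyadic systems $\{2^s([0,1)^d+m+(-1)^s\alpha/3): s\in\mathbb Z,\,m\in\mathbb Z^d\}$, $\alpha\in\{0,1,2\}^d$; such a cube has scale $s_Q=s$. Kernels. Let $[K]=\{K_s:s\in\mathbb Z\}$ be measurable real functions on $\mathbb R^d\times\mathbb R^d$ such that $K_s(x,y)=0$ unless $|x-y|_\infty<2^s$ (in particular, this holds if $K_s$ vanishes unless the Euclidean distance $|x-y|$ is less than $2^s$), and $$\sup_{s}2^{sd}\sup_x\big(\|K_s(x,\cdot)\|_\infty+\|K_s(\cdot,x)\|_\infty\big)<\infty .$$ Put $T[K]f(x,t_1,t_2)=\sum_{t_1<s\le t_2}\int K_s(x,y)f(y)\,dy$ for $t_1,t_2\in\mathbb Z$, $T_\star[K]f(x)=\sup_{t_1\le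 t_2}|T[K]f(x,t_1,t_2)|$, and let $\|[K]\|_{r,\star}$ be the norm of $T_\star[K]$ on $L^r(\mathbb R^d)$. For bounded measurable $t_1,t_2:\mathbb R^d\to\mathbb Z$ let $T[K]_{t_1}^{t_2}f(x)=T[K]f(x,t_1(x),t_2(x))$. Stopping collections. A stopping collection $\mathcal Q$ with top the dyadic cube $Q$ is a collection of pairwise disjoint dyadic cubes of the same dyadic system with $\mathsf{sh}\mathcal Q:=\bigcup_{L\in\mathcal Q}L\subset 3Q$, with $9L\subset\mathsf{sh}\mathcal Q$ for all $L\in\mathcal Q$ such that $3L\cap 2Q\ne\emptyset$, and with $|s_L-s_{L'}|\le 8$ whenever $L,L'\in\mathcal Q$ and $3L\cap3L'\neq\emptyset$. $\mathcal Y_p(\mathcal Q)$ is the space of $f\in L^p(\mathbb R^d)$ supported in $3Q$ with finite norm, equal to $\max\{\|f\mathbf 1_{\mathbb R^d\setminus\mathsf{sh}\mathcal Q}\|_\infty,\ \sup_{L\in\mathcal Q}\inf_{x\in 2^5L}\mathrm M_pf(x)\}$ if $p<\infty$ and to $\|f\|_\infty$ if $p=\infty$. $\dot{\mathcal X}_p(\mathcal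 Q)$ is the subspace, with the same norm, of those $b=\sum_{L\in\mathcal Q}b_L$ with $\mathrm{supp}\,b_L\subset L$ and $\int b_L=0$. Set $$\mathcal Q[K]_{t_1}^{t_2}(f_1,f_2)=\frac1{|Q|}\Big[\big\langle T[K]_{t_1}^{\min(t_2,s_Q)}(f_1\mathbf 1_Q),f_2\big\rangle-\sum_{L\in\mathcal Q,\,L\subset Q}\big\langle T[K]_{t_1}^{\min(t_2,s_L)}(f_1\mathbf 1_L),f_2\big\rangle\Big],$$ and let $C_{\mathsf L}[K](p_1,p_2)$ be the supremum, over all stopping collections $\mathcal Q$ and all bounded measurable $t_1,t_2$, of $$\sup_{\|b\|_{\dot{\mathcal X}_{p_1}(\mathcal Q)}=1,\ \|f\|_{\mathcal Y_{p_2}(\mathcal Q)}=1}\big|\mathcal Q[K]_{t_1}^{t_2}(b,f)\big|+\sup_{\|f\|_{\mathcal Y_{\infty}(\mathcal Q)}=1,\ \|b\|_{\dot{\mathcal X}_{p_2}(\mathcal Q)}=1}\big|\mathcal Q[K]_{t_1}^{t_2}(f,b)\big|.$$ Sparse norm. For a locally $p$-integrable $f:\mathbb R^d\to\mathbb R^n$,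 $1\le p<\infty$, $p'=p/(p-1)$, let $\langle f\rangle_{p,Q}=\{\frac1{|Q|}\int_Qf\varphi\,dx:\ \varphi:Q\to\mathbb R,\ \langle\varphi\rangle_{p',Q}\le1\}\subset\mathbb R^n$, and let $\langle f_1\rangle_{p_1,Q}\langle f_2\rangle_{p_2,Q}$ denote the right endpoint of the Minkowski product $\{\langle a,b\rangle_{\mathbb R^n}:a\in\langle f_1\rangle_{p_1,Q},\,b\in\langle f_2\rangle_{p_2,Q}\}$. A countable collection $\mathcal S$ of cubes is $\frac12$-sparse if there are pairwise disjoint measurable $E_I\subset I$, $I\in\mathcal S$, with $|E_I|\ge\frac12|I|$. For a linear $T$ mapping bounded, compactly supported $\mathbb R^n$-valued functions to locally integrable ones, $\|T\|_{(p_1,p_2),\mathsf{sparse}}$ is the least $C$ such that for all bounded, compactly supported $f_1,f_2:\mathbb R^d\to\mathbb R^n$ there is a $\frac12$-sparse $\mathcal S$ with convergent sparse sum and $$|\langle Tf_1,f_2\rangle|\le C\sum_{Q\in\mathcal S}|Q|\,\langle f_1\rangle_{p_1,Q}\langle f_2\rangle_{p_2,Q}.$$ Theorem. Let $1<r<\infty$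 and $1\le p_1,p_2<\infty$. There is a constant $C$ depending only on $r,p_1,p_2,d,n$ such that, for every $[K]$ as above with $\|[K]\|_{r,\star}<\infty$ and $C_{\mathsf L}[K](p_1,p_2)<\infty$ and for all bounded measurable $t_1,t_2:\mathbb R^d\to\mathbb Z$, the operator $T[K]_{t_1}^{t_2}\otimes\mathrm{Id}_{\mathbb R^n}$ (acting coordinatewise) maps bounded, compactly supported functions to locally integrable ones and satisfies $$\big\|T[K]_{t_1}^{t_2}\otimes\mathrm{Id}_{\mathbb R^n}\big\|_{(p_1,p_2),\mathsf{sparse}}\le C\big(\|[K]\|_{r,\star}+C_{\mathsf L}[K](p_1,p_2)\big).$$ -/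

import Mathlib

open MeasureTheory Set
open scoped ENNReal NNReal

noncomputable section

/-- `ℝ^d`, with Lebesgue measure `volume`. -/
abbrev Rd (d : ℕ) : Type := Fin d → ℝ

/-- `ℝ^n` with its Euclidean norm and scalar product (the space of values). -/
abbrev Rn (n : ℕ) : Type := EuclideanSpace ℝ (Fin n)

/-! ### Cubes -/

/-- A cube of `ℝ^d` with sides parallel to the axes, given by its lower corner and side length. -/
@[ext] structure Cube (d : ℕ) where
  corner : Fin d → ℝ
  side : ℝ
  side_pos : 0 < side

namespace Cube

variable {d : ℕ}

/-- The (half-open) set of points of a cube. -/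
def toSet (Q : Cube d) : Set (Rd d) :=
  {x | ∀ i, Q.corner i ≤ x i ∧ x i < Q.corner i + Q.side}

/-- The center of a cube. -/
def center (Q : Cube d) : Rd d := fun i => Q.corner i + Q.side / 2

/-- The concentric dilate `cQ`. -/
def dilate (c : ℝ) (Q : Cube d) : Set (Rd d) :=
  {x | ∀ i, Q.center i - c * Q.side / 2 ≤ x i ∧ x i < Q.center i + c * Q.side / 2}

end Cube

/-- Indices of the cubes of a dyadic system: the scale `s` and the integer position. -/
@[ext] structure DyadicCube (d : ℕ) where
  scale : ℤ
  pos : Fin d → ℤ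

/-- The cube `2^s ([0,1)^d + m + (-1)^s α/3)` of the dyadic system attached to
`α ∈ {0,1,2}^d`; these are the `3^d` canonical dyadic systems, and `α = 0` is the standard one. -/
def DyadicCube.toCube {d : ℕ} (α : Fin d → Fin 3) (L : DyadicCube d) : Cube d where
  corner := fun i =>
    (2 : ℝ) ^ L.scale * ((L.pos i : ℝ) + (-1 : ℝ) ^ L.scale * (((α i : ℕ) : ℝ) / 3))
  side := (2 : ℝ) ^ L.scale
  side_pos := zpow_pos two_pos _

/-! ### Averages and maximal functions -/

/-- `⟨f⟩_{p,Q} = ‖f 1_Q‖_p / |Q|^{1/p}`, for `p ∈ (0,∞]` (`1/p = 0` if `p = ∞`). -/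
def avg {d : ℕ} (p : ℝ≥0∞) (f : Rd d → ℝ) (Q : Cube d) : ℝ≥0∞ :=
  eLpNorm (Q.toSet.indicator f) p volume / volume Q.toSet ^ (p⁻¹).toReal

/-- The maximal function `M_p f (x) = sup_Q ⟨f⟩_{p,Q} 1_Q(x)`, over all cubes. -/
def maxFn {d : ℕ} (p : ℝ≥0∞) (f : Rd d → ℝ) (x : Rd d) : ℝ≥0∞ :=
  ⨆ (Q : Cube d) (_ : x ∈ Q.toSet), avg p f Q

/-! ### Stopping collections and the localized spaces -/

/-- `sh 𝒬`, the union of the cubes of `𝒬`. -/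
def shadow {d : ℕ} (α : Fin d → Fin 3) (𝒬 : Set (DyadicCube d)) : Set (Rd d) :=
  ⋃ L ∈ 𝒬, (L.toCube α).toSet

/-- `𝒬` is a stopping collection with top `Q`, in the dyadic system `α`. -/
structure IsStoppingCollection {d : ℕ} (α : Fin d → Fin 3) (Q : DyadicCube d)
    (𝒬 : Set (DyadicCube d)) : Prop where
  shadow_subset : shadow α 𝒬 ⊆ (Q.toCube α).dilate 3
  dilate_subset : ∀ L ∈ 𝒬, ((L.toCube α).dilate 3 ∩ (Q.toCube α).dilate 2).Nonempty →
    (L.toCube α).dilate 9 ⊆ shadow α 𝒬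
  eq_of_inter : ∀ L ∈ 𝒬, ∀ L' ∈ 𝒬,
    ((L.toCube α).toSet ∩ (L'.toCube α).toSet).Nonempty → L = L'
  whitney : ∀ L ∈ 𝒬, ∀ L' ∈ 𝒬,
    ((L.toCube α).dilate 3 ∩ (L'.toCube α).dilate 3).Nonempty → |L.scale - L'.scale| ≤ 8

/-- The norm of `𝒴_p(𝒬)`. -/
def normY {d : ℕ} (α : Fin d → Fin 3) (𝒬 : Set (DyadicCube d)) (p : ℝ≥0∞)
    (f : Rd d → ℝ) : ℝ≥0∞ :=
  open Classical in
  if p = ∞ then eLpNorm f ∞ volume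
  else max (eLpNorm ((shadow α 𝒬)ᶜ.indicator f) ∞ volume)
    (⨆ L ∈ 𝒬, ⨅ x ∈ (L.toCube α).dilate (2 ^ 5), maxFn p f x)

/-- Membership in `𝒴_p(𝒬)`: functions of `L^p` supported in `3Q`, of finite `𝒴_p(𝒬)` norm. -/
structure MemY {d : ℕ} (α : Fin d → Fin 3) (Q : DyadicCube d) (𝒬 : Set (DyadicCube d))
    (p : ℝ≥0∞) (f : Rd d → ℝ) : Prop where
  memLp : MemLp f p volume
  supp : ∀ᵐ x, x ∉ (Q.toCube α).dilate 3 → f x = 0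
  norm_lt : normY α 𝒬 p f < ∞

/-- Membership in `𝒳̇_p(𝒬)`: elements of `𝒴_p(𝒬)` of the form `b = ∑_{L ∈ 𝒬} b_L`, with `b_L`
supported in `L` and of mean zero. As the cubes are disjoint, `b_L` can only be `b 1_L`. -/
structure MemXdot {d : ℕ} (α : Fin d → Fin 3) (Q : DyadicCube d) (𝒬 : Set (DyadicCube d))
    (p : ℝ≥0∞) (b : Rd d → ℝ) : Prop where
  memY : MemY α Q 𝒬 p b
  supp : ∀ᵐ x, x ∉ shadow α 𝒬 → b x = 0
  mean_zero : ∀ L ∈ 𝒬, ∫ x in (L.toCube α).toSet, b x = 0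

/-! ### Kernel families and their truncated operators -/

/-- A family of real kernels `K_s(x,y)` on `ℝ^d × ℝ^d`, indexed by `s ∈ ℤ`. -/
abbrev KernelFamily (d : ℕ) : Type := ℤ → Rd d → Rd d → ℝ

/-- `‖[K]‖ = sup_s 2^{sd} sup_x (‖K_s(x,·)‖_∞ + ‖K_s(·,x)‖_∞)`. -/
def sizeNorm {d : ℕ} (K : KernelFamily d) : ℝ≥0∞ :=
  ⨆ s : ℤ, (2 : ℝ≥0∞) ^ (s * (d : ℤ)) *
    ⨆ x : Rd d, (eLpNorm (fun y => K s x y) ∞ volume + eLpNorm (fun y => K s y x) ∞ volume)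

/-- The standing assumptions on a kernel family. Here `‖x - y‖` is the maximum norm of `ℝ^d`, so
kernels supported in the smaller set where the Euclidean distance is less than `2^s` are
included. -/
structure IsKernelFamily {d : ℕ} (K : KernelFamily d) : Prop where
  measurable : ∀ s, Measurable (fun z : Rd d × Rd d => K s z.1 z.2)
  supp : ∀ s x y, K s x y ≠ 0 → ‖x - y‖ < (2 : ℝ) ^ s
  size_lt : sizeNorm K < ∞

/-- `T[K]f(x,t₁,t₂) = ∑_{t₁ < s ≤ t₂} ∫ K_s(x,y) f(y) dy`. -/
def truncT {d : ℕ} (K : KernelFamily d) (f : Rd d → ℝ) (x : Rd d) (t₁ t₂ : ℤ) : ℝ :=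
  ∑ s ∈ Finset.Ioc t₁ t₂, ∫ y, K s x y * f y

/-- `T_⋆[K]f(x) = sup_{t₁ ≤ t₂} |T[K]f(x,t₁,t₂)|`. -/
def maxT {d : ℕ} (K : KernelFamily d) (f : Rd d → ℝ) (x : Rd d) : ℝ≥0∞ :=
  ⨆ (t₁ : ℤ) (t₂ : ℤ) (_ : t₁ ≤ t₂), ENNReal.ofReal |truncT K f x t₁ t₂|

/-- `‖[K]‖_{r,⋆}`, the norm of the sublinear operator `T_⋆[K]` on `L^r(ℝ^d)`. -/
def maxNorm {d : ℕ} (K : KernelFamily d) (r : ℝ) : ℝ≥0∞ :=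
  sInf {C : ℝ≥0∞ | ∀ f : Rd d → ℝ, MemLp f (ENNReal.ofReal r) volume →
    (∫⁻ x, maxT K f x ^ r) ^ (1 / r) ≤ C * eLpNorm f (ENNReal.ofReal r) volume}

/-- Bounded measurable truncation functions `ℝ^d → ℤ`. -/
def IsTruncation {d : ℕ} (t : Rd d → ℤ) : Prop :=
  Measurable t ∧ ∃ M : ℤ, ∀ x, |t x| ≤ M

/-- The linearized truncation `T[K]_{t₁}^{t₂} f(x) = T[K]f(x,t₁(x),t₂(x))`. -/
def linT {d : ℕ} (K : KernelFamily d) (t₁ t₂ : Rd d → ℤ) (f : Rd d → ℝ) (x : Rd d) : ℝ :=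
  truncT K f x (t₁ x) (t₂ x)

/-- The localized truncated form `𝒬[K]_{t₁}^{t₂}(f₁,f₂)`. Only finitely many terms of the series
are nonzero if `t₁` is bounded below, as those with `s_L ≤ inf t₁` vanish. -/
def locForm {d : ℕ} (K : KernelFamily d) (α : Fin d → Fin 3) (Q : DyadicCube d)
    (𝒬 : Set (DyadicCube d)) (t₁ t₂ : Rd d → ℤ) (f₁ f₂ : Rd d → ℝ) : ℝ :=
  (volume.real (Q.toCube α).toSet)⁻¹ *
    ((∫ x, linT K t₁ (fun z => min (t₂ z) Q.scale) ((Q.toCube α).toSet.indicator f₁) x * f₂ x) -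
      ∑' L : {L : DyadicCube d // L ∈ 𝒬 ∧ (L.toCube α).toSet ⊆ (Q.toCube α).toSet},
        ∫ x, linT K t₁ (fun z => min (t₂ z) L.1.scale)
          ((L.1.toCube α).toSet.indicator f₁) x * f₂ x)

/-- The constant `C_L[K](p₁,p₂)`: the least upper bound of the sums of the two suprema, over all
stopping collections and all bounded measurable truncation functions. -/
def locConst {d : ℕ} (K : KernelFamily d) (p₁ p₂ : ℝ≥0∞) : ℝ≥0∞ :=
  ⨆ (α : Fin d → Fin 3) (Q : DyadicCube d) (𝒬 : Set (DyadicCube d))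
    (_ : IsStoppingCollection α Q 𝒬) (t₁ : Rd d → ℤ) (t₂ : Rd d → ℤ)
    (_ : IsTruncation t₁) (_ : IsTruncation t₂),
    ((⨆ (b : Rd d → ℝ) (f : Rd d → ℝ)
        (_ : MemXdot α Q 𝒬 p₁ b ∧ normY α 𝒬 p₁ b = 1)
        (_ : MemY α Q 𝒬 p₂ f ∧ normY α 𝒬 p₂ f = 1),
        ENNReal.ofReal |locForm K α Q 𝒬 t₁ t₂ b f|) +
      (⨆ (f : Rd d → ℝ) (b : Rd d → ℝ)
        (_ : MemY α Q 𝒬 ∞ f ∧ normY α 𝒬 ∞ f = 1)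
        (_ : MemXdot α Q 𝒬 p₂ b ∧ normY α 𝒬 p₂ b = 1),
        ENNReal.ofReal |locForm K α Q 𝒬 t₁ t₂ f b|))

/-! ### Convex body averages and the vector-valued sparse norm -/

/-- `Φ_q(Q)`: the functions `φ` on `Q` with `⟨φ⟩_{q,Q} ≤ 1`. -/
def Phi {d : ℕ} (q : ℝ≥0∞) (Q : Cube d) : Set (Rd d → ℝ) :=
  {φ | AEStronglyMeasurable φ (volume.restrict Q.toSet) ∧ avg q φ Q ≤ 1}

/-- The convex body average `⟨f⟩_{p,Q} = { |Q|⁻¹ ∫_Q f φ : φ ∈ Φ_{p'}(Q) }`, where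
`p' = (1 - 1/p)⁻¹` is the dual exponent (`p' = ∞` if `p = 1`). -/
def bodyAvg {d n : ℕ} (p : ℝ≥0∞) (f : Rd d → Rn n) (Q : Cube d) : Set (Rn n) :=
  {v | ∃ φ ∈ Phi ((1 - p⁻¹)⁻¹) Q,
    v = (volume.real Q.toSet)⁻¹ • ∫ x in Q.toSet, φ x • f x}

/-- The Minkowski product `AB = {⟨a,b⟩ : a ∈ A, b ∈ B}`. -/
def minkowskiProd {n : ℕ} (A B : Set (Rn n)) : Set ℝ :=
  Set.image2 (fun a b => inner ℝ a b) A B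

/-- The right endpoint of a symmetric interval, as a supremum in `[0,∞]`. -/
def rightEndpoint (I : Set ℝ) : ℝ≥0∞ := ⨆ c ∈ I, ENNReal.ofReal c

/-- `η`-sparse collections of cubes. -/
def IsSparse {d : ℕ} (η : ℝ≥0∞) (S : Set (Cube d)) : Prop :=
  S.Countable ∧ ∃ E : Cube d → Set (Rd d),
    (∀ I ∈ S, MeasurableSet (E I) ∧ E I ⊆ I.toSet ∧ η * volume I.toSet ≤ volume (E I)) ∧
    ∀ I ∈ S, ∀ J ∈ S, I ≠ J → E I ∩ E J = ∅

/-- The sparse form `∑_{Q ∈ S} |Q| ⟨f₁⟩_{p₁,Q} ⟨f₂⟩_{p₂,Q}`. -/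
def sparseForm {d n : ℕ} (p₁ p₂ : ℝ≥0∞) (S : Set (Cube d)) (f₁ f₂ : Rd d → Rn n) : ℝ≥0∞ :=
  ∑' Q : S, volume Q.1.toSet *
    rightEndpoint (minkowskiProd (bodyAvg p₁ f₁ Q.1) (bodyAvg p₂ f₂ Q.1))

/-- `L^∞_0(ℝ^d; ℝ^n)`: bounded functions with compact support. -/
def MemLinf0 {d n : ℕ} (f : Rd d → Rn n) : Prop :=
  MemLp f ∞ volume ∧ HasCompactSupport f

/-- `T` maps `L^∞_0(ℝ^d; ℝ^n)` into locally integrable functions and has the sparse `(p₁,p₂)`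
bound with constant `C`. The sparse sum is required to be a convergent series. -/
def HasSparseBound {d n : ℕ} (T : (Rd d → Rn n) → Rd d → Rn n) (p₁ p₂ : ℝ≥0∞) (C : ℝ≥0) :
    Prop :=
  (∀ f, MemLinf0 f → LocallyIntegrable (T f) volume) ∧
  ∀ f₁ f₂, MemLinf0 f₁ → MemLinf0 f₂ → ∃ S : Set (Cube d), IsSparse (1 / 2) S ∧
    sparseForm p₁ p₂ S f₁ f₂ < ∞ ∧
    ENNReal.ofReal |∫ x, inner ℝ (T f₁ x) (f₂ x)| ≤ (C : ℝ≥0∞) * sparseForm p₁ p₂ S f₁ f₂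

/-- `‖T‖_{(p₁,p₂),sparse}`, the least constant in the sparse bound (`∞` if there is none). -/
def sparseNorm {d n : ℕ} (T : (Rd d → Rn n) → Rd d → Rn n) (p₁ p₂ : ℝ≥0∞) : ℝ≥0∞ :=
  ⨅ (C : ℝ≥0) (_ : HasSparseBound T p₁ p₂ C), (C : ℝ≥0∞)

/-- The `ℝ^n`-valued extension `T ⊗ Id`, acting on each coordinate. -/
def vecExt {d : ℕ} (n : ℕ) (T : (Rd d → ℝ) → Rd d → ℝ) (f : Rd d → Rn n) (x : Rd d) : Rn n :=
  WithLp.toLp 2 (fun i => T (fun y => f y i) x)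

end

/-! ### Cubes and dyadic systems -/

namespace Cube

variable {d : ℕ}

/-! The proof is a stopping-time iteration; the vector-valued feature is that each step uses
coordinates adapted to a convex body.

Scalar estimate. Split `h` in a localized space along the stopping cubes as `h = g + b`, with `g`
the average of `h` on each cube (`exists_calderonZygmund`). Splitting the first entry, and then the
second only against the bounded part of the first, leaves forms of the types (b, v), (g, b') and (g,
g'). The first two are the forms measured by `locConst`. The third has bounded entries and is
controlled by the `L^r` norm of the maximal truncation and Hölder's inequality on tripled cubes.
This is `ofReal_abs_locForm_le`.

Passing to vectors. An Auerbach frame of the body of `f₁` over `3Q` gives `f₁ = ∑ l_i(f₁) a_i` on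
`3Q`, with at most `n` terms, the `l_i(f₁)` having averages at most `2`. As `a_i` belongs to the
body, the average of `⟨a_i, f₂⟩` is at most the right endpoint of the product of the two bodies
(`exists_frame`). The pairing therefore becomes a sum of at most `n` scalar pairings, each with the
correct product of averages, however degenerate the body may be.

Stopping step. Outside a small open set `U` all these scalar functions and their maximal functions
are comparable to their averages. The Whitney cubes of `U` form a stopping collection in which the
functions have controlled norms. Hence the pairing over `Q`, minus the pairings over its children,
costs `|Q|` times the product of the bodies, and the children fill at most half of `Q`
(`exists_children`).

Conclusion. Pairings over cubes below the lower truncation vanish, so the iteration is finite; it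
yields a Carleson family of dyadic cubes (`exists_carleson_domination`). The bodies live on the
triples, which need not be nested. They are nested inside each of `3^d` residue classes, and keeping
only levels far apart makes them sparse at the cost of a dimensional factor
(`exists_sparse_subfamily`). -/

theorem toSet_eq_pi (Q : Cube d) :
    Q.toSet = Set.pi univ fun i => Ico (Q.corner i) (Q.corner i + Q.side) := by
  ext x; simp [toSet, mem_pi]

theorem measurableSet_toSet (Q : Cube d) : MeasurableSet Q.toSet := by
  rw [toSet_eq_pi]
  exact MeasurableSet.univ_pi fun i => measurableSet_Ico

theorem volume_toSet (Q : Cube d) : volume Q.toSet = ENNReal.ofReal Q.side ^ d := by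
  rw [toSet_eq_pi, Real.volume_pi_Ico]
  simp

theorem volume_toSet_ne_zero (Q : Cube d) : volume Q.toSet ≠ 0 := by
  rw [volume_toSet]
  exact pow_ne_zero _ (by simpa using Q.side_pos)

theorem volume_toSet_ne_top (Q : Cube d) : volume Q.toSet ≠ ∞ := by
  rw [volume_toSet]
  exact ENNReal.pow_ne_top ENNReal.ofReal_ne_top

theorem corner_mem_toSet (Q : Cube d) : Q.corner ∈ Q.toSet :=
  fun _ => ⟨le_rfl, lt_add_of_pos_right _ Q.side_pos⟩

/-- The concentric dilate of a cube, as a cube. -/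
noncomputable def dilation (c : ℝ) (hc : 0 < c) (Q : Cube d) : Cube d where
  corner := fun i => Q.center i - c * Q.side / 2
  side := c * Q.side
  side_pos := mul_pos hc Q.side_pos

theorem toSet_dilation {c : ℝ} (hc : 0 < c) (Q : Cube d) :
    (Q.dilation c hc).toSet = Q.dilate c := by
  ext x
  simp only [toSet, dilation, dilate, mem_ofPred_eq]
  refine forall_congr' fun i => and_congr_right fun _ => ?_
  rw [show Q.center i - c * Q.side / 2 + c * Q.side = Q.center i + c * Q.side / 2 by ring]

theorem volume_dilate {c : ℝ} (hc : 0 < c) (Q : Cube d) :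
    volume (Q.dilate c) = ENNReal.ofReal c ^ d * volume Q.toSet := by
  rw [← toSet_dilation hc, volume_toSet, volume_toSet, ← mul_pow, ← ENNReal.ofReal_mul hc.le]
  rfl

theorem measurableSet_dilate {c : ℝ} (hc : 0 < c) (Q : Cube d) :
    MeasurableSet (Q.dilate c) := by
  rw [← toSet_dilation hc]; exact measurableSet_toSet _

theorem toSet_subset_dilate {c : ℝ} (hc : 1 ≤ c) (Q : Cube d) : Q.toSet ⊆ Q.dilate c := by
  intro x hx i
  have := hx i
  have h := mul_le_mul_of_nonneg_right hc Q.side_pos.le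
  simp only [center]
  constructor <;> linarith

theorem mem_dilate_three {Q : Cube d} {x : Rd d} :
    x ∈ Q.dilate 3 ↔ ∀ i, Q.corner i - Q.side ≤ x i ∧ x i < Q.corner i + 2 * Q.side := by
  refine forall_congr' fun i => ?_
  simp only [center]
  constructor <;> rintro ⟨h1, h2⟩ <;> constructor <;> linarith

end Cube

/-- The points of the grid of scale `s` of a dyadic system of the line. -/
noncomputable def gridPt (a : ℕ) (s p : ℤ) : ℝ := (2 : ℝ) ^ s * (p + (-1 : ℝ) ^ s * (a / 3))

theorem gridPt_add_mul (a : ℕ) (s p k : ℤ) :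
    gridPt a s p + k * (2 : ℝ) ^ s = gridPt a s (p + k) := by
  simp only [gridPt]; push_cast; ring

theorem gridPt_injective (a : ℕ) (s : ℤ) : Function.Injective (gridPt a s) := by
  intro p q h
  have h2 : (2 : ℝ) ^ s ≠ 0 := (zpow_pos two_pos _).ne'
  have := mul_left_cancel₀ h2 h
  exact_mod_cast add_right_cancel this

/-- The alternating sign in the shift makes consecutive grids nested: doubling `-a/3` gives `-2a/3`,
which differs from `a/3` by the integer `a`. -/
theorem gridPt_succ (a : ℕ) (s p : ℤ) :
    gridPt a (s + 1) p = gridPt a s (2 * p - s.negOnePow * a) := by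
  simp only [gridPt]
  rw [zpow_add₀ two_ne_zero, zpow_add₀ (by norm_num : (-1 : ℝ) ≠ 0)]
  push_cast [Int.cast_negOnePow]
  ring

/-- The integer `(-1)^s p - s a` modulo `3` does not change when a grid point is rewritten at a
finer scale: `2p ≡ -p`, while the sign flips. This invariant labels the tripled lattices in
`residue`. -/
theorem gridPt_add_nat (a : ℕ) (s : ℤ) (j : ℕ) (p : ℤ) :
    ∃ q : ℤ, gridPt a (s + j) p = gridPt a s q ∧
      (3 : ℤ) ∣ ((s + j).negOnePow * p - (s + j) * a) - (s.negOnePow * q - s * a) := by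
  induction j generalizing p with
  | zero => exact ⟨p, by simp, by simp⟩
  | succ j ih =>
    obtain ⟨q, hq, h3⟩ := ih (2 * p - (s + j).negOnePow * a)
    refine ⟨q, ?_, ?_⟩
    · rw [← hq, ← gridPt_succ]; push_cast; ring_nf
    · have h1 : (((s + j).negOnePow : ℤˣ) : ℤ) * ((s + j).negOnePow : ℤˣ) = 1 := by
        exact_mod_cast Int.units_coe_mul_self _
      have h2 : ((s + (j + 1 : ℕ)).negOnePow : ℤˣ) = -(s + j).negOnePow := by
        rw [← Int.negOnePow_succ]; push_cast; ring_nf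
      rw [h2]
      obtain ⟨m, hm⟩ := h3
      refine ⟨m - (s + j).negOnePow * p, ?_⟩
      push_cast
      linear_combination hm + (a : ℤ) * h1

/-- Intervals between points of a lattice contain the lattice cells that they meet. -/
theorem cell_subset {l h x : ℝ} {k₁ k₂ : ℤ} (hh : 0 < h) (h1 : l ≤ x) (h2 : x < l + h)
    (h3 : l + k₁ * h ≤ x) (h4 : x < l + k₂ * h) : l + k₁ * h ≤ l ∧ l + h ≤ l + k₂ * h := by
  have hk1 : k₁ ≤ 0 := by
    by_contra hc
    have : (1 : ℝ) ≤ k₁ := by exact_mod_cast (not_le.1 hc)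
    nlinarith
  have hk2 : 1 ≤ k₂ := by
    by_contra hc
    have : (k₂ : ℝ) ≤ 0 := by exact_mod_cast (Int.le_of_lt_add_one (not_le.1 hc))
    nlinarith
  have hk1 : (k₁ : ℝ) ≤ 0 := by exact_mod_cast hk1
  have hk2 : (1 : ℝ) ≤ k₂ := by exact_mod_cast hk2
  constructor <;> nlinarith

/-! ### Nesting of dyadic cubes and of their triples. -/

namespace DyadicCube

variable {d : ℕ} {α : Fin d → Fin 3}

theorem corner_eq (L : DyadicCube d) (i : Fin d) :
    (L.toCube α).corner i = gridPt (α i) L.scale (L.pos i) := rfl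

theorem side_eq (L : DyadicCube d) : (L.toCube α).side = (2 : ℝ) ^ L.scale := rfl

theorem center_eq (L : DyadicCube d) (i : Fin d) :
    (L.toCube α).center i = (L.toCube α).corner i + (2 : ℝ) ^ L.scale / 2 := rfl

theorem scale_lt_iff {L Q : DyadicCube d} :
    L.scale < Q.scale ↔ (2 : ℝ) ^ L.scale < (2 : ℝ) ^ Q.scale :=
  (zpow_lt_zpow_iff_right₀ one_lt_two).symm

theorem countable_dyadicCube : Countable (DyadicCube d) := by
  refine Function.Injective.countable (f := fun L : DyadicCube d => (L.scale, L.pos)) ?_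
  intro L L' h
  simp only [Prod.mk.injEq] at h
  exact DyadicCube.ext h.1 h.2

/-- The residue class modulo `3` that determines to which of the `3^d` tripled lattices the
triple of a dyadic cube belongs. -/
def residue (α : Fin d → Fin 3) (L : DyadicCube d) : Fin d → ZMod 3 := fun i =>
  ((L.scale.negOnePow * (L.pos i - 1) - L.scale * (α i : ℕ) : ℤ) : ZMod 3)

theorem exists_corner_add {L Q : DyadicCube d} (h : L.scale ≤ Q.scale) (i : Fin d) (a : ℤ) :
    ∃ k : ℤ, (Q.toCube α).corner i + a * 2 ^ Q.scale =
      (L.toCube α).corner i + k * 2 ^ L.scale := by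
  obtain ⟨j, hj⟩ := Int.eq_ofNat_of_zero_le (sub_nonneg.2 h)
  obtain ⟨q, hq, -⟩ := gridPt_add_nat (α i) L.scale j (Q.pos i + a)
  refine ⟨q - L.pos i, ?_⟩
  rw [corner_eq, corner_eq, gridPt_add_mul, gridPt_add_mul,
    show Q.scale = L.scale + j by omega, hq]
  congr 1; ring

theorem subset_box {L Q : DyadicCube d} (h : L.scale ≤ Q.scale) {a b : ℤ} {x : Rd d}
    (hx : x ∈ (L.toCube α).toSet)
    (hQ : ∀ i, (Q.toCube α).corner i + a * 2 ^ Q.scale ≤ x i ∧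
      x i < (Q.toCube α).corner i + b * 2 ^ Q.scale) {y : Rd d}
    (hy : y ∈ (L.toCube α).toSet) (i : Fin d) :
    (Q.toCube α).corner i + a * 2 ^ Q.scale ≤ y i ∧
      y i < (Q.toCube α).corner i + b * 2 ^ Q.scale := by
  obtain ⟨k₁, h₁⟩ := exists_corner_add (α := α) h i a
  obtain ⟨k₂, h₂⟩ := exists_corner_add (α := α) h i b
  have hi := hQ i
  have hxi := hx i
  have hyi := hy i
  rw [h₁, h₂] at hi ⊢
  rw [side_eq] at hxi hyi
  have := cell_subset (zpow_pos two_pos _) hxi.1 hxi.2 hi.1 hi.2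
  exact ⟨this.1.trans hyi.1, hyi.2.trans_le this.2⟩

theorem toSet_subset_of_mem {L Q : DyadicCube d} (h : L.scale ≤ Q.scale) {x : Rd d}
    (hx : x ∈ (L.toCube α).toSet) (hQ : x ∈ (Q.toCube α).toSet) :
    (L.toCube α).toSet ⊆ (Q.toCube α).toSet := by
  intro y hy i
  have := subset_box (a := 0) (b := 1) h hx
    (fun i => by simpa [side_eq] using hQ i) hy i
  simpa [side_eq] using this

theorem toSet_subset_dilate_three_of_mem {L Q : DyadicCube d} (h : L.scale ≤ Q.scale)
    {x : Rd d} (hx : x ∈ (L.toCube α).toSet) (hQ : x ∈ (Q.toCube α).dilate 3) :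
    (L.toCube α).toSet ⊆ (Q.toCube α).dilate 3 := by
  rw [Cube.mem_dilate_three] at hQ
  intro y hy
  rw [Cube.mem_dilate_three]
  intro i
  have := subset_box (a := -1) (b := 2) h hx
    (fun i => by simpa [side_eq, ← sub_eq_add_neg] using hQ i) hy i
  simpa [side_eq, ← sub_eq_add_neg] using this

theorem eq_of_mem {L Q : DyadicCube d} (h : L.scale = Q.scale) {x : Rd d}
    (hx : x ∈ (L.toCube α).toSet) (hQ : x ∈ (Q.toCube α).toSet) : L = Q := by
  have h1 := toSet_subset_of_mem h.le hx hQ (Cube.corner_mem_toSet _)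
  have h2 := toSet_subset_of_mem h.ge hQ hx (Cube.corner_mem_toSet _)
  refine DyadicCube.ext h (funext fun i => ?_)
  have h3 : (L.toCube α).corner i = (Q.toCube α).corner i := le_antisymm (h2 i).1 (h1 i).1
  rw [corner_eq, corner_eq, h] at h3
  exact gridPt_injective _ _ h3

theorem exists_mem (α : Fin d → Fin 3) (s : ℤ) (x : Rd d) :
    ∃ L : DyadicCube d, L.scale = s ∧ x ∈ (L.toCube α).toSet := by
  have h2 : (0 : ℝ) < (2 : ℝ) ^ s := zpow_pos two_pos _
  refine ⟨⟨s, fun i => ⌊x i / 2 ^ s - (-1 : ℝ) ^ s * (((α i : ℕ) : ℝ) / 3)⌋⟩, rfl, fun i => ?_⟩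
  have h3 := Int.floor_le (x i / 2 ^ s - (-1 : ℝ) ^ s * (((α i : ℕ) : ℝ) / 3))
  have h4 := Int.lt_floor_add_one (x i / 2 ^ s - (-1 : ℝ) ^ s * (((α i : ℕ) : ℝ) / 3))
  simp only [toCube]
  constructor
  · rw [← le_div_iff₀' h2]
    linarith
  · rw [← mul_add_one, ← div_lt_iff₀' h2]
    linarith

theorem exists_parent (α : Fin d → Fin 3) (L : DyadicCube d) :
    ∃ P : DyadicCube d, P.scale = L.scale + 1 ∧ (L.toCube α).toSet ⊆ (P.toCube α).toSet := by
  obtain ⟨P, hP, hm⟩ := exists_mem α (L.scale + 1) (L.toCube α).corner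
  exact ⟨P, hP, toSet_subset_of_mem (by omega) (Cube.corner_mem_toSet _) hm⟩

theorem volume_toSet (L : DyadicCube d) :
    volume (L.toCube α).toSet = ENNReal.ofReal ((2 : ℝ) ^ L.scale) ^ d :=
  Cube.volume_toSet _

/-- The triple of a dyadic cube. -/
noncomputable def triple (α : Fin d → Fin 3) (L : DyadicCube d) : Cube d :=
  (L.toCube α).dilation 3 (by norm_num)

theorem toSet_triple (L : DyadicCube d) : (L.triple α).toSet = (L.toCube α).dilate 3 :=
  Cube.toSet_dilation _ _

theorem triple_injective : Function.Injective (triple (d := d) α) := by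
  intro L Q h
  have hs : L.scale = Q.scale := by
    have := congrArg Cube.side h
    simp only [triple, Cube.dilation, side_eq] at this
    exact zpow_right_injective₀ two_pos (by norm_num) (mul_left_cancel₀ three_ne_zero this)
  refine DyadicCube.ext hs (funext fun i => ?_)
  have := congrFun (congrArg Cube.corner h) i
  simp only [triple, Cube.dilation, side_eq, center_eq, hs] at this
  have : (L.toCube α).corner i = (Q.toCube α).corner i := by linarith
  rw [corner_eq, corner_eq, hs] at this
  exact gridPt_injective _ _ this

/-- Three lattice theorem: the triples of the dyadic cubes of one residue class are nested. -/
theorem dilate_three_subset {L Q : DyadicCube d} (h : L.scale ≤ Q.scale)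
    (hr : residue α L = residue α Q)
    (hx : ((L.toCube α).dilate 3 ∩ (Q.toCube α).dilate 3).Nonempty) :
    (L.toCube α).dilate 3 ⊆ (Q.toCube α).dilate 3 := by
  obtain ⟨x, hxL, hxQ⟩ := hx
  rw [Cube.mem_dilate_three] at hxL hxQ
  intro y hy
  rw [Cube.mem_dilate_three] at hy ⊢
  intro i
  obtain ⟨j, hj⟩ := Int.eq_ofNat_of_zero_le (sub_nonneg.2 h)
  have hjs : Q.scale = L.scale + j := by omega
  obtain ⟨q, hq, h3⟩ := gridPt_add_nat (α i) L.scale j (Q.pos i - 1)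
  -- The triple of a cube starts one cell to the left, at position `pos - 1`. By the invariant of
  -- `gridPt_add_nat`, equal residues place the starting points of both triples in one coset of the
  -- lattice of step `3 * 2 ^ L.scale`.
  have hk : ∃ k : ℤ, (Q.toCube α).corner i - (Q.toCube α).side =
      ((L.toCube α).corner i - (L.toCube α).side) + k * (3 * 2 ^ L.scale) := by
    have hr := congrFun hr i
    simp only [residue] at hr
    have h4 := (ZMod.intCast_eq_intCast_iff_dvd_sub _ _ _).1 hr
    rw [hjs] at h4
    have h5 : (3 : ℤ) ∣ L.scale.negOnePow * (q - (L.pos i - 1)) := by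
      have := dvd_sub h4 h3
      ring_nf at this ⊢
      exact this
    have h6 : (3 : ℤ) ∣ q - (L.pos i - 1) := by
      rcases Int.units_eq_one_or L.scale.negOnePow with h7 | h7 <;> rw [h7] at h5
      · simpa using h5
      · simpa [dvd_sub_comm] using h5
    obtain ⟨k, hk⟩ := h6
    refine ⟨k, ?_⟩
    have e1 : (Q.toCube α).corner i - (Q.toCube α).side = gridPt (α i) Q.scale (Q.pos i - 1) := by
      rw [corner_eq, side_eq, sub_eq_add_neg (Q.pos i), ← gridPt_add_mul]; push_cast; ring
    have e2 : (L.toCube α).corner i - (L.toCube α).side = gridPt (α i) L.scale (L.pos i - 1) := by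
      rw [corner_eq, side_eq, sub_eq_add_neg (L.pos i), ← gridPt_add_mul]; push_cast; ring
    rw [e1, e2, hjs, hq, show (k : ℝ) * (3 * 2 ^ L.scale) = ((3 * k : ℤ) : ℝ) * 2 ^ L.scale by
      push_cast; ring, gridPt_add_mul, ← hk]
    congr 1; ring
  obtain ⟨k, hk⟩ := hk
  have hs : (Q.toCube α).side = (2 : ℝ) ^ j * 2 ^ L.scale := by
    rw [side_eq, hjs, zpow_add₀ two_ne_zero, zpow_natCast]; ring
  -- The side of the larger triple is `2 ^ j` steps of that lattice, so its right end is a lattice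
  -- point too and `cell_subset` applies.
  have e3 : (Q.toCube α).corner i + 2 * (Q.toCube α).side =
      ((L.toCube α).corner i - (L.toCube α).side) + (k + 2 ^ j : ℤ) * (3 * 2 ^ L.scale) := by
    have : (Q.toCube α).corner i + 2 * (Q.toCube α).side =
      (Q.toCube α).corner i - (Q.toCube α).side + 3 * (Q.toCube α).side := by ring
    rw [this, hk, hs]; push_cast; ring
  have hi := hxQ i
  have hl := hxL i
  have hyi := hy i
  rw [hk, e3] at hi ⊢
  have hc := cell_subset (mul_pos three_pos (zpow_pos two_pos L.scale)) hl.1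
    (by have := hl.2; rw [side_eq] at this ⊢; linarith) hi.1 hi.2
  rw [side_eq] at hyi hc ⊢
  constructor <;> linarith [hc.1, hc.2]

end DyadicCube

/-! ### Averages and the maximal function -/

section Averages

variable {d : ℕ} {p : ℝ≥0∞}

theorem avg_eq (p : ℝ≥0∞) (f : Rd d → ℝ) (Q : Cube d) :
    avg p f Q = eLpNorm f p (volume.restrict Q.toSet) / volume Q.toSet ^ (p⁻¹).toReal := by
  rw [avg, eLpNorm_indicator_eq_eLpNorm_restrict Q.measurableSet_toSet]

theorem volume_rpow_ne_zero (Q : Cube d) (a : ℝ) : volume Q.toSet ^ a ≠ 0 := by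
  simp [ENNReal.rpow_eq_zero_iff, Q.volume_toSet_ne_zero, Q.volume_toSet_ne_top]

theorem volume_rpow_ne_top (Q : Cube d) (a : ℝ) : volume Q.toSet ^ a ≠ ∞ := by
  simp [ENNReal.rpow_eq_top_iff, Q.volume_toSet_ne_zero, Q.volume_toSet_ne_top]

theorem avg_mul_volume_rpow (p : ℝ≥0∞) (f : Rd d → ℝ) (Q : Cube d) :
    avg p f Q * volume Q.toSet ^ (p⁻¹).toReal = eLpNorm f p (volume.restrict Q.toSet) := by
  rw [avg_eq, ENNReal.div_mul_cancel (volume_rpow_ne_zero Q _) (volume_rpow_ne_top Q _)]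

theorem avg_rpow_mul_volume (hp0 : p ≠ 0) (hp : p ≠ ∞) (f : Rd d → ℝ) (Q : Cube d) :
    avg p f Q ^ p.toReal * volume Q.toSet = ∫⁻ x in Q.toSet, ‖f x‖ₑ ^ p.toReal := by
  have h := ENNReal.toReal_pos hp0 hp
  have h1 := congrArg (· ^ p.toReal) (avg_mul_volume_rpow p f Q)
  rw [ENNReal.mul_rpow_of_nonneg _ _ h.le, ← ENNReal.rpow_mul, ENNReal.toReal_inv,
    inv_mul_cancel₀ h.ne', ENNReal.rpow_one, eLpNorm_eq_lintegral_rpow_enorm_toReal hp0 hp,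
    ← ENNReal.rpow_mul, one_div_mul_cancel h.ne', ENNReal.rpow_one] at h1
  exact h1

theorem toReal_inv_le_one (hp : 1 ≤ p) : (p⁻¹).toReal ≤ 1 :=
  ENNReal.toReal_le_of_le_ofReal zero_le_one (by simpa using hp)

/-- The natural factor is `c ^ (1/p)`; it is enlarged to `c` so that the constants do not depend on
`p`. -/
theorem avg_le_of_subset (hp : 1 ≤ p) (f : Rd d → ℝ) {Q Q' : Cube d}
    (h : Q.toSet ⊆ Q'.toSet) {c : ℝ≥0∞} (hc : 1 ≤ c)
    (hv : volume Q'.toSet ≤ c * volume Q.toSet) : avg p f Q ≤ c * avg p f Q' := by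
  have h1 : eLpNorm f p (volume.restrict Q.toSet) ≤ eLpNorm f p (volume.restrict Q'.toSet) :=
    eLpNorm_mono_measure _ (Measure.restrict_mono h le_rfl)
  have h2 : volume Q'.toSet ^ (p⁻¹).toReal ≤ c * volume Q.toSet ^ (p⁻¹).toReal := by
    calc volume Q'.toSet ^ (p⁻¹).toReal ≤ (c * volume Q.toSet) ^ (p⁻¹).toReal :=
          ENNReal.rpow_le_rpow hv ENNReal.toReal_nonneg
      _ = c ^ (p⁻¹).toReal * volume Q.toSet ^ (p⁻¹).toReal :=
          ENNReal.mul_rpow_of_nonneg _ _ ENNReal.toReal_nonneg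
      _ ≤ c * volume Q.toSet ^ (p⁻¹).toReal := by
          gcongr
          exact (ENNReal.rpow_le_rpow_of_exponent_le hc (toReal_inv_le_one hp)).trans_eq
            (ENNReal.rpow_one c)
  rw [avg_eq, ENNReal.div_le_iff (volume_rpow_ne_zero Q _) (volume_rpow_ne_top Q _)]
  calc eLpNorm f p (volume.restrict Q.toSet) ≤ eLpNorm f p (volume.restrict Q'.toSet) := h1
    _ = avg p f Q' * volume Q'.toSet ^ (p⁻¹).toReal := (avg_mul_volume_rpow p f Q').symm
    _ ≤ avg p f Q' * (c * volume Q.toSet ^ (p⁻¹).toReal) := by gcongr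
    _ = _ := by ring

theorem avg_add_le (hp : 1 ≤ p) {f g : Rd d → ℝ} (hf : AEStronglyMeasurable f volume)
    (hg : AEStronglyMeasurable g volume) (Q : Cube d) :
    avg p (f + g) Q ≤ avg p f Q + avg p g Q := by
  rw [avg_eq, avg_eq, avg_eq, ← ENNReal.add_div]
  gcongr
  exact eLpNorm_add_le hf.restrict hg.restrict hp

theorem avg_congr {f g : Rd d → ℝ} {Q : Cube d} (h : f =ᵐ[volume.restrict Q.toSet] g) :
    avg p f Q = avg p g Q := by
  rw [avg_eq, avg_eq, eLpNorm_congr_ae h]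

theorem avg_neg (p : ℝ≥0∞) (f : Rd d → ℝ) (Q : Cube d) : avg p (-f) Q = avg p f Q := by
  rw [avg_eq, avg_eq, eLpNorm_neg]

theorem avg_le_eLpNorm_top {f : Rd d → ℝ} (hf : AEStronglyMeasurable f volume)
    (Q : Cube d) : avg p f Q ≤ eLpNorm f ∞ volume := by
  rw [avg_eq, ENNReal.div_le_iff (volume_rpow_ne_zero Q _) (volume_rpow_ne_top Q _)]
  have h := eLpNorm_le_eLpNorm_mul_rpow_measure_univ (f := f) (μ := volume.restrict Q.toSet)
    (le_top : p ≤ ∞) hf.restrict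
  refine h.trans ?_
  simp only [Measure.restrict_apply_univ, ENNReal.toReal_top, div_zero, sub_zero, one_div,
    ENNReal.toReal_inv]
  gcongr
  exact Measure.restrict_le_self

theorem lintegral_enorm_le_avg_mul (hp : 1 ≤ p) {f : Rd d → ℝ} {Q : Cube d}
    (hf : AEStronglyMeasurable f (volume.restrict Q.toSet)) :
    ∫⁻ x in Q.toSet, ‖f x‖ₑ ≤ avg p f Q * volume Q.toSet := by
  have h := eLpNorm_le_eLpNorm_mul_rpow_measure_univ (μ := volume.restrict Q.toSet)
    hp hf
  rw [eLpNorm_one_eq_lintegral_enorm, ← avg_mul_volume_rpow] at h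
  refine h.trans_eq ?_
  rw [Measure.restrict_apply_univ, mul_assoc,
    ← ENNReal.rpow_add _ _ Q.volume_toSet_ne_zero Q.volume_toSet_ne_top]
  simp

theorem ofReal_abs_integral_le_avg_mul (hp : 1 ≤ p) {f : Rd d → ℝ}
    (hf : AEStronglyMeasurable f volume) (Q : Cube d) :
    ENNReal.ofReal |∫ x in Q.toSet, f x| ≤ avg p f Q * volume Q.toSet := by
  rw [← Real.enorm_eq_ofReal_abs]
  exact (enorm_integral_le_lintegral_enorm _).trans (lintegral_enorm_le_avg_mul hp hf.restrict)

theorem avg_const_smul (p : ℝ≥0∞) (c : ℝ) (f : Rd d → ℝ) (Q : Cube d) :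
    avg p (c • f) Q = ‖c‖ₑ * avg p f Q := by
  rw [avg_eq, avg_eq, eLpNorm_const_smul, mul_div_assoc]

theorem maxFn_const_smul (p : ℝ≥0∞) (c : ℝ) (f : Rd d → ℝ) (x : Rd d) :
    maxFn p (c • f) x = ‖c‖ₑ * maxFn p f x := by
  simp only [maxFn, avg_const_smul, ENNReal.mul_iSup]

theorem avg_le_maxFn (p : ℝ≥0∞) (f : Rd d → ℝ) {Q : Cube d} {x : Rd d} (hx : x ∈ Q.toSet) :
    avg p f Q ≤ maxFn p f x :=
  le_iSup₂_of_le Q hx le_rfl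

theorem maxFn_add_le (hp : 1 ≤ p) {f g : Rd d → ℝ} (hf : AEStronglyMeasurable f volume)
    (hg : AEStronglyMeasurable g volume) (x : Rd d) :
    maxFn p (f + g) x ≤ maxFn p f x + maxFn p g x :=
  iSup₂_le fun Q hQ => (avg_add_le hp hf hg Q).trans
    (add_le_add (avg_le_maxFn p f hQ) (avg_le_maxFn p g hQ))

theorem maxFn_neg (p : ℝ≥0∞) (f : Rd d → ℝ) (x : Rd d) : maxFn p (-f) x = maxFn p f x := by
  simp only [maxFn, avg_neg]

theorem maxFn_le_eLpNorm_top {f : Rd d → ℝ} (hf : AEStronglyMeasurable f volume)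
    (x : Rd d) : maxFn p f x ≤ eLpNorm f ∞ volume :=
  iSup₂_le fun Q _ => avg_le_eLpNorm_top hf Q

/-- The weak type `(1,1)` inequality for the maximal function over cubes. -/
theorem measure_exists_cube_lt_lintegral_le (hd : 0 < d) (g : Rd d → ℝ≥0∞)
    (hg : ∫⁻ x, g x ≠ ∞) {t : ℝ≥0∞} (ht0 : t ≠ 0) (ht : t ≠ ∞) :
    volume {x : Rd d | ∃ Q : Cube d, x ∈ Q.toSet ∧
      t * volume Q.toSet < ∫⁻ y in Q.toSet, g y} ≤ 4 ^ d * ((∫⁻ x, g x) / t) := by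
  set T : Set (Cube d) := {Q | t * volume Q.toSet < ∫⁻ y in Q.toSet, g y} with hT
  set J := (∫⁻ x, g x) / t with hJ
  have hJt : J ≠ ∞ := ENNReal.div_ne_top hg ht0
  -- Balls of the maximum norm are cubes, so each cube has the same volume as the closed ball
  -- containing it and no geometric constant is lost.
  have hsub : ∀ Q : Cube d, Q.toSet ⊆ Metric.closedBall Q.center (Q.side / 2) := by
    intro Q x hx
    rw [Metric.mem_closedBall, dist_pi_le_iff (by linarith [Q.side_pos])]
    intro i
    have := hx i
    rw [Real.dist_eq, abs_le]
    simp only [Cube.center]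
    constructor <;> linarith
  have hvol : ∀ (Q : Cube d) (c : ℝ), 0 ≤ c →
      volume (Metric.closedBall Q.center (c * (Q.side / 2))) =
        ENNReal.ofReal c ^ d * volume Q.toSet := by
    intro Q c hc
    rw [Real.volume_pi_closedBall _ (mul_nonneg hc (by linarith [Q.side_pos])), Q.volume_toSet,
      ← mul_pow, ← ENNReal.ofReal_mul hc, Fintype.card_fin,
      ENNReal.ofReal_pow (by have := Q.side_pos; positivity)]
    congr 2; ring
  -- The Vitali lemma needs bounded radii. Here `|Q| ≤ J`, and a side that is at least `1` is at
  -- most its `d`-th power, since `d > 0`.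
  have hbd : ∀ Q ∈ T, Q.side / 2 ≤ (max 1 J).toReal := by
    intro Q hQ
    have h1 : volume Q.toSet ≤ J := by
      rw [hJ, ENNReal.le_div_iff_mul_le (Or.inl ht0) (Or.inl ht), mul_comm]
      exact hQ.le.trans (setLIntegral_le_lintegral _ _)
    rw [Q.volume_toSet] at h1
    have h2 : ENNReal.ofReal Q.side ≤ max 1 J := by
      rcases le_total 1 (ENNReal.ofReal Q.side) with h | h
      · exact le_max_of_le_right ((le_self_pow₀ h hd.ne').trans h1)
      · exact le_max_of_le_left h
    have h3 : Q.side ≤ (max 1 J).toReal :=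
      (ENNReal.ofReal_le_iff_le_toReal (by simp [hJt])).1 h2
    linarith [Q.side_pos]
  -- Any enlargement factor above `3` is allowed; the choice `4` gives the constant `4 ^ d`.
  obtain ⟨u, huT, hdisj, hcov⟩ :=
    Vitali.exists_disjoint_subfamily_covering_enlargement_closedBall T Cube.center
      (fun Q => Q.side / 2) _ hbd 4 (by norm_num)
  have huc : u.Countable := by
    refine hdisj.countable_of_nonempty_interior fun Q _ => ?_
    refine ⟨Q.center, mem_interior_iff_mem_nhds.2 (Metric.closedBall_mem_nhds _ ?_)⟩
    exact half_pos Q.side_pos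
  have := huc.to_subtype
  calc volume {x : Rd d | ∃ Q : Cube d, x ∈ Q.toSet ∧ t * volume Q.toSet < ∫⁻ y in Q.toSet, g y}
      ≤ volume (⋃ Q : u, Metric.closedBall Q.1.center (4 * (Q.1.side / 2))) := by
        refine measure_mono ?_
        rintro x ⟨Q, hx, hQ⟩
        obtain ⟨b, hb, hbQ⟩ := hcov Q hQ
        exact mem_iUnion.2 ⟨⟨b, hb⟩, hbQ (hsub Q hx)⟩
    _ ≤ ∑' Q : u, volume (Metric.closedBall Q.1.center (4 * (Q.1.side / 2))) :=
        measure_iUnion_le _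
    _ = ∑' Q : u, 4 ^ d * volume Q.1.toSet := by
        refine tsum_congr fun Q => ?_
        rw [hvol _ _ (by norm_num)]; norm_num
    _ ≤ ∑' Q : u, 4 ^ d * ((∫⁻ y in Metric.closedBall Q.1.center (Q.1.side / 2), g y) / t) := by
        refine ENNReal.tsum_le_tsum fun Q => ?_
        gcongr
        rw [ENNReal.le_div_iff_mul_le (Or.inl ht0) (Or.inl ht), mul_comm]
        exact (huT Q.2).le.trans (lintegral_mono_set (hsub Q.1))
    _ = 4 ^ d * ((∑' Q : u, ∫⁻ y in Metric.closedBall Q.1.center (Q.1.side / 2), g y) / t) := by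
        simp only [div_eq_mul_inv]
        rw [ENNReal.tsum_mul_left, ENNReal.tsum_mul_right]
    _ = 4 ^ d * ((∫⁻ y in ⋃ Q : u, Metric.closedBall Q.1.center (Q.1.side / 2), g y) / t) := by
        rw [lintegral_iUnion (fun _ => Metric.isClosed_closedBall.measurableSet)]
        intro a b hab
        exact hdisj a.2 b.2 (fun h => hab (Subtype.ext h))
    _ ≤ 4 ^ d * J := by
        rw [hJ]
        gcongr
        exact Measure.restrict_le_self

/-- This is the weak `(1,1)` inequality applied to `|f| ^ p` at height `t ^ p`. -/
theorem measure_lt_maxFn_le (hd : 0 < d) (hp0 : p ≠ 0) (hp : p ≠ ∞) {f : Rd d → ℝ}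
    (hf : MemLp f p volume) {t : ℝ≥0∞} (ht0 : t ≠ 0) (ht : t ≠ ∞) :
    volume {x | t < maxFn p f x} ≤ 4 ^ d * (eLpNorm f p volume / t) ^ p.toReal := by
  have h := ENNReal.toReal_pos hp0 hp
  have e : eLpNorm f p volume ^ p.toReal = ∫⁻ x, ‖f x‖ₑ ^ p.toReal := by
    rw [eLpNorm_eq_lintegral_rpow_enorm_toReal hp0 hp, ← ENNReal.rpow_mul,
      one_div_mul_cancel h.ne', ENNReal.rpow_one]
  rw [ENNReal.div_rpow_of_nonneg _ _ h.le, e]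
  have h2 : ∫⁻ x, ‖f x‖ₑ ^ p.toReal ≠ ∞ := by
    rw [← e]; exact ENNReal.rpow_ne_top_of_nonneg h.le hf.2.ne
  refine le_trans (measure_mono ?_) (measure_exists_cube_lt_lintegral_le hd _ h2
    (t := t ^ p.toReal) (by simp [ENNReal.rpow_eq_zero_iff, ht0, ht])
    (ENNReal.rpow_ne_top_of_nonneg h.le ht))
  intro x hx
  simp only [mem_ofPred_eq, maxFn, lt_iSup_iff] at hx
  obtain ⟨Q, hxQ, hQ⟩ := hx
  refine ⟨Q, hxQ, ?_⟩
  rw [← avg_rpow_mul_volume hp0 hp]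
  exact ENNReal.mul_lt_mul_left Q.volume_toSet_ne_zero Q.volume_toSet_ne_top
    (ENNReal.rpow_lt_rpow hQ h)

end Averages

/-! ### Truncated operators -/

section Truncations

variable {d : ℕ} {K : KernelFamily d}

theorem IsKernelFamily.exists_bound (hK : IsKernelFamily K) (s : ℤ) :
    ∃ B : ℝ, 0 ≤ B ∧ ∀ x, ∀ᵐ y, |K s x y| ≤ B := by
  set A := ⨆ x : Rd d, (eLpNorm (fun y => K s x y) ∞ volume +
    eLpNorm (fun y => K s y x) ∞ volume) with hA
  have h1 : (2 : ℝ≥0∞) ^ (s * (d : ℤ)) * A ≤ sizeNorm K :=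
    le_iSup (fun s : ℤ => (2 : ℝ≥0∞) ^ (s * (d : ℤ)) *
    ⨆ x : Rd d, (eLpNorm (fun y => K s x y) ∞ volume + eLpNorm (fun y => K s y x) ∞ volume)) s
  have hAt : A ≠ ∞ := by
    intro h
    rw [h, ENNReal.mul_top (ENNReal.zpow_pos two_ne_zero ENNReal.ofNat_ne_top _).ne'] at h1
    exact absurd hK.size_lt (not_lt.2 h1)
  refine ⟨A.toReal, ENNReal.toReal_nonneg, fun x => ?_⟩
  have h2 : eLpNorm (fun y => K s x y) ∞ volume ≤ A :=
    le_self_add.trans (le_iSup (fun x : Rd d => (eLpNorm (fun y => K s x y) ∞ volume +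
    eLpNorm (fun y => K s y x) ∞ volume)) x)
  rw [eLpNorm_exponent_top] at h2
  filter_upwards [ae_le_eLpNormEssSup (f := fun y => K s x y) (μ := volume)] with y hy
  have h3 := ENNReal.toReal_mono hAt (hy.trans h2)
  rwa [toReal_enorm, Real.norm_eq_abs] at h3

theorem IsKernelFamily.integrable_mul (hK : IsKernelFamily K) (s : ℤ) (x : Rd d)
    {u : Rd d → ℝ} (hu : Integrable u) : Integrable fun y => K s x y * u y := by
  obtain ⟨B, -, hB⟩ := hK.exists_bound s
  refine hu.bdd_mul (c := B) ?_ (hB x)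
  exact ((hK.measurable s).comp measurable_prodMk_left).aestronglyMeasurable

/-- Replacing `u` by a measurable representative changes the integral for no `x`, so the result is
measurable and not merely almost everywhere measurable. -/
theorem IsKernelFamily.measurable_integral (hK : IsKernelFamily K) (s : ℤ)
    {u : Rd d → ℝ} (hu : AEStronglyMeasurable u volume) :
    Measurable fun x => ∫ y, K s x y * u y := by
  have h : (fun x => ∫ y, K s x y * u y) = fun x => ∫ y, K s x y * hu.mk u y := by
    ext x
    refine integral_congr_ae ?_
    filter_upwards [hu.ae_eq_mk] with y hy
    rw [hy]
  rw [h]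
  have h2 : StronglyMeasurable (Function.uncurry fun x y => K s x y * hu.mk u y) :=
    ((hK.measurable s).mul (hu.stronglyMeasurable_mk.measurable.comp measurable_snd)).stronglyMeasurable
  exact h2.integral_prod_right.measurable

theorem truncT_congr {u v : Rd d → ℝ} (h : u =ᵐ[volume] v) (x : Rd d) (t₁ t₂ : ℤ) :
    truncT K u x t₁ t₂ = truncT K v x t₁ t₂ := by
  refine Finset.sum_congr rfl fun s _ => integral_congr_ae ?_
  filter_upwards [h] with y hy
  rw [hy]

theorem linT_congr {u v : Rd d → ℝ} (h : u =ᵐ[volume] v) (t₁ t₂ : Rd d → ℤ) :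
    linT K t₁ t₂ u = linT K t₁ t₂ v :=
  funext fun x => truncT_congr h x _ _

theorem linT_add (hK : IsKernelFamily K) {u v : Rd d → ℝ} (hu : Integrable u)
    (hv : Integrable v) (t₁ t₂ : Rd d → ℤ) :
    linT K t₁ t₂ (u + v) = linT K t₁ t₂ u + linT K t₁ t₂ v := by
  ext x
  simp only [linT, truncT, Pi.add_apply, mul_add, ← Finset.sum_add_distrib]
  exact Finset.sum_congr rfl fun s _ =>
    integral_add (hK.integrable_mul s x hu) (hK.integrable_mul s x hv)

theorem linT_smul (c : ℝ) (u : Rd d → ℝ) (t₁ t₂ : Rd d → ℤ) :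
    linT K t₁ t₂ (c • u) = c • linT K t₁ t₂ u := by
  ext x
  simp only [linT, truncT, Pi.smul_apply, smul_eq_mul, mul_left_comm _ c, integral_const_mul,
    Finset.mul_sum]

theorem IsTruncation.exists_bound {t₁ t₂ : Rd d → ℤ} (h₁ : IsTruncation t₁)
    (h₂ : IsTruncation t₂) : ∃ M : ℤ, ∀ x, |t₁ x| ≤ M ∧ |t₂ x| ≤ M := by
  obtain ⟨-, M₁, h₁⟩ := h₁
  obtain ⟨-, M₂, h₂⟩ := h₂
  exact ⟨max M₁ M₂, fun x => ⟨le_max_of_le_left (h₁ x), le_max_of_le_right (h₂ x)⟩⟩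

theorem IsTruncation.min_const {t : Rd d → ℤ} (h : IsTruncation t) (s : ℤ) :
    IsTruncation fun z => min (t z) s := by
  obtain ⟨hm, M, hM⟩ := h
  refine ⟨hm.min measurable_const, max M |s|, fun x => ?_⟩
  rcases min_choice (t x) s with h | h <;> simp only [h]
  · exact le_max_of_le_left (hM x)
  · exact le_max_right _ _

theorem measurable_linT (hK : IsKernelFamily K) {u : Rd d → ℝ}
    (hu : AEStronglyMeasurable u volume) {t₁ t₂ : Rd d → ℤ} (h₁ : IsTruncation t₁)
    (h₂ : IsTruncation t₂) : Measurable (linT K t₁ t₂ u) := by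
  obtain ⟨M, hM⟩ := h₁.exists_bound h₂
  have h : linT K t₁ t₂ u = fun x => ∑ s ∈ Finset.Ioc (-M) M,
      ({x | t₁ x < s} ∩ {x | s ≤ t₂ x}).indicator (fun x => ∫ y, K s x y * u y) x := by
    ext x
    obtain ⟨hx1, hx2⟩ := hM x
    rw [abs_le] at hx1 hx2
    simp only [indicator_apply, mem_inter_iff, mem_ofPred_eq, linT, truncT]
    rw [← Finset.sum_filter]
    refine Finset.sum_congr ?_ fun _ _ => rfl
    ext s
    simp only [Finset.mem_Ioc, Finset.mem_filter]
    omega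
  rw [h]
  refine Finset.measurable_fun_sum _ fun s _ => ?_
  exact (hK.measurable_integral s hu).indicator
    ((measurableSet_lt h₁.1 measurable_const).inter (measurableSet_le measurable_const h₂.1))

/-- A qualitative bound: it depends on the truncations and on `u`, and serves only to justify
integrability and additivity. -/
theorem exists_bound_linT (hK : IsKernelFamily K) {u : Rd d → ℝ} (hu : Integrable u)
    {t₁ t₂ : Rd d → ℤ} (h₁ : IsTruncation t₁) (h₂ : IsTruncation t₂) :
    ∃ B : ℝ, ∀ x, |linT K t₁ t₂ u x| ≤ B := by
  obtain ⟨M, hM⟩ := h₁.exists_bound h₂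
  choose B hB0 hB using hK.exists_bound
  refine ⟨∑ s ∈ Finset.Ioc (-M) M, B s * ∫ y, |u y|, fun x => ?_⟩
  obtain ⟨hx1, hx2⟩ := hM x
  rw [abs_le] at hx1 hx2
  calc |linT K t₁ t₂ u x| ≤ ∑ s ∈ Finset.Ioc (t₁ x) (t₂ x), |∫ y, K s x y * u y| := by
        simp only [linT, truncT]
        exact Finset.abs_sum_le_sum_abs _ _
    _ ≤ ∑ s ∈ Finset.Ioc (t₁ x) (t₂ x), B s * ∫ y, |u y| := by
        refine Finset.sum_le_sum fun s _ => ?_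
        rw [← integral_const_mul, ← Real.norm_eq_abs]
        refine norm_integral_le_of_norm_le (hu.abs.const_mul _) ?_
        filter_upwards [hB s x] with y hy
        rw [norm_mul, Real.norm_eq_abs, Real.norm_eq_abs]
        exact mul_le_mul_of_nonneg_right hy (abs_nonneg _)
    _ ≤ _ := by
        refine Finset.sum_le_sum_of_subset_of_nonneg (fun s => ?_) fun s _ _ =>
          mul_nonneg (hB0 s) (integral_nonneg fun _ => abs_nonneg _)
        simp only [Finset.mem_Ioc]
        omega

theorem enorm_linT_le_maxT (t₁ t₂ : Rd d → ℤ) (u : Rd d → ℝ) (x : Rd d) :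
    ‖linT K t₁ t₂ u x‖ₑ ≤ maxT K u x := by
  rcases le_total (t₁ x) (t₂ x) with h | h
  · rw [Real.enorm_eq_ofReal_abs]
    exact le_iSup_of_le (t₁ x) (le_iSup₂_of_le (t₂ x) h le_rfl)
  · simp [linT, truncT, Finset.Ioc_eq_empty_of_le h]

/-- The infimum defining the norm is attained. -/
theorem lintegral_maxT_le {r : ℝ} (hN : maxNorm K r < ∞) {f : Rd d → ℝ}
    (hf : MemLp f (ENNReal.ofReal r) volume) :
    (∫⁻ x, maxT K f x ^ r) ^ (1 / r) ≤ maxNorm K r * eLpNorm f (ENNReal.ofReal r) volume := by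
  -- One cannot divide by a vanishing norm. In that case any admissible constant will do, and one
  -- exists because the infimum is finite.
  rcases eq_or_ne (eLpNorm f (ENNReal.ofReal r) volume) 0 with h0 | h0
  · obtain ⟨C, hC⟩ := nonempty_iff_ne_empty.2 fun h : {C : ℝ≥0∞ | ∀ f : Rd d → ℝ,
      MemLp f (ENNReal.ofReal r) volume →
      (∫⁻ x, maxT K f x ^ r) ^ (1 / r) ≤ C * eLpNorm f (ENNReal.ofReal r) volume} = ∅ => by
        rw [maxNorm, h, sInf_empty] at hN; exact hN.ne rfl
    simpa [h0] using hC f hf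
  · rw [← ENNReal.div_le_iff h0 hf.2.ne]
    exact le_sInf fun C hC => (ENNReal.div_le_iff h0 hf.2.ne).2 (hC f hf)

/-- A kernel of scale at most `s_L` moves each coordinate by less than the side of `L`, so functions
on `L` are mapped to functions on `3L`. -/
theorem linT_indicator_eq_zero (hK : IsKernelFamily K) {α : Fin d → Fin 3} (L : DyadicCube d)
    (t₁ t₂ : Rd d → ℤ) (u : Rd d → ℝ) {x : Rd d} (hx : x ∉ (L.toCube α).dilate 3) :
    linT K t₁ (fun z => min (t₂ z) L.scale) ((L.toCube α).toSet.indicator u) x = 0 := by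
  simp only [linT, truncT]
  refine Finset.sum_eq_zero fun s hs => ?_
  rw [Finset.mem_Ioc, le_min_iff] at hs
  rw [← integral_zero (Rd d) ℝ]
  congr 1
  ext y
  by_contra hne
  obtain ⟨hk, hu⟩ := mul_ne_zero_iff.1 hne
  have hy : y ∈ (L.toCube α).toSet := mem_of_indicator_ne_zero hu
  refine hx (Cube.mem_dilate_three.2 fun i => ?_)
  have h1 := (hK.supp s x y hk).trans_le (zpow_le_zpow_right₀ one_le_two hs.2.2)
  have h2 := (norm_le_pi_norm (x - y) i).trans_lt h1
  rw [Pi.sub_apply, Real.norm_eq_abs, abs_lt] at h2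
  have h3 := hy i
  rw [DyadicCube.side_eq] at h3 ⊢
  constructor <;> linarith

/-! ### The pairing over a dyadic cube -/

/-- The pairing of `T[K]` truncated at the scale of `L`, applied to `u 1_L`, with `v`. -/
noncomputable def locPair (K : KernelFamily d) (α : Fin d → Fin 3) (t₁ t₂ : Rd d → ℤ)
    (L : DyadicCube d) (u v : Rd d → ℝ) : ℝ :=
  ∫ x, linT K t₁ (fun z => min (t₂ z) L.scale) ((L.toCube α).toSet.indicator u) x * v x

variable {α : Fin d → Fin 3} {t₁ t₂ : Rd d → ℤ} {L : DyadicCube d}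

theorem locPair_congr_left {u u' : Rd d → ℝ} (v : Rd d → ℝ)
    (h : ∀ᵐ x, x ∈ (L.toCube α).toSet → u x = u' x) :
    locPair K α t₁ t₂ L u v = locPair K α t₁ t₂ L u' v := by
  have : (L.toCube α).toSet.indicator u =ᵐ[volume] (L.toCube α).toSet.indicator u' := by
    filter_upwards [h] with x hx
    by_cases hm : x ∈ (L.toCube α).toSet
    · simp [hm, hx hm]
    · simp [hm]
  rw [locPair, linT_congr this, locPair]

theorem locPair_congr_right (hK : IsKernelFamily K) (u : Rd d → ℝ) {v v' : Rd d → ℝ}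
    (h : ∀ᵐ x, x ∈ (L.toCube α).dilate 3 → v x = v' x) :
    locPair K α t₁ t₂ L u v = locPair K α t₁ t₂ L u v' := by
  refine integral_congr_ae ?_
  filter_upwards [h] with x hx
  by_cases hm : x ∈ (L.toCube α).dilate 3
  · simp only [hx hm]
  · simp only [linT_indicator_eq_zero hK L t₁ t₂ u hm, zero_mul]

theorem integrable_locPair (hK : IsKernelFamily K) (h₁ : IsTruncation t₁) (h₂ : IsTruncation t₂)
    {u v : Rd d → ℝ} (hu : Integrable u) (hv : Integrable v) :
    Integrable fun x => linT K t₁ (fun z => min (t₂ z) L.scale)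
      ((L.toCube α).toSet.indicator u) x * v x := by
  have hi := hu.indicator (L.toCube α).measurableSet_toSet
  obtain ⟨B, hB⟩ := exists_bound_linT hK hi h₁ (h₂.min_const L.scale)
  exact hv.bdd_mul (c := B) (measurable_linT hK hi.1 h₁ (h₂.min_const L.scale)).aestronglyMeasurable
    (Filter.Eventually.of_forall hB)

theorem locPair_add_left (hK : IsKernelFamily K) (h₁ : IsTruncation t₁) (h₂ : IsTruncation t₂)
    {u u' v : Rd d → ℝ} (hu : Integrable u) (hu' : Integrable u') (hv : Integrable v) :
    locPair K α t₁ t₂ L (u + u') v =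
      locPair K α t₁ t₂ L u v + locPair K α t₁ t₂ L u' v := by
  simp only [locPair]
  rw [indicator_add', linT_add hK (hu.indicator (L.toCube α).measurableSet_toSet)
    (hu'.indicator (L.toCube α).measurableSet_toSet)]
  simp only [Pi.add_apply, add_mul]
  exact integral_add (integrable_locPair hK h₁ h₂ hu hv) (integrable_locPair hK h₁ h₂ hu' hv)

theorem locPair_smul_left (c : ℝ) (u v : Rd d → ℝ) :
    locPair K α t₁ t₂ L (c • u) v = c * locPair K α t₁ t₂ L u v := by
  simp only [locPair]
  rw [show (L.toCube α).toSet.indicator (c • u) = c • (L.toCube α).toSet.indicator u from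
    indicator_const_smul _ c u, linT_smul]
  simp only [Pi.smul_apply, smul_eq_mul, mul_assoc, integral_const_mul]

theorem locPair_add_right (hK : IsKernelFamily K) (h₁ : IsTruncation t₁) (h₂ : IsTruncation t₂)
    {u v v' : Rd d → ℝ} (hu : Integrable u) (hv : Integrable v) (hv' : Integrable v') :
    locPair K α t₁ t₂ L u (v + v') =
      locPair K α t₁ t₂ L u v + locPair K α t₁ t₂ L u v' := by
  simp only [locPair, Pi.add_apply, mul_add]
  exact integral_add (integrable_locPair hK h₁ h₂ hu hv) (integrable_locPair hK h₁ h₂ hu hv')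

theorem locPair_smul_right (c : ℝ) (u v : Rd d → ℝ) :
    locPair K α t₁ t₂ L u (c • v) = c * locPair K α t₁ t₂ L u v := by
  simp only [locPair, Pi.smul_apply, smul_eq_mul, mul_left_comm _ c, integral_const_mul]

theorem locPair_sum_left (hK : IsKernelFamily K) (h₁ : IsTruncation t₁) (h₂ : IsTruncation t₂)
    {ι : Type*} (S : Finset ι) {u : ι → Rd d → ℝ} {v : Rd d → ℝ} (hu : ∀ i, Integrable (u i))
    (hv : Integrable v) :
    locPair K α t₁ t₂ L (∑ i ∈ S, u i) v = ∑ i ∈ S, locPair K α t₁ t₂ L (u i) v := by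
  classical
  induction S using Finset.induction_on with
  | empty => simpa using locPair_smul_left (K := K) (α := α) (t₁ := t₁) (t₂ := t₂) (L := L) 0 0 v
  | insert i S hi ih =>
    rw [Finset.sum_insert hi, Finset.sum_insert hi,
      locPair_add_left hK h₁ h₂ (hu i) (integrable_finsetSum' _ fun i _ => hu i) hv, ih]

theorem locPair_sum_right (hK : IsKernelFamily K) (h₁ : IsTruncation t₁) (h₂ : IsTruncation t₂)
    {ι : Type*} (S : Finset ι) {u : Rd d → ℝ} {v : ι → Rd d → ℝ} (hu : Integrable u)
    (hv : ∀ i, Integrable (v i)) :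
    locPair K α t₁ t₂ L u (∑ i ∈ S, v i) = ∑ i ∈ S, locPair K α t₁ t₂ L u (v i) := by
  classical
  induction S using Finset.induction_on with
  | empty => simpa using locPair_smul_right (K := K) (α := α) (t₁ := t₁) (t₂ := t₂) (L := L) 0 u 0
  | insert i S hi ih =>
    rw [Finset.sum_insert hi, Finset.sum_insert hi,
      locPair_add_right hK h₁ h₂ hu (hv i) (integrable_finsetSum' _ fun i _ => hv i), ih]

/-- With `s_L` below `t₁`, every truncated sum is empty. This makes the localized sums finite and
ends the stopping iteration. -/
theorem locPair_eq_zero_of_scale_le (h : ∀ x, L.scale ≤ t₁ x) (u v : Rd d → ℝ) :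
    locPair K α t₁ t₂ L u v = 0 := by
  have : ∀ x, linT K t₁ (fun z => min (t₂ z) L.scale) ((L.toCube α).toSet.indicator u) x = 0 := by
    intro x
    simp [linT, truncT, Finset.Ioc_eq_empty_of_le ((min_le_right (t₂ x) _).trans (h x))]
  simp [locPair, this]

/-- The output lives on `3L`, where Hölder's inequality turns the `L^r` bound into an `L^1` bound.
The factor `3 ^ d` is `|3L| / |L|`. -/
theorem ofReal_abs_locPair_le (hK : IsKernelFamily K) {r : ℝ} (hr : 1 < r)
    (hN : maxNorm K r < ∞) (h₁ : IsTruncation t₁) (h₂ : IsTruncation t₂)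
    {u v : Rd d → ℝ} (hu : Integrable u) (hu' : eLpNorm u ∞ volume < ∞) :
    ENNReal.ofReal |locPair K α t₁ t₂ L u v| ≤
      3 ^ d * maxNorm K r * eLpNorm u ∞ volume * eLpNorm v ∞ volume *
        volume (L.toCube α).toSet := by
  have hr0 : 0 < r := by linarith
  have hr1 : (1 : ℝ≥0∞) ≤ ENNReal.ofReal r := by
    rw [← ENNReal.ofReal_one]; exact ENNReal.ofReal_le_ofReal hr.le
  set F := linT K t₁ (fun z => min (t₂ z) L.scale) ((L.toCube α).toSet.indicator u) with hF
  have hi := hu.indicator (L.toCube α).measurableSet_toSet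
  have hFm : AEStronglyMeasurable F volume :=
    (measurable_linT hK hi.1 h₁ (h₂.min_const L.scale)).aestronglyMeasurable
  have hLT : volume (L.triple α).toSet = 3 ^ d * volume (L.toCube α).toSet := by
    rw [L.toSet_triple, Cube.volume_dilate (by norm_num)]; norm_num
  -- The norm over `L` is deliberately estimated over `3L`, so that the powers of the volume cancel
  -- in the average over the triple.
  have hui : eLpNorm ((L.toCube α).toSet.indicator u) (ENNReal.ofReal r) volume ≤
      eLpNorm u ∞ volume * volume (L.triple α).toSet ^ ((ENNReal.ofReal r)⁻¹).toReal := by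
    rw [eLpNorm_indicator_eq_eLpNorm_restrict (L.toCube α).measurableSet_toSet,
      ← avg_mul_volume_rpow]
    gcongr
    · exact avg_le_eLpNorm_top hu.1 _
    · rw [L.toSet_triple]
      exact Cube.toSet_subset_dilate (by norm_num) _
  have hmem : MemLp ((L.toCube α).toSet.indicator u) (ENNReal.ofReal r) volume :=
    ⟨hi.1, hui.trans_lt (ENNReal.mul_lt_top hu' (volume_rpow_ne_top _ _).lt_top)⟩
  have hFr : eLpNorm F (ENNReal.ofReal r) volume ≤ maxNorm K r *
      (eLpNorm u ∞ volume * volume (L.triple α).toSet ^ ((ENNReal.ofReal r)⁻¹).toReal) := by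
    refine le_trans ?_ ((lintegral_maxT_le hN hmem).trans (by gcongr))
    rw [eLpNorm_eq_lintegral_rpow_enorm_toReal (by simpa using hr0) ENNReal.ofReal_ne_top,
      ENNReal.toReal_ofReal hr0.le]
    gcongr with x
    exact enorm_linT_le_maxT _ _ _ x
  have havg : avg (ENNReal.ofReal r) F (L.triple α) ≤ maxNorm K r * eLpNorm u ∞ volume := by
    rw [avg_eq, ENNReal.div_le_iff (volume_rpow_ne_zero _ _) (volume_rpow_ne_top _ _), mul_assoc]
    exact (eLpNorm_mono_measure F Measure.restrict_le_self).trans hFr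
  have hV : ∀ᵐ x, ‖v x‖ₑ ≤ eLpNorm v ∞ volume := by
    rw [eLpNorm_exponent_top]; exact ae_le_eLpNormEssSup
  calc ENNReal.ofReal |locPair K α t₁ t₂ L u v| = ‖∫ x, F x * v x‖ₑ := by
        rw [Real.enorm_eq_ofReal_abs]; rfl
    _ ≤ ∫⁻ x, ‖F x * v x‖ₑ := enorm_integral_le_lintegral_enorm _
    _ ≤ ∫⁻ x, eLpNorm v ∞ volume * (L.triple α).toSet.indicator (fun x => ‖F x‖ₑ) x := by
        refine lintegral_mono_ae ?_
        filter_upwards [hV] with x hx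
        by_cases hm : x ∈ (L.triple α).toSet
        · rw [indicator_of_mem hm, enorm_mul, mul_comm]
          gcongr
        · rw [L.toSet_triple] at hm
          simp [hF, linT_indicator_eq_zero hK L t₁ t₂ u hm]
    _ = eLpNorm v ∞ volume * ∫⁻ x in (L.triple α).toSet, ‖F x‖ₑ := by
        rw [lintegral_const_mul'' _ (hFm.enorm.indicator (L.triple α).measurableSet_toSet),
          lintegral_indicator (L.triple α).measurableSet_toSet]
    _ ≤ eLpNorm v ∞ volume * ((maxNorm K r * eLpNorm u ∞ volume) *
          (3 ^ d * volume (L.toCube α).toSet)) := by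
        rw [← hLT]
        gcongr
        exact (lintegral_enorm_le_avg_mul hr1 hFm.restrict).trans (by gcongr)
    _ = _ := by ring

end Truncations

/-! ### The localized estimate -/

section Localized

variable {d : ℕ} {K : KernelFamily d} {α : Fin d → Fin 3} {Q : DyadicCube d}
  {𝒬 : Set (DyadicCube d)} {t₁ t₂ : Rd d → ℤ} {p : ℝ≥0∞}

/-! ### Algebra of the localized form. -/

theorem locForm_def (K : KernelFamily d) (α : Fin d → Fin 3) (Q : DyadicCube d)
    (𝒬 : Set (DyadicCube d)) (t₁ t₂ : Rd d → ℤ) (u v : Rd d → ℝ) :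
    locForm K α Q 𝒬 t₁ t₂ u v = (volume.real (Q.toCube α).toSet)⁻¹ *
      (locPair K α t₁ t₂ Q u v -
        ∑' L : {L : DyadicCube d // L ∈ 𝒬 ∧ (L.toCube α).toSet ⊆ (Q.toCube α).toSet},
          locPair K α t₁ t₂ L.1 u v) := rfl

theorem locForm_smul_left (c : ℝ) (u v : Rd d → ℝ) :
    locForm K α Q 𝒬 t₁ t₂ (c • u) v = c * locForm K α Q 𝒬 t₁ t₂ u v := by
  simp only [locForm_def, locPair_smul_left, tsum_mul_left]
  ring

theorem locForm_smul_right (c : ℝ) (u v : Rd d → ℝ) :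
    locForm K α Q 𝒬 t₁ t₂ u (c • v) = c * locForm K α Q 𝒬 t₁ t₂ u v := by
  simp only [locForm_def, locPair_smul_right, tsum_mul_left]
  ring

theorem locForm_eq_zero_left {u : Rd d → ℝ} (hu : u =ᵐ[volume] 0) (v : Rd d → ℝ) :
    locForm K α Q 𝒬 t₁ t₂ u v = 0 := by
  have h : ∀ L, locPair K α t₁ t₂ L u v = 0 := fun L => by
    rw [locPair_congr_left (u' := (0 : ℝ) • u) v, locPair_smul_left, zero_mul]
    filter_upwards [hu] with x hx _
    simpa using hx
  simp [locForm_def, h]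

theorem locForm_eq_zero_right (u : Rd d → ℝ) {v : Rd d → ℝ} (hv : v =ᵐ[volume] 0) :
    locForm K α Q 𝒬 t₁ t₂ u v = 0 := by
  have h : ∀ L, locPair K α t₁ t₂ L u v = 0 := fun L => by
    have : (fun x => linT K t₁ (fun z => min (t₂ z) L.scale)
        ((L.toCube α).toSet.indicator u) x * v x) =ᵐ[volume] fun _ => 0 := by
      filter_upwards [hv] with x hx
      simp [hx]
    rw [locPair, integral_congr_ae this, integral_zero]
  simp [locForm_def, h]

/-- Disjoint subsets of `Q` whose volumes are bounded below are finite in number. -/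
theorem finite_dyadic_subset (m : ℤ)
    (hdisj : ∀ L ∈ 𝒬, ∀ L' ∈ 𝒬,
      ((L.toCube α).toSet ∩ (L'.toCube α).toSet).Nonempty → L = L') :
    {L | L ∈ 𝒬 ∧ (L.toCube α).toSet ⊆ (Q.toCube α).toSet ∧ m < L.scale}.Finite := by
  set S := {L | L ∈ 𝒬 ∧ (L.toCube α).toSet ⊆ (Q.toCube α).toSet ∧ m < L.scale}
  have h := Measure.finite_const_le_meas_of_disjoint_iUnion (ι := S) (volume : Measure (Rd d))
    (ε := ENNReal.ofReal ((2 : ℝ) ^ m) ^ d)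
    (ENNReal.pow_pos (ENNReal.ofReal_pos.2 (zpow_pos two_pos _)) _)
    (As := fun L => (L.1.toCube α).toSet) (fun L => Cube.measurableSet_toSet _)
    (fun L L' hne => by
      rw [Function.onFun, disjoint_iff_inter_eq_empty, ← not_nonempty_iff_eq_empty]
      exact fun hn => hne (Subtype.ext (hdisj _ L.2.1 _ L'.2.1 hn)))
    (((measure_mono (iUnion_subset fun L => L.2.2.1)).trans_lt
      (Cube.volume_toSet_ne_top (Q.toCube α)).lt_top).ne)
  have huniv : {i : S | ENNReal.ofReal ((2 : ℝ) ^ m) ^ d ≤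
      volume ((i.1.toCube α).toSet)} = univ := by
    refine eq_univ_of_forall fun L => ?_
    rw [mem_ofPred_eq, DyadicCube.volume_toSet]
    gcongr
    · exact one_le_two
    · exact L.2.2.2.le
  rw [huniv] at h
  exact Set.finite_coe_iff.1 (finite_univ_iff.1 h)

theorem locForm_eq_sum {m : ℤ} (hm : ∀ x, m ≤ t₁ x) {ch : Finset (DyadicCube d)}
    (hch : ∀ L, L ∈ ch ↔ L ∈ 𝒬 ∧ (L.toCube α).toSet ⊆ (Q.toCube α).toSet ∧ m < L.scale)
    (u v : Rd d → ℝ) :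
    locForm K α Q 𝒬 t₁ t₂ u v = (volume.real (Q.toCube α).toSet)⁻¹ *
      (locPair K α t₁ t₂ Q u v - ∑ L ∈ ch, locPair K α t₁ t₂ L u v) := by
  rw [locForm_def]
  congr 2
  have := tsum_subtype {L : DyadicCube d | L ∈ 𝒬 ∧ (L.toCube α).toSet ⊆ (Q.toCube α).toSet}
    (fun L => locPair K α t₁ t₂ L u v)
  refine this.trans ?_
  rw [tsum_eq_sum (s := ch)]
  · refine Finset.sum_congr rfl fun L hL => indicator_of_mem ?_ _
    exact ⟨((hch L).1 hL).1, ((hch L).1 hL).2.1⟩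
  · intro L hL
    by_cases hL' : L ∈ {L : DyadicCube d | L ∈ 𝒬 ∧ (L.toCube α).toSet ⊆ (Q.toCube α).toSet}
    · rw [indicator_of_mem hL']
      refine locPair_eq_zero_of_scale_le (fun x => ?_) u v
      by_contra hc
      exact hL ((hch L).2 ⟨hL'.1, hL'.2, (hm x).trans_lt (not_le.1 hc)⟩)
    · exact indicator_of_notMem hL' _

theorem locForm_add_left (hK : IsKernelFamily K) (h₁ : IsTruncation t₁) (h₂ : IsTruncation t₂)
    (hst : IsStoppingCollection α Q 𝒬) {u u' v : Rd d → ℝ} (hu : Integrable u)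
    (hu' : Integrable u') (hv : Integrable v) :
    locForm K α Q 𝒬 t₁ t₂ (u + u') v =
      locForm K α Q 𝒬 t₁ t₂ u v + locForm K α Q 𝒬 t₁ t₂ u' v := by
  obtain ⟨M, hM⟩ := h₁.2
  have hm : ∀ x, -M ≤ t₁ x := fun x => (abs_le.1 (hM x)).1
  have hch := fun L => (finite_dyadic_subset (Q := Q) (-M) hst.eq_of_inter).mem_toFinset (a := L)
  simp only [locForm_eq_sum hm hch, locPair_add_left hK h₁ h₂ hu hu' hv, Finset.sum_add_distrib]
  ring

theorem locForm_add_right (hK : IsKernelFamily K) (h₁ : IsTruncation t₁) (h₂ : IsTruncation t₂)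
    (hst : IsStoppingCollection α Q 𝒬) {u v v' : Rd d → ℝ} (hu : Integrable u)
    (hv : Integrable v) (hv' : Integrable v') :
    locForm K α Q 𝒬 t₁ t₂ u (v + v') =
      locForm K α Q 𝒬 t₁ t₂ u v + locForm K α Q 𝒬 t₁ t₂ u v' := by
  obtain ⟨M, hM⟩ := h₁.2
  have hm : ∀ x, -M ≤ t₁ x := fun x => (abs_le.1 (hM x)).1
  have hch := fun L => (finite_dyadic_subset (Q := Q) (-M) hst.eq_of_inter).mem_toFinset (a := L)
  simp only [locForm_eq_sum hm hch, locPair_add_right hK h₁ h₂ hu hv hv', Finset.sum_add_distrib]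
  ring

/-! ### Norms of the localized spaces and extraction of the constant `locConst`. -/

theorem MeasureTheory.MemLp.of_le_of_support {f : Rd d → ℝ} {p q : ℝ≥0∞} (hf : MemLp f p volume)
    (hq : q ≤ p) {A : Set (Rd d)} (hA : MeasurableSet A) (hAt : volume A ≠ ∞)
    (hs : ∀ᵐ x, x ∉ A → f x = 0) : MemLp f q volume := by
  have : IsFiniteMeasure (volume.restrict A) := ⟨by simpa using hAt.lt_top⟩
  have h1 : MemLp f q (volume.restrict A) := (hf.restrict A).mono_exponent hq
  rw [← memLp_indicator_iff_restrict hA] at h1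
  refine h1.ae_eq ?_
  filter_upwards [hs] with x hx
  by_cases h : x ∈ A
  · simp [h]
  · simp [h, hx h]

theorem volume_dilate_three_ne_top (Q : DyadicCube d) :
    volume ((Q.toCube α).dilate 3) ≠ ∞ := by
  rw [← Cube.toSet_dilation (by norm_num)]
  exact Cube.volume_toSet_ne_top _

theorem MemY.integrable {f : Rd d → ℝ} (hp : 1 ≤ p) (hf : MemY α Q 𝒬 p f) : Integrable f :=
  memLp_one_iff_integrable.1 (hf.memLp.of_le_of_support hp
    (Cube.measurableSet_dilate (by norm_num) _) (volume_dilate_three_ne_top Q) hf.supp)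

/-- For every `x` in `32L`, the cube `32L` competes in the maximal function at `x`; the constant is
`|32L| / |L|`. -/
theorem avg_le_mul_normY (hp : 1 ≤ p) (hpt : p ≠ ∞) (f : Rd d → ℝ) {L : DyadicCube d}
    (hL : L ∈ 𝒬) : avg p f (L.toCube α) ≤ 32 ^ d * normY α 𝒬 p f := by
  have h1 : ∀ x ∈ (L.toCube α).dilate (2 ^ 5), avg p f (L.toCube α) / 32 ^ d ≤ maxFn p f x := by
    intro x hx
    rw [← Cube.toSet_dilation (by norm_num)] at hx
    refine le_trans ?_ (avg_le_maxFn p f hx)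
    rw [ENNReal.div_le_iff' (by simp) (by simp)]
    refine avg_le_of_subset hp f ?_ (one_le_pow₀ (by norm_num)) ?_
    · rw [Cube.toSet_dilation]; exact Cube.toSet_subset_dilate (by norm_num) _
    · rw [Cube.toSet_dilation, Cube.volume_dilate (by norm_num)]
      norm_num
  have h2 : avg p f (L.toCube α) / 32 ^ d ≤ normY α 𝒬 p f := by
    rw [normY, if_neg hpt]
    exact le_max_of_le_right (le_iSup₂_of_le L hL (le_iInf₂ h1))
  rwa [ENNReal.div_le_iff' (by simp) (by simp)] at h2

/-- The norm is definite. This settles the case in which a function cannot be normalized. -/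
theorem ae_eq_zero_of_normY_eq_zero (hp : 1 ≤ p) {f : Rd d → ℝ}
    (hf : AEStronglyMeasurable f volume) (h0 : normY α 𝒬 p f = 0) : f =ᵐ[volume] 0 := by
  rcases eq_or_ne p ∞ with rfl | hpt
  · rw [normY, if_pos rfl] at h0
    exact (eLpNorm_eq_zero_iff hf (by simp)).1 h0
  have hc := DyadicCube.countable_dyadicCube (d := d)
  have h1 : ∀ L ∈ 𝒬, ∀ᵐ x, x ∈ (L.toCube α).toSet → f x = 0 := by
    intro L hL
    have h2 := avg_le_mul_normY (α := α) hp hpt f hL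
    rw [h0, mul_zero, nonpos_iff_eq_zero] at h2
    have h3 := avg_mul_volume_rpow p f (L.toCube α)
    rw [h2, zero_mul, eq_comm, eLpNorm_eq_zero_iff hf.restrict (by positivity)] at h3
    exact (ae_restrict_iff' (Cube.measurableSet_toSet _)).1 h3
  have h2 : ∀ᵐ x, x ∉ shadow α 𝒬 → f x = 0 := by
    rw [normY, if_neg hpt, max_eq_zero] at h0
    have hsm : MeasurableSet (shadow α 𝒬) :=
      MeasurableSet.biUnion (to_countable _) fun L _ => Cube.measurableSet_toSet _
    filter_upwards [(eLpNorm_eq_zero_iff (hf.indicator hsm.compl) (by simp)).1 h0.1] with x hx hxs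
    rwa [indicator_of_mem (by simpa using hxs)] at hx
  have h3 : ∀ᵐ x, ∀ L ∈ 𝒬, x ∈ (L.toCube α).toSet → f x = 0 :=
    (ae_ball_iff (to_countable _)).2 h1
  filter_upwards [h2, h3] with x hx2 hx3
  by_cases hx : x ∈ shadow α 𝒬
  · simp only [shadow, mem_iUnion, exists_prop] at hx
    obtain ⟨L, hL, hxL⟩ := hx
    exact hx3 L hL hxL
  · exact hx2 hx

theorem normY_const_smul {c : ℝ} (hc : c ≠ 0) (f : Rd d → ℝ) :
    normY α 𝒬 p (c • f) = ‖c‖ₑ * normY α 𝒬 p f := by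
  have hc0 : ‖c‖ₑ ≠ 0 := by simpa using hc
  rcases eq_or_ne p ∞ with rfl | hpt
  · rw [normY, if_pos rfl, normY, if_pos rfl, eLpNorm_const_smul]
  rw [normY, if_neg hpt, normY, if_neg hpt, mul_max, ENNReal.mul_iSup]
  congr 1
  · rw [show (shadow α 𝒬)ᶜ.indicator (c • f) = c • (shadow α 𝒬)ᶜ.indicator f from
      indicator_const_smul _ c f, eLpNorm_const_smul]
  · refine iSup_congr fun L => ?_
    rw [ENNReal.mul_iSup]
    refine iSup_congr fun _ => ?_
    simp only [maxFn_const_smul, iInf_subtype']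
    rw [ENNReal.mul_iInf_of_ne hc0 enorm_ne_top]

theorem MemY.const_smul {f : Rd d → ℝ} (hf : MemY α Q 𝒬 p f) {c : ℝ} (hc : c ≠ 0) :
    MemY α Q 𝒬 p (c • f) where
  memLp := hf.memLp.const_smul c
  supp := by
    filter_upwards [hf.supp] with x hx h
    simp [hx h]
  norm_lt := by
    rw [normY_const_smul hc]
    exact ENNReal.mul_lt_top enorm_lt_top hf.norm_lt

theorem MemXdot.const_smul {f : Rd d → ℝ} (hf : MemXdot α Q 𝒬 p f) {c : ℝ} (hc : c ≠ 0) :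
    MemXdot α Q 𝒬 p (c • f) where
  memY := hf.memY.const_smul hc
  supp := by
    filter_upwards [hf.supp] with x hx h
    simp [hx h]
  mean_zero := fun L hL => by
    simp [integral_const_mul, hf.mean_zero L hL]

/-- A bound for the localized form on normalized multiples extends by homogeneity. -/
theorem ofReal_abs_locForm_le_of_normalized {p q : ℝ≥0∞} (hp : 1 ≤ p) (hq : 1 ≤ q)
    {u v : Rd d → ℝ} (hu : MemY α Q 𝒬 p u) (hv : MemY α Q 𝒬 q v) {C : ℝ≥0∞}
    (H : ∀ a b : ℝ, a ≠ 0 → b ≠ 0 → normY α 𝒬 p (a • u) = 1 → normY α 𝒬 q (b • v) = 1 →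
      ENNReal.ofReal |locForm K α Q 𝒬 t₁ t₂ (a • u) (b • v)| ≤ C) :
    ENNReal.ofReal |locForm K α Q 𝒬 t₁ t₂ u v| ≤ C * normY α 𝒬 p u * normY α 𝒬 q v := by
  rcases eq_or_ne (normY α 𝒬 p u) 0 with hu0 | hu0
  · rw [locForm_eq_zero_left (ae_eq_zero_of_normY_eq_zero hp hu.memLp.1 hu0)]; simp
  rcases eq_or_ne (normY α 𝒬 q v) 0 with hv0 | hv0
  · rw [locForm_eq_zero_right _ (ae_eq_zero_of_normY_eq_zero hq hv.memLp.1 hv0)]; simp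
  have key : ∀ A : ℝ≥0∞, A ≠ 0 → A ≠ ∞ → A.toReal⁻¹ ≠ 0 ∧ ‖A.toReal⁻¹‖ₑ * A = 1 ∧
      ENNReal.ofReal A.toReal = A := by
    intro A h0 ht
    have hpos := ENNReal.toReal_pos h0 ht
    refine ⟨inv_ne_zero hpos.ne', ?_, ENNReal.ofReal_toReal ht⟩
    rw [Real.enorm_eq_ofReal (inv_nonneg.2 hpos.le), ENNReal.ofReal_inv_of_pos hpos,
      ENNReal.ofReal_toReal ht, ENNReal.inv_mul_cancel h0 ht]
  obtain ⟨ha, ha1, ha2⟩ := key _ hu0 hu.norm_lt.ne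
  obtain ⟨hb, hb1, hb2⟩ := key _ hv0 hv.norm_lt.ne
  have h := H _ _ ha hb (by rw [normY_const_smul ha, ha1]) (by rw [normY_const_smul hb, hb1])
  set a := (normY α 𝒬 p u).toReal
  set b := (normY α 𝒬 q v).toReal
  have e : locForm K α Q 𝒬 t₁ t₂ u v =
      locForm K α Q 𝒬 t₁ t₂ (a⁻¹ • u) (b⁻¹ • v) * a * b := by
    rw [locForm_smul_left, locForm_smul_right]
    have : a ≠ 0 := by simpa using ha
    have : b ≠ 0 := by simpa using hb
    field_simp
  rw [e, abs_mul, abs_mul, abs_of_nonneg (a := a) ENNReal.toReal_nonneg,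
    abs_of_nonneg (a := b) ENNReal.toReal_nonneg, ENNReal.ofReal_mul (by positivity),
    ENNReal.ofReal_mul (by positivity), ha2, hb2]
  gcongr

theorem le_locConst (K : KernelFamily d) {p₁ p₂ : ℝ≥0∞} (hst : IsStoppingCollection α Q 𝒬)
    (h₁ : IsTruncation t₁) (h₂ : IsTruncation t₂) :
    ((⨆ (b : Rd d → ℝ) (f : Rd d → ℝ)
        (_ : MemXdot α Q 𝒬 p₁ b ∧ normY α 𝒬 p₁ b = 1)
        (_ : MemY α Q 𝒬 p₂ f ∧ normY α 𝒬 p₂ f = 1),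
        ENNReal.ofReal |locForm K α Q 𝒬 t₁ t₂ b f|) +
      (⨆ (f : Rd d → ℝ) (b : Rd d → ℝ)
        (_ : MemY α Q 𝒬 ∞ f ∧ normY α 𝒬 ∞ f = 1)
        (_ : MemXdot α Q 𝒬 p₂ b ∧ normY α 𝒬 p₂ b = 1),
        ENNReal.ofReal |locForm K α Q 𝒬 t₁ t₂ f b|)) ≤ locConst K p₁ p₂ := by
  unfold locConst
  refine le_iSup_of_le α (le_iSup_of_le Q (le_iSup_of_le 𝒬 (le_iSup_of_le hst
    (le_iSup_of_le t₁ (le_iSup_of_le t₂ (le_iSup_of_le h₁ (le_iSup_of_le h₂ le_rfl)))))))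

theorem ofReal_abs_locForm_Xdot_left_le (K : KernelFamily d) {p₁ p₂ : ℝ≥0∞} (hp₁ : 1 ≤ p₁)
    (hp₂ : 1 ≤ p₂) (hst : IsStoppingCollection α Q 𝒬) (h₁ : IsTruncation t₁)
    (h₂ : IsTruncation t₂) {b f : Rd d → ℝ} (hb : MemXdot α Q 𝒬 p₁ b) (hf : MemY α Q 𝒬 p₂ f) :
    ENNReal.ofReal |locForm K α Q 𝒬 t₁ t₂ b f| ≤
      locConst K p₁ p₂ * normY α 𝒬 p₁ b * normY α 𝒬 p₂ f := by
  refine ofReal_abs_locForm_le_of_normalized hp₁ hp₂ hb.memY hf fun a c ha hc h1 h2 => ?_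
  refine le_trans ?_ (le_self_add.trans (le_locConst K hst h₁ h₂))
  exact le_iSup_of_le _ (le_iSup_of_le _ (le_iSup₂_of_le ⟨hb.const_smul ha, h1⟩
    ⟨hf.const_smul hc, h2⟩ le_rfl))

theorem ofReal_abs_locForm_Xdot_right_le (K : KernelFamily d) {p₁ p₂ : ℝ≥0∞} (hp₂ : 1 ≤ p₂)
    (hst : IsStoppingCollection α Q 𝒬) (h₁ : IsTruncation t₁)
    (h₂ : IsTruncation t₂) {f b : Rd d → ℝ} (hf : MemY α Q 𝒬 ∞ f) (hb : MemXdot α Q 𝒬 p₂ b) :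
    ENNReal.ofReal |locForm K α Q 𝒬 t₁ t₂ f b| ≤
      locConst K p₁ p₂ * normY α 𝒬 ∞ f * normY α 𝒬 p₂ b := by
  refine ofReal_abs_locForm_le_of_normalized le_top hp₂ hf hb.memY fun a c ha hc h1 h2 => ?_
  refine le_trans ?_ (le_add_self.trans (le_locConst (p₁ := p₁) K hst h₁ h₂))
  exact le_iSup_of_le _ (le_iSup_of_le _ (le_iSup₂_of_le ⟨hf.const_smul ha, h1⟩
    ⟨hb.const_smul hc, h2⟩ le_rfl))

end Localized

/-! ### Calderón–Zygmund decomposition along a stopping collection -/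

section CalderonZygmund

variable {d : ℕ} {K : KernelFamily d} {α : Fin d → Fin 3} {Q : DyadicCube d}
  {𝒬 : Set (DyadicCube d)} {t₁ t₂ : Rd d → ℤ} {p : ℝ≥0∞}

open Classical in
/-- The function equal to `c L` on each cube `L` of a collection, and to `0` off its shadow. -/
noncomputable def stepFn (α : Fin d → Fin 3) (𝒬 : Set (DyadicCube d)) (c : DyadicCube d → ℝ)
    (x : Rd d) : ℝ :=
  if h : ∃ L, L ∈ 𝒬 ∧ x ∈ (L.toCube α).toSet then c h.choose else 0

theorem stepFn_of_mem (hst : IsStoppingCollection α Q 𝒬) (c : DyadicCube d → ℝ)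
    {L : DyadicCube d} (hL : L ∈ 𝒬) {x : Rd d} (hx : x ∈ (L.toCube α).toSet) :
    stepFn α 𝒬 c x = c L := by
  have h : ∃ L, L ∈ 𝒬 ∧ x ∈ (L.toCube α).toSet := ⟨L, hL, hx⟩
  rw [stepFn, dif_pos h, hst.eq_of_inter _ h.choose_spec.1 L hL ⟨x, h.choose_spec.2, hx⟩]

theorem mem_shadow {x : Rd d} : x ∈ shadow α 𝒬 ↔ ∃ L, L ∈ 𝒬 ∧ x ∈ (L.toCube α).toSet := by
  simp [shadow]

theorem stepFn_of_notMem (c : DyadicCube d → ℝ) {x : Rd d} (hx : x ∉ shadow α 𝒬) :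
    stepFn α 𝒬 c x = 0 :=
  dif_neg fun h => hx (mem_shadow.2 h)

theorem measurableSet_shadow (α : Fin d → Fin 3) (𝒬 : Set (DyadicCube d)) :
    MeasurableSet (shadow α 𝒬) := by
  have := DyadicCube.countable_dyadicCube (d := d)
  exact MeasurableSet.biUnion (to_countable _) fun L _ => Cube.measurableSet_toSet _

theorem measurable_stepFn (hst : IsStoppingCollection α Q 𝒬) (c : DyadicCube d → ℝ) :
    Measurable (stepFn α 𝒬 c) := by
  have := DyadicCube.countable_dyadicCube (d := d)
  intro B _
  have h : stepFn α 𝒬 c ⁻¹' B = (⋃ L ∈ 𝒬, (L.toCube α).toSet ∩ {_x | c L ∈ B}) ∪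
      ((shadow α 𝒬)ᶜ ∩ {_x | (0 : ℝ) ∈ B}) := by
    ext x
    by_cases hx : x ∈ shadow α 𝒬
    · obtain ⟨L, hL, hxL⟩ := mem_shadow.1 hx
      simp only [mem_preimage, stepFn_of_mem hst c hL hxL, mem_union, mem_iUnion, mem_inter_iff,
        mem_ofPred_eq, mem_compl_iff, hx, not_true_eq_false, false_and, or_false, exists_prop]
      constructor
      · exact fun h => ⟨L, hL, hxL, h⟩
      · rintro ⟨L', hL', hxL', h⟩
        rwa [hst.eq_of_inter L hL L' hL' ⟨x, hxL, hxL'⟩]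
    · have hx' : ∀ L ∈ 𝒬, x ∉ (L.toCube α).toSet := fun L hL h => hx (mem_shadow.2 ⟨L, hL, h⟩)
      simp only [mem_preimage, stepFn_of_notMem c hx, mem_union, mem_iUnion, mem_inter_iff,
        mem_ofPred_eq, mem_compl_iff, hx, not_false_eq_true, true_and, exists_prop]
      constructor
      · exact Or.inr
      · rintro (⟨L, hL, h, -⟩ | h)
        · exact absurd h (hx' L hL)
        · exact h
  rw [h]
  exact (MeasurableSet.biUnion (to_countable _) fun L _ =>
    (Cube.measurableSet_toSet _).inter (MeasurableSet.const _)).union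
    ((measurableSet_shadow α 𝒬).compl.inter (MeasurableSet.const _))

/-- The good part `g` is `h` off the shadow and the average of `h` on each stopping cube, so `h - g`
has mean zero there. The averages are at most `32 ^ d` times the norm, by `avg_le_mul_normY`. -/
theorem exists_calderonZygmund (hp : 1 ≤ p) (hpt : p ≠ ∞) (hst : IsStoppingCollection α Q 𝒬)
    {h : Rd d → ℝ} (hh : MemY α Q 𝒬 p h) :
    ∃ g : Rd d → ℝ, MemY α Q 𝒬 ∞ g ∧ eLpNorm g ∞ volume ≤ 32 ^ d * normY α 𝒬 p h ∧
      MemXdot α Q 𝒬 p (h - g) ∧ normY α 𝒬 p (h - g) ≤ (1 + 32 ^ d) * normY α 𝒬 p h := by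
  have hc := DyadicCube.countable_dyadicCube (d := d)
  have hint : Integrable h := hh.integrable hp
  have hsm := measurableSet_shadow α 𝒬
  have hQm : MeasurableSet ((Q.toCube α).dilate 3) := Cube.measurableSet_dilate (by norm_num) _
  set N := normY α 𝒬 p h with hN
  set c : DyadicCube d → ℝ := fun L =>
    (volume.real (L.toCube α).toSet)⁻¹ * ∫ x in (L.toCube α).toSet, h x with hcdef
  have hone : (1 : ℝ≥0∞) ≤ 32 ^ d := one_le_pow₀ (by norm_num)
  have hNN : N ≤ 32 ^ d * N := le_mul_of_one_le_left (zero_le) hone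
  have hcL : ∀ L ∈ 𝒬, ‖c L‖ₑ ≤ 32 ^ d * N := by
    intro L hL
    have h0 := Cube.volume_toSet_ne_zero (L.toCube α)
    have ht := Cube.volume_toSet_ne_top (L.toCube α)
    have h1 : ‖c L‖ₑ = (volume (L.toCube α).toSet)⁻¹ * ‖∫ x in (L.toCube α).toSet, h x‖ₑ := by
      rw [hcdef, enorm_mul, Measure.real, Real.enorm_eq_ofReal (by positivity),
        ENNReal.ofReal_inv_of_pos (ENNReal.toReal_pos h0 ht), ENNReal.ofReal_toReal ht]
    rw [h1, Real.enorm_eq_ofReal_abs]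
    calc _ ≤ (volume (L.toCube α).toSet)⁻¹ *
          (avg p h (L.toCube α) * volume (L.toCube α).toSet) := by
          gcongr
          exact ofReal_abs_integral_le_avg_mul hp hh.memLp.1 _
      _ = avg p h (L.toCube α) := by
          rw [mul_comm (avg _ _ _), ← mul_assoc, ENNReal.inv_mul_cancel h0 ht, one_mul]
      _ ≤ _ := avg_le_mul_normY hp hpt h hL
  set g : Rd d → ℝ := (shadow α 𝒬)ᶜ.indicator h + stepFn α 𝒬 c with hg
  have hg_mem : ∀ L ∈ 𝒬, ∀ x ∈ (L.toCube α).toSet, g x = c L := by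
    intro L hL x hx
    have hxs : x ∈ shadow α 𝒬 := mem_shadow.2 ⟨L, hL, hx⟩
    rw [hg, Pi.add_apply, stepFn_of_mem hst c hL hx, indicator_of_notMem (by simpa using hxs),
      zero_add]
  have hg_not : ∀ x, x ∉ shadow α 𝒬 → g x = h x := by
    intro x hx
    rw [hg, Pi.add_apply, stepFn_of_notMem c hx, indicator_of_mem (by simpa using hx), add_zero]
  have hgm : AEStronglyMeasurable g volume :=
    (hh.memLp.1.indicator hsm.compl).add (measurable_stepFn hst c).aestronglyMeasurable
  have hoff : eLpNorm ((shadow α 𝒬)ᶜ.indicator h) ∞ volume ≤ N := by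
    rw [hN, normY, if_neg hpt]; exact le_max_left _ _
  have hgbd : eLpNorm g ∞ volume ≤ 32 ^ d * N := by
    rw [eLpNorm_exponent_top]
    refine essSup_le_of_ae_le _ ?_
    have h1 : ∀ᵐ x, ‖(shadow α 𝒬)ᶜ.indicator h x‖ₑ ≤ N := by
      rw [eLpNorm_exponent_top] at hoff
      filter_upwards [ae_le_eLpNormEssSup (f := (shadow α 𝒬)ᶜ.indicator h) (μ := volume)]
        with x hx using hx.trans hoff
    filter_upwards [h1] with x hx
    by_cases hxs : x ∈ shadow α 𝒬
    · obtain ⟨L, hL, hxL⟩ := mem_shadow.1 hxs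
      rw [hg_mem L hL x hxL]; exact hcL L hL
    · rw [hg_not x hxs]
      rw [indicator_of_mem (by simpa using hxs)] at hx
      exact hx.trans hNN
  have hNt : 32 ^ d * N < ∞ := ENNReal.mul_lt_top (by simp) hh.norm_lt
  have hgsupp : ∀ᵐ x, x ∉ (Q.toCube α).dilate 3 → g x = 0 := by
    filter_upwards [hh.supp] with x hx hxQ
    rw [hg_not x fun hxs => hxQ (hst.shadow_subset hxs)]
    exact hx hxQ
  have hgtop : MemLp g ∞ volume := ⟨hgm, hgbd.trans_lt hNt⟩
  have hgY : MemY α Q 𝒬 ∞ g := ⟨hgtop, hgsupp, by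
    rw [normY, if_pos rfl]; exact hgbd.trans_lt hNt⟩
  have hgp : MemLp g p volume :=
    hgtop.of_le_of_support le_top hQm (volume_dilate_three_ne_top Q) hgsupp
  have hbN : normY α 𝒬 p (h - g) ≤ (1 + 32 ^ d) * N := by
    rw [normY, if_neg hpt]
    refine max_le ?_ (iSup₂_le fun L hL => ?_)
    · have : (shadow α 𝒬)ᶜ.indicator (h - g) = 0 := by
        ext x
        by_cases hx : x ∈ shadow α 𝒬
        · simp [hx]
        · simp [hx, hg_not x hx]
      rw [this, eLpNorm_zero]
      exact zero_le
    -- Subtracting `g` raises the maximal function at every point by at most the constant bounding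
    -- `g`, so the infimum over `32L` grows by no more.
    · have h1 : ∀ x, maxFn p (h - g) x ≤ maxFn p h x + 32 ^ d * N := by
        intro x
        rw [sub_eq_add_neg]
        refine (maxFn_add_le hp hh.memLp.1 hgm.neg x).trans ?_
        rw [maxFn_neg]
        gcongr
        exact (maxFn_le_eLpNorm_top hgm x).trans hgbd
      have h2 : ⨅ x ∈ (L.toCube α).dilate (2 ^ 5), maxFn p h x ≤ N := by
        rw [hN, normY, if_neg hpt]
        exact le_max_of_le_right (le_iSup₂_of_le L hL le_rfl)
      rw [add_mul, one_mul]
      refine le_trans ?_ (add_le_add_left h2 _)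
      rw [iInf_subtype', iInf_subtype', ENNReal.iInf_add]
      exact iInf_mono fun x => h1 x
  refine ⟨g, hgY, hgbd, ⟨⟨hh.memLp.sub hgp, ?_, hbN.trans_lt ?_⟩, ?_, ?_⟩, hbN⟩
  · filter_upwards [hh.supp, hgsupp] with x h1 h2 hx
    simp [h1 hx, h2 hx]
  · exact ENNReal.mul_lt_top (by simp) hh.norm_lt
  · exact Filter.Eventually.of_forall fun x hx => by simp [hg_not x hx]
  · intro L hL
    have h1 : ∫ x in (L.toCube α).toSet, (h - g) x =
        ∫ x in (L.toCube α).toSet, (h x - c L) := by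
      refine setIntegral_congr_fun (Cube.measurableSet_toSet _) fun x hx => ?_
      simp [hg_mem L hL x hx]
    have h0 := Cube.volume_toSet_ne_zero (L.toCube α)
    have ht := Cube.volume_toSet_ne_top (L.toCube α)
    rw [h1, integral_sub hint.integrableOn (integrableOn_const ht), setIntegral_const, hcdef,
      smul_eq_mul, mul_inv_cancel_left₀, sub_self]
    exact (ENNReal.toReal_pos h0 ht).ne'

theorem ofReal_inv_real_mul_abs (Q : Cube d) (a : ℝ) :
    ENNReal.ofReal |(volume.real Q.toSet)⁻¹ * a| =
      (volume Q.toSet)⁻¹ * ENNReal.ofReal |a| := by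
  have h0 := Q.volume_toSet_ne_zero
  have ht := Q.volume_toSet_ne_top
  have hpos := ENNReal.toReal_pos h0 ht
  rw [Measure.real, abs_mul, ENNReal.ofReal_mul (abs_nonneg _), abs_of_pos (inv_pos.2 hpos),
    ENNReal.ofReal_inv_of_pos hpos, ENNReal.ofReal_toReal ht]

theorem sum_volume_le {α : Fin d → Fin 3} {ch : Finset (DyadicCube d)} {A : Set (Rd d)}
    (hsub : ∀ L ∈ ch, (L.toCube α).toSet ⊆ A)
    (hdisj : ∀ L ∈ ch, ∀ L' ∈ ch,
      ((L.toCube α).toSet ∩ (L'.toCube α).toSet).Nonempty → L = L') :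
    ∑ L ∈ ch, volume (L.toCube α).toSet ≤ volume A := by
  rw [← measure_biUnion_finset]
  · exact measure_mono (iUnion₂_subset hsub)
  · intro L hL L' hL' hne
    rw [Function.onFun, disjoint_iff_inter_eq_empty, ← not_nonempty_iff_eq_empty]
    exact fun hn => hne (hdisj L hL L' hL' hn)
  · exact fun L _ => Cube.measurableSet_toSet _

/-- Every pairing is controlled by the volume of its cube. The cubes subtracted are disjoint and
inside `Q`, so together they cost no more than `Q` itself, whence the factor `2`. -/
theorem ofReal_abs_locForm_top_le (hK : IsKernelFamily K) {r : ℝ} (hr : 1 < r)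
    (hN : maxNorm K r < ∞) (h₁ : IsTruncation t₁) (h₂ : IsTruncation t₂)
    (hst : IsStoppingCollection α Q 𝒬) {u v : Rd d → ℝ} (hu : MemY α Q 𝒬 ∞ u) :
    ENNReal.ofReal |locForm K α Q 𝒬 t₁ t₂ u v| ≤
      2 * (3 ^ d * maxNorm K r * eLpNorm u ∞ volume * eLpNorm v ∞ volume) := by
  obtain ⟨M, hM⟩ := h₁.2
  have hm : ∀ x, -M ≤ t₁ x := fun x => (abs_le.1 (hM x)).1
  have hch := fun L => (finite_dyadic_subset (Q := Q) (-M) hst.eq_of_inter).mem_toFinset (a := L)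
  set ch := (finite_dyadic_subset (Q := Q) (-M) hst.eq_of_inter).toFinset
  set D := 3 ^ d * maxNorm K r * eLpNorm u ∞ volume * eLpNorm v ∞ volume
  have hui : Integrable u := hu.integrable le_top
  have hb := fun L => ofReal_abs_locPair_le (α := α) (L := L) (v := v) hK hr hN h₁ h₂ hui
    hu.memLp.2
  have h0 := Cube.volume_toSet_ne_zero (Q.toCube α)
  have ht := Cube.volume_toSet_ne_top (Q.toCube α)
  rw [locForm_eq_sum hm hch, ofReal_inv_real_mul_abs]
  have hsum : ENNReal.ofReal |∑ L ∈ ch, locPair K α t₁ t₂ L u v| ≤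
      D * volume (Q.toCube α).toSet := by
    calc _ ≤ ENNReal.ofReal (∑ L ∈ ch, |locPair K α t₁ t₂ L u v|) :=
          ENNReal.ofReal_le_ofReal (Finset.abs_sum_le_sum_abs _ _)
      _ = ∑ L ∈ ch, ENNReal.ofReal |locPair K α t₁ t₂ L u v| :=
          ENNReal.ofReal_sum_of_nonneg fun _ _ => abs_nonneg _
      _ ≤ ∑ L ∈ ch, D * volume (L.toCube α).toSet := Finset.sum_le_sum fun L _ => hb L
      _ = D * ∑ L ∈ ch, volume (L.toCube α).toSet := (Finset.mul_sum _ _ _).symm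
      _ ≤ _ := by
          gcongr
          exact sum_volume_le (fun L hL => ((hch L).1 hL).2.1) fun L hL L' hL' =>
            hst.eq_of_inter L ((hch L).1 hL).1 L' ((hch L').1 hL').1
  calc (volume (Q.toCube α).toSet)⁻¹ *
        ENNReal.ofReal |locPair K α t₁ t₂ Q u v - ∑ L ∈ ch, locPair K α t₁ t₂ L u v|
      ≤ (volume (Q.toCube α).toSet)⁻¹ *
        (D * volume (Q.toCube α).toSet + D * volume (Q.toCube α).toSet) := by
        gcongr
        refine (ENNReal.ofReal_le_ofReal (abs_sub _ _)).trans (ENNReal.ofReal_add_le.trans ?_)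
        exact add_le_add (hb Q) hsum
    _ = 2 * D * ((volume (Q.toCube α).toSet)⁻¹ * volume (Q.toCube α).toSet) := by ring
    _ = 2 * D := by rw [ENNReal.inv_mul_cancel h0 ht, mul_one]

/-- The localized estimate: the localized form is controlled on `𝒴_{p₁} × 𝒴_{p₂}`. -/
theorem ofReal_abs_locForm_le (hK : IsKernelFamily K) {r : ℝ} (hr : 1 < r)
    (hN : maxNorm K r < ∞) {p₁ p₂ : ℝ≥0∞} (hp₁ : 1 ≤ p₁) (hp₂ : 1 ≤ p₂) (hpt₁ : p₁ ≠ ∞)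
    (hpt₂ : p₂ ≠ ∞) (h₁ : IsTruncation t₁) (h₂ : IsTruncation t₂)
    (hst : IsStoppingCollection α Q 𝒬) {u v : Rd d → ℝ} (hu : MemY α Q 𝒬 p₁ u)
    (hv : MemY α Q 𝒬 p₂ v) :
    ENNReal.ofReal |locForm K α Q 𝒬 t₁ t₂ u v| ≤
      (2 * 3 ^ d * (1 + 32 ^ d) ^ 2) * (maxNorm K r + locConst K p₁ p₂) *
        normY α 𝒬 p₁ u * normY α 𝒬 p₂ v := by
  obtain ⟨g, hgY, hgN, hbX, hbN⟩ := exists_calderonZygmund hp₁ hpt₁ hst hu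
  obtain ⟨g', hgY', hgN', hbX', hbN'⟩ := exists_calderonZygmund hp₂ hpt₂ hst hv
  set N₁ := normY α 𝒬 p₁ u
  set N₂ := normY α 𝒬 p₂ v
  set A := maxNorm K r
  set B := locConst K p₁ p₂
  have hgi := hgY.integrable le_top
  have hgi' := hgY'.integrable le_top
  have hbi := hbX.memY.integrable hp₁
  have hbi' := hbX'.memY.integrable hp₂
  -- The second function is split only against the bounded part of the first. The forms with a
  -- mean-zero entry are then exactly those controlled by the two suprema in `locConst`.
  have e : locForm K α Q 𝒬 t₁ t₂ u v = locForm K α Q 𝒬 t₁ t₂ (u - g) v +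
      (locForm K α Q 𝒬 t₁ t₂ g (v - g') + locForm K α Q 𝒬 t₁ t₂ g g') := by
    rw [← locForm_add_right hK h₁ h₂ hst hgi hbi' hgi', sub_add_cancel,
      ← locForm_add_left hK h₁ h₂ hst hbi hgi (hv.integrable hp₂), sub_add_cancel]
  have b1 := ofReal_abs_locForm_Xdot_left_le K hp₁ hp₂ hst h₁ h₂ hbX hv
  have b2 := ofReal_abs_locForm_Xdot_right_le K (p₁ := p₁) hp₂ hst h₁ h₂ hgY hbX'
  have b3 := ofReal_abs_locForm_top_le (v := g') hK hr hN h₁ h₂ hst hgY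
  have hgn : normY α 𝒬 ∞ g = eLpNorm g ∞ volume := by rw [normY, if_pos rfl]
  rw [hgn] at b2
  rw [e]
  refine (ENNReal.ofReal_le_ofReal
    ((abs_add_le _ _).trans (add_le_add_right (abs_add_le _ _) _))).trans ?_
  refine ENNReal.ofReal_add_le.trans ((add_le_add_right ENNReal.ofReal_add_le _).trans ?_)
  set E : ℝ≥0∞ := 32 ^ d
  set T : ℝ≥0∞ := 3 ^ d
  have hT : 1 ≤ T := one_le_pow₀ (by norm_num)
  have hE1 : E ≤ 1 + E := le_add_self
  have h1 : B * normY α 𝒬 p₁ (u - g) * N₂ ≤ (1 + E) * B * N₁ * N₂ := by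
    calc _ ≤ B * ((1 + E) * N₁) * N₂ := by gcongr
      _ = _ := by ring
  have h2 : B * eLpNorm g ∞ volume * normY α 𝒬 p₂ (v - g') ≤ E * (1 + E) * B * N₁ * N₂ := by
    calc _ ≤ B * (E * N₁) * ((1 + E) * N₂) := by gcongr
      _ = _ := by ring
  have h3 : 2 * (T * A * eLpNorm g ∞ volume * eLpNorm g' ∞ volume) ≤
      2 * T * (1 + E) ^ 2 * A * N₁ * N₂ := by
    calc _ ≤ 2 * (T * A * ((1 + E) * N₁) * ((1 + E) * N₂)) := by
          gcongr
          · exact hgN.trans (by gcongr)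
          · exact hgN'.trans (by gcongr)
      _ = _ := by ring
  calc _ ≤ (1 + E) * B * N₁ * N₂ + (E * (1 + E) * B * N₁ * N₂ +
        2 * T * (1 + E) ^ 2 * A * N₁ * N₂) :=
        add_le_add (b1.trans h1) (add_le_add (b2.trans h2) (b3.trans h3))
    _ = 1 * (1 + E) ^ 2 * B * N₁ * N₂ + 2 * T * (1 + E) ^ 2 * A * N₁ * N₂ := by ring
    _ ≤ 2 * T * (1 + E) ^ 2 * B * N₁ * N₂ + 2 * T * (1 + E) ^ 2 * A * N₁ * N₂ := by
        gcongr
        calc (1 : ℝ≥0∞) = 1 * 1 := by ring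
          _ ≤ 2 * T := by gcongr; norm_num
    _ = _ := by ring

end CalderonZygmund

/-! ### Convex bodies -/

section Bodies

/-- A bounded spanning set contains a basis of nearly maximal volume, with respect to which all
elements of the set have coordinates at most `2`. -/
theorem exists_basis_coord_le_two {E : Type*} [NormedAddCommGroup E] [NormedSpace ℝ E]
    [FiniteDimensional ℝ E] {A : Set E} (hA : Bornology.IsBounded A)
    (hspan : Submodule.span ℝ A = ⊤) :
    ∃ b : Module.Basis (Fin (Module.finrank ℝ E)) ℝ E, (∀ i, b i ∈ A) ∧
      ∀ x ∈ A, ∀ i, |b.coord i x| ≤ 2 := by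
  classical
  obtain ⟨s, hsA, hs, hli⟩ := exists_linearIndependent ℝ A
  have hsp : ⊤ ≤ Submodule.span ℝ (range ((↑) : s → E)) := by
    rw [Subtype.range_coe, hs, hspan]
  set e' : Module.Basis s ℝ E := Module.Basis.mk hli hsp with he'
  have : Fintype s := FiniteDimensional.fintypeBasisIndex e'
  set e := e'.reindex (Fintype.equivFinOfCardEq (Module.finrank_eq_card_basis e').symm) with he
  have heA : ∀ i, e i ∈ A := fun i => by
    rw [he, Module.Basis.reindex_apply, he', Module.Basis.mk_apply]
    exact hsA (Subtype.coe_prop _)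
  -- The volume spanned by a tuple is continuous, hence bounded on tuples from the compact closure
  -- of `A`.
  have hcont : Continuous fun v : Fin (Module.finrank ℝ E) → E => |e.det v| := by
    simp only [Module.Basis.det_apply]
    refine (Continuous.matrix_det ?_).abs
    refine continuous_matrix fun i j => ?_
    exact (LinearMap.continuous_of_finiteDimensional (e.coord i)).comp (continuous_apply j)
  have hcpt : IsCompact (univ.pi fun _ : Fin (Module.finrank ℝ E) => closure A) :=
    isCompact_univ_pi fun _ => hA.isCompact_closure
  set S := (fun v : Fin (Module.finrank ℝ E) → E => |e.det v|) ''
    (univ.pi fun _ : Fin (Module.finrank ℝ E) => A) with hS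
  have hbdd : BddAbove S := (hcpt.image hcont).bddAbove.mono
    (image_mono (pi_mono fun _ _ => subset_closure))
  have h1S : (1 : ℝ) ∈ S := ⟨e, fun i _ => heA i, by
    change |e.det e| = 1
    rw [Module.Basis.det_self, abs_one]⟩
  have hsup : 1 ≤ sSup S := le_csSup hbdd h1S
  -- As `A` need not be closed, the maximal volume may not be attained. A tuple exceeding half the
  -- supremum suffices, and this is the origin of the bound `2`.
  obtain ⟨_, ⟨v, hv, rfl⟩, hlt⟩ := exists_lt_of_lt_csSup ⟨1, h1S⟩
    (show sSup S / 2 < sSup S by linarith)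
  have hdet : e.det v ≠ 0 := by
    intro h
    simp only [h, abs_zero] at hlt
    linarith
  obtain ⟨hli, hsp⟩ := (Module.Basis.is_basis_iff_det e).2 (isUnit_iff_ne_zero.2 hdet)
  refine ⟨Module.Basis.mk hli hsp.ge, fun i => ?_, fun x hx i => ?_⟩
  · rw [Module.Basis.mk_apply]; exact hv i (mem_univ i)
  -- Cramer's rule: the coordinate is a quotient of two volumes, the numerator at most the supremum
  -- and the denominator more than half of it.
  · have h := LinearMap.congr_fun (Module.Basis.det_smul_mk_coord_eq_det_update e hli hsp.ge i) x
    rw [LinearMap.smul_apply, smul_eq_mul, MultilinearMap.toLinearMap_apply] at h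
    have hle : |e.det (Function.update v i x)| ≤ sSup S := by
      refine le_csSup hbdd ⟨_, fun j _ => ?_, rfl⟩
      rcases eq_or_ne j i with rfl | hj
      · rwa [Function.update_self]
      · rw [Function.update_of_ne hj]; exact hv j (mem_univ j)
    have h2 : |e.det v| * |(Module.Basis.mk hli hsp.ge).coord i x| ≤ sSup S := by
      rw [← abs_mul, h]; exact hle
    have h3 : 0 < |e.det v| := abs_pos.2 hdet
    by_contra hc
    nlinarith [not_le.1 hc]

/-- An Auerbach-type frame for a bounded set: elements of the set, and functionals bounded by `2`
on it, that reproduce it. -/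
theorem exists_auerbach_frame {E : Type*} [NormedAddCommGroup E] [NormedSpace ℝ E]
    [FiniteDimensional ℝ E] {A : Set E} (hA : Bornology.IsBounded A) :
    ∃ k : ℕ, k ≤ Module.finrank ℝ E ∧ ∃ (a : Fin k → E) (l : Fin k → (E →L[ℝ] ℝ)),
      (∀ i, a i ∈ A) ∧ ∀ x ∈ A, (∀ i, |l i x| ≤ 2) ∧ x = ∑ i, l i x • a i := by
  -- A degenerate set spans a proper subspace. The basis is taken there, and its coordinate
  -- functionals are extended arbitrarily to `E`.
  set W := Submodule.span ℝ A with hW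
  set A' : Set W := ((↑) : W → E) ⁻¹' A with hA'
  have hspan : Submodule.span ℝ A' = ⊤ := Submodule.span_span_coe_preimage
  have hbdd : Bornology.IsBounded A' := by
    obtain ⟨C, hC⟩ := hA.exists_norm_le
    exact isBounded_iff_forall_norm_le.2 ⟨C, fun x hx => hC x hx⟩
  obtain ⟨b, hbA, hb⟩ := exists_basis_coord_le_two hbdd hspan
  choose l hl using fun i => LinearMap.exists_extend (b.coord i)
  have hlx : ∀ i (x : W), l i x = b.coord i x := fun i x => by
    rw [← hl i]; rfl
  refine ⟨Module.finrank ℝ W, Submodule.finrank_le W, fun i => b i,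
    fun i => (l i).toContinuousLinearMap, hbA, fun x hx => ?_⟩
  have hxW : x ∈ W := Submodule.subset_span hx
  have h1 : ∀ i, (l i).toContinuousLinearMap x = b.coord i ⟨x, hxW⟩ := fun i =>
    hlx i ⟨x, hxW⟩
  refine ⟨fun i => ?_, ?_⟩
  · rw [h1]; exact hb ⟨x, hxW⟩ hx i
  · simp only [h1]
    have h := congrArg ((↑) : W → E) (b.sum_repr ⟨x, hxW⟩)
    simpa only [Submodule.coe_sum, Submodule.coe_smul, Module.Basis.coord_apply] using h.symm

/-! ### Duality and convex body averages. -/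

variable {d n : ℕ} {p : ℝ≥0∞}

theorem one_le_dualExponent (p : ℝ≥0∞) : 1 ≤ (1 - p⁻¹)⁻¹ := by
  rw [ENNReal.one_le_inv]; exact tsub_le_self

theorem integrableOn_of_avg_ne_top {q : ℝ≥0∞} (hq : 1 ≤ q) {φ : Rd d → ℝ} {Q : Cube d}
    (hφ : AEStronglyMeasurable φ (volume.restrict Q.toSet)) (h : avg q φ Q ≠ ∞) :
    IntegrableOn φ Q.toSet := by
  refine ⟨hφ, ?_⟩
  exact (lintegral_enorm_le_avg_mul hq hφ).trans_lt
    (ENNReal.mul_lt_top h.lt_top Q.volume_toSet_ne_top.lt_top)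

theorem Phi.integrableOn {q : ℝ≥0∞} (hq : 1 ≤ q) {φ : Rd d → ℝ} {Q : Cube d} (h : φ ∈ Phi q Q) :
    IntegrableOn φ Q.toSet :=
  integrableOn_of_avg_ne_top hq h.1 (h.2.trans_lt ENNReal.one_lt_top).ne

theorem volume_real_pos (Q : Cube d) : 0 < volume.real Q.toSet :=
  ENNReal.toReal_pos Q.volume_toSet_ne_zero Q.volume_toSet_ne_top

/-- The average `⟨f⟩_{p,Q}` is attained by duality. -/
theorem exists_Phi_integral_eq_avg (hp : 1 ≤ p) (hpt : p ≠ ∞) {f : Rd d → ℝ} {Q : Cube d}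
    (hf : AEStronglyMeasurable f (volume.restrict Q.toSet)) (hfin : avg p f Q ≠ ∞) :
    ∃ φ ∈ Phi ((1 - p⁻¹)⁻¹) Q,
      (volume.real Q.toSet)⁻¹ * ∫ x in Q.toSet, φ x * f x = (avg p f Q).toReal := by
  have hvpos := volume_real_pos Q
  have hp0 : p ≠ 0 := (zero_lt_one.trans_le hp).ne'
  set s := p.toReal with hs
  have hs1 : 1 ≤ s := by
    have := ENNReal.toReal_mono hpt hp
    simpa using this
  set A := (avg p f Q).toReal with hA
  have hA0 : 0 ≤ A := ENNReal.toReal_nonneg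
  have hpow : ∫ x in Q.toSet, |f x| ^ s = A ^ s * volume.real Q.toSet := by
    have h := congrArg ENNReal.toReal (avg_rpow_mul_volume hp0 hpt f Q)
    rw [ENNReal.toReal_mul, ← ENNReal.toReal_rpow] at h
    rw [Measure.real, hA, hs, h, integral_eq_lintegral_of_nonneg_ae]
    · congr 1
      refine lintegral_congr fun x => ?_
      rw [Real.enorm_eq_ofReal_abs, ENNReal.ofReal_rpow_of_nonneg (abs_nonneg _) (by positivity)]
    · exact Filter.Eventually.of_forall fun x => by positivity
    · exact (hf.aemeasurable.abs.pow_const s).aestronglyMeasurable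
  rcases eq_or_lt_of_le hA0 with h0 | hApos
  · refine ⟨0, ⟨aestronglyMeasurable_zero, by simp [avg_eq]⟩, ?_⟩
    simp [← h0]
  have hsign : ∀ y : ℝ, (SignType.sign y : ℝ) * |y| ^ (s - 1) * y = |y| ^ s := by
    intro y
    rcases eq_or_ne y 0 with rfl | hy
    · simp [Real.zero_rpow (by linarith : s ≠ 0)]
    · rw [mul_right_comm, sign_mul_self, ← Real.rpow_one_add' (abs_nonneg y) (by linarith)]
      congr 1; ring
  -- The extremizer in Hölder's inequality is `sgn(f) |f| ^ (s - 1)`, normalized by `A ^ (1 - s)` to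
  -- have average at most `1`.
  have hmeas : AEStronglyMeasurable
      (fun x => A ^ (1 - s) * ((SignType.sign (f x) : ℝ) * |f x| ^ (s - 1)))
      (volume.restrict Q.toSet) := by
    refine AEMeasurable.aestronglyMeasurable ?_
    have h1 : Measurable fun y : ℝ => (SignType.sign y : ℝ) := by
      have : (fun y : ℝ => (SignType.sign y : ℝ)) = fun y =>
          if 0 < y then 1 else if y < 0 then -1 else 0 := by
        ext y
        rw [sign_apply]
        split_ifs <;> simp
      rw [this]
      exact Measurable.ite measurableSet_Ioi measurable_const
        (Measurable.ite measurableSet_Iio measurable_const measurable_const)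
    exact ((h1.comp_aemeasurable hf.aemeasurable).mul
      (hf.aemeasurable.abs.pow_const (s - 1))).const_mul _
  have hnorm : ∀ x, |A ^ (1 - s) * ((SignType.sign (f x) : ℝ) * |f x| ^ (s - 1))| ≤
      A ^ (1 - s) * |f x| ^ (s - 1) := by
    intro x
    rw [abs_mul, abs_mul, abs_of_nonneg (Real.rpow_nonneg hA0 _),
      abs_of_nonneg (Real.rpow_nonneg (abs_nonneg _) _)]
    have : |(SignType.sign (f x) : ℝ)| ≤ 1 := by
      rcases lt_trichotomy (f x) 0 with h | h | h <;> simp [h]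
    have h2 : 0 ≤ |f x| ^ (s - 1) := by positivity
    exact mul_le_mul_of_nonneg_left (mul_le_of_le_one_left h2 this) (by positivity)
  refine ⟨_, ⟨hmeas, ?_⟩, ?_⟩
  -- For `p = 1` the dual exponent is infinite and the extremizer is bounded by `1`; otherwise the
  -- dual exponent `q` is finite and `(s - 1) q = s`.
  · rcases eq_or_lt_of_le hs1 with h1 | h1
    · have hp1 : p = 1 := by
        rw [← ENNReal.ofReal_toReal hpt, ← hs, ← h1, ENNReal.ofReal_one]
      rw [hp1, inv_one, tsub_self, ENNReal.inv_zero, avg_eq]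
      simp only [ENNReal.inv_top, ENNReal.toReal_zero, ENNReal.rpow_zero, div_one]
      rw [eLpNorm_exponent_top]
      refine essSup_le_of_ae_le _ (Filter.Eventually.of_forall fun x => ?_)
      simp only
      rw [Real.enorm_eq_ofReal_abs, ← ENNReal.ofReal_one]
      refine ENNReal.ofReal_le_ofReal ((hnorm x).trans ?_)
      simp [← h1]
    · set q : ℝ≥0∞ := (1 - p⁻¹)⁻¹ with hq
      have hpinv : p⁻¹ = ENNReal.ofReal s⁻¹ := by
        rw [ENNReal.ofReal_inv_of_pos (by linarith), hs, ENNReal.ofReal_toReal hpt]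
      have hs0 : 0 < s := by linarith
      have hpos : 0 < 1 - s⁻¹ := by
        rw [sub_pos]; exact inv_lt_one_of_one_lt₀ h1
      have hq' : q = ENNReal.ofReal (1 - s⁻¹)⁻¹ := by
        rw [hq, hpinv, ← ENNReal.ofReal_one, ← ENNReal.ofReal_sub _ (by positivity),
          ENNReal.ofReal_inv_of_pos hpos]
      have hqr : q.toReal = (1 - s⁻¹)⁻¹ := by
        rw [hq', ENNReal.toReal_ofReal (by positivity)]
      have hq0 : q ≠ 0 := (zero_lt_one.trans_le (one_le_dualExponent p)).ne'
      have hqt : q ≠ ∞ := by rw [hq']; exact ENNReal.ofReal_ne_top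
      have hqpos : 0 < q.toReal := ENNReal.toReal_pos hq0 hqt
      have hqs : (s - 1) * q.toReal = s := by
        rw [hqr]
        have : s - 1 ≠ 0 := by linarith
        field_simp
      set φ := fun x => A ^ (1 - s) * ((SignType.sign (f x) : ℝ) * |f x| ^ (s - 1)) with hφ
      have h2 := avg_rpow_mul_volume hq0 hqt φ Q
      have h3 : ∫⁻ x in Q.toSet, ‖φ x‖ₑ ^ q.toReal ≤
          ENNReal.ofReal (A ^ (-s)) * ∫⁻ x in Q.toSet, ‖f x‖ₑ ^ p.toReal := by
        rw [← lintegral_const_mul'' _ ((hf.enorm).pow_const _)]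
        refine lintegral_mono fun x => ?_
        simp only
        rw [Real.enorm_eq_ofReal_abs, Real.enorm_eq_ofReal_abs,
          ENNReal.ofReal_rpow_of_nonneg (abs_nonneg _) hqpos.le,
          ENNReal.ofReal_rpow_of_nonneg (abs_nonneg _) hs0.le,
          ← ENNReal.ofReal_mul (by positivity)]
        refine ENNReal.ofReal_le_ofReal ?_
        calc |φ x| ^ q.toReal ≤ (A ^ (1 - s) * |f x| ^ (s - 1)) ^ q.toReal :=
              Real.rpow_le_rpow (abs_nonneg _) (hnorm x) hqpos.le
          _ = A ^ (-s) * |f x| ^ s := by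
              rw [Real.mul_rpow (by positivity) (by positivity), ← Real.rpow_mul hA0,
                ← Real.rpow_mul (abs_nonneg _), hqs,
                show (1 - s) * q.toReal = -s by linarith]
      rw [← h2, ← avg_rpow_mul_volume hp0 hpt, ← hs, ← mul_assoc] at h3
      have h4 : ENNReal.ofReal (A ^ (-s)) * avg p f Q ^ s = 1 := by
        rw [← ENNReal.ofReal_toReal hfin, ← hA, ENNReal.ofReal_rpow_of_nonneg hA0 hs0.le,
          ← ENNReal.ofReal_mul (by positivity), ← Real.rpow_add hApos]
        simp
      rw [h4, one_mul] at h3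
      have h5 : avg q φ Q ^ q.toReal ≤ 1 := by
        rw [← ENNReal.mul_le_mul_iff_left Q.volume_toSet_ne_zero Q.volume_toSet_ne_top]
        simpa using h3
      rw [← ENNReal.rpow_le_rpow_iff hqpos, ENNReal.one_rpow]
      exact h5
  · simp only [mul_assoc]
    have : ∀ x, A ^ (1 - s) * ((SignType.sign (f x) : ℝ) * (|f x| ^ (s - 1) * f x)) =
        A ^ (1 - s) * |f x| ^ s := fun x => by rw [← hsign (f x)]; ring
    simp only [this]
    have hA1 : A ^ (1 - s) * A ^ s = A := by
      rw [← Real.rpow_add hApos, sub_add_cancel, Real.rpow_one]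
    rw [integral_const_mul, hpow, ← mul_assoc (A ^ (1 - s)), hA1]
    field_simp

theorem integrableOn_Phi_smul {q : ℝ≥0∞} (hq : 1 ≤ q) {φ : Rd d → ℝ} {Q : Cube d}
    (h : φ ∈ Phi q Q) {f : Rd d → Rn n} (hf : MemLp f ∞ volume) :
    IntegrableOn (fun x => φ x • f x) Q.toSet :=
  (Phi.integrableOn hq h).smul_of_top_left (hf.restrict _)

theorem exists_bound_bodyAvg (p : ℝ≥0∞) {f : Rd d → Rn n} (hf : MemLp f ∞ volume) (Q : Cube d) :
    ∃ B : ℝ, 0 ≤ B ∧ ∀ v ∈ bodyAvg p f Q, ‖v‖ ≤ B := by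
  set B := (eLpNorm f ∞ volume).toReal with hB
  have hfB : ∀ᵐ x, ‖f x‖ ≤ B := by
    filter_upwards [ae_le_eLpNormEssSup (f := f) (μ := volume)] with x hx
    rw [← eLpNorm_exponent_top] at hx
    have := ENNReal.toReal_mono hf.2.ne hx
    rwa [toReal_enorm] at this
  refine ⟨B, ENNReal.toReal_nonneg, ?_⟩
  rintro v ⟨φ, hφ, rfl⟩
  have hv := volume_real_pos Q
  have hq := one_le_dualExponent p
  have hi := Phi.integrableOn hq hφ
  have h1 : ∫ x in Q.toSet, ‖φ x‖ ≤ volume.real Q.toSet := by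
    rw [integral_norm_eq_lintegral_enorm hi.1]
    refine ENNReal.toReal_mono Q.volume_toSet_ne_top ?_
    refine (lintegral_enorm_le_avg_mul hq hφ.1).trans ?_
    calc _ ≤ 1 * volume Q.toSet := by gcongr; exact hφ.2
      _ = _ := one_mul _
  have h2 : ‖∫ x in Q.toSet, φ x • f x‖ ≤ B * volume.real Q.toSet := by
    calc _ ≤ ∫ x in Q.toSet, B * ‖φ x‖ := by
          refine norm_integral_le_of_norm_le (hi.norm.const_mul B) ?_
          filter_upwards [ae_restrict_of_ae hfB] with x hx
          rw [norm_smul, mul_comm]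
          gcongr
      _ = B * ∫ x in Q.toSet, ‖φ x‖ := integral_const_mul _ _
      _ ≤ _ := mul_le_mul_of_nonneg_left h1 ENNReal.toReal_nonneg
  rw [norm_smul, norm_inv, Real.norm_of_nonneg hv.le, inv_mul_le_iff₀ hv, mul_comm]
  exact h2

theorem memLp_top_clm {f : Rd d → Rn n} (hf : MemLp f ∞ volume) (l : Rn n →L[ℝ] ℝ) :
    MemLp (fun x => l (f x)) ∞ volume :=
  l.comp_memLp' hf

theorem avg_ne_top_of_memLp_top {f : Rd d → ℝ} (hf : MemLp f ∞ volume) (p : ℝ≥0∞)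
    (Q : Cube d) : avg p f Q ≠ ∞ :=
  ((avg_le_eLpNorm_top hf.1 Q).trans_lt hf.2).ne

/-- The average of a component is attained on the convex body. -/
theorem exists_mem_bodyAvg_eq_avg (hp : 1 ≤ p) (hpt : p ≠ ∞) {f : Rd d → Rn n}
    (hf : MemLp f ∞ volume) (Q : Cube d) (l : Rn n →L[ℝ] ℝ) :
    ∃ v ∈ bodyAvg p f Q, l v = (avg p (fun x => l (f x)) Q).toReal := by
  have hl := memLp_top_clm hf l
  obtain ⟨φ, hφ, h⟩ := exists_Phi_integral_eq_avg hp hpt hl.1.restrict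
    (avg_ne_top_of_memLp_top hl p Q)
  refine ⟨_, ⟨φ, hφ, rfl⟩, ?_⟩
  rw [← h, map_smul, smul_eq_mul,
    ← l.integral_comp_comm (integrableOn_Phi_smul (one_le_dualExponent p) hφ hf)]
  simp only [map_smul, smul_eq_mul]

theorem isBounded_bodyAvg (p : ℝ≥0∞) {f : Rd d → Rn n} (hf : MemLp f ∞ volume) (Q : Cube d) :
    Bornology.IsBounded (bodyAvg p f Q) := by
  obtain ⟨B, -, hB⟩ := exists_bound_bodyAvg p hf Q
  exact isBounded_iff_forall_norm_le.2 ⟨B, hB⟩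

theorem rightEndpoint_minkowskiProd_lt_top (p₁ p₂ : ℝ≥0∞) {f₁ f₂ : Rd d → Rn n}
    (hf₁ : MemLp f₁ ∞ volume) (hf₂ : MemLp f₂ ∞ volume) (Q : Cube d) :
    rightEndpoint (minkowskiProd (bodyAvg p₁ f₁ Q) (bodyAvg p₂ f₂ Q)) < ∞ := by
  obtain ⟨B₁, hB₁0, hB₁⟩ := exists_bound_bodyAvg p₁ hf₁ Q
  obtain ⟨B₂, -, hB₂⟩ := exists_bound_bodyAvg p₂ hf₂ Q
  refine lt_of_le_of_lt (iSup₂_le ?_) (ENNReal.ofReal_lt_top (r := B₁ * B₂))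
  rintro _ ⟨a, ha, b, hb, rfl⟩
  refine ENNReal.ofReal_le_ofReal ((real_inner_le_norm a b).trans ?_)
  exact mul_le_mul (hB₁ a ha) (hB₂ b hb) (norm_nonneg _) hB₁0

/-- Splitting of a vector valued function along an Auerbach frame of its convex body. -/
theorem exists_frame {p₁ p₂ : ℝ≥0∞} (hp₁ : 1 ≤ p₁) (hpt₁ : p₁ ≠ ∞) (hp₂ : 1 ≤ p₂)
    (hpt₂ : p₂ ≠ ∞) {f₁ f₂ : Rd d → Rn n} (hf₁ : MemLp f₁ ∞ volume) (hf₂ : MemLp f₂ ∞ volume)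
    (Q : Cube d) :
    ∃ k : ℕ, k ≤ n ∧ ∃ (a : Fin k → Rn n) (l : Fin k → (Rn n →L[ℝ] ℝ)),
      (∀ i, avg p₁ (fun x => l i (f₁ x)) Q ≤ 2) ∧
      (∀ i, avg p₂ (fun x => inner ℝ (a i) (f₂ x)) Q ≤
        rightEndpoint (minkowskiProd (bodyAvg p₁ f₁ Q) (bodyAvg p₂ f₂ Q))) ∧
      ∀ᵐ x, x ∈ Q.toSet → f₁ x = ∑ i, l i (f₁ x) • a i := by
  obtain ⟨k, hk, a, l, ha, hl⟩ := exists_auerbach_frame (isBounded_bodyAvg p₁ hf₁ Q)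
  refine ⟨k, by simpa using hk, a, l, fun i => ?_, fun i => ?_, ?_⟩
  -- The average of `l i ∘ f₁` is the value of `l i` at a point of the body, where the frame bounds
  -- it by `2`.
  · obtain ⟨v, hv, h⟩ := exists_mem_bodyAvg_eq_avg hp₁ hpt₁ hf₁ Q (l i)
    have h1 := (le_abs_self _).trans ((hl v hv).1 i)
    rw [h] at h1
    rw [← ENNReal.ofReal_toReal (avg_ne_top_of_memLp_top (memLp_top_clm hf₁ (l i)) p₁ Q)]
    exact (ENNReal.ofReal_le_ofReal h1).trans (by simp)
  -- The average of `⟨a i, f₂⟩` is the scalar product of `a i` with a point of the second body.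
  -- Since `a i` lies in the first body, this is an element of the Minkowski product.
  · obtain ⟨v, hv, h⟩ := exists_mem_bodyAvg_eq_avg hp₂ hpt₂ hf₂ Q (innerSL ℝ (a i))
    simp only [innerSL_apply_apply] at h
    have hne := avg_ne_top_of_memLp_top (memLp_top_clm hf₂ (innerSL ℝ (a i))) p₂ Q
    simp only [innerSL_apply_apply] at hne
    rw [← ENNReal.ofReal_toReal hne, ← h]
    exact le_iSup₂_of_le _ ⟨a i, ha i, v, hv, rfl⟩ le_rfl
  -- The frame reproduces points of the body; the values of `f₁` need a further argument. The
  -- functional measuring the error in coordinate `j` vanishes on the body, so the average of its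
  -- composition with `f₁` is zero, and that composition vanishes almost everywhere on `Q`.
  · have key : ∀ j : Fin n, ∀ᵐ x, x ∈ Q.toSet →
        f₁ x j = (∑ i, l i (f₁ x) • a i) j := by
      intro j
      set m : Rn n →L[ℝ] ℝ := EuclideanSpace.proj j - ∑ i, a i j • l i with hm
      have hmx : ∀ y, m y = y j - (∑ i, l i y • a i) j := by
        intro y
        simp [hm, mul_comm]
      obtain ⟨v, hv, h⟩ := exists_mem_bodyAvg_eq_avg hp₁ hpt₁ hf₁ Q m
      rw [hmx, ← (hl v hv).2, sub_self, eq_comm, ENNReal.toReal_eq_zero_iff,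
        or_iff_left (avg_ne_top_of_memLp_top (memLp_top_clm hf₁ m) p₁ Q)] at h
      have h3 := avg_mul_volume_rpow p₁ (fun x => m (f₁ x)) Q
      rw [h, zero_mul, eq_comm, eLpNorm_eq_zero_iff (memLp_top_clm hf₁ m).1.restrict
        (zero_lt_one.trans_le hp₁).ne'] at h3
      filter_upwards [(ae_restrict_iff' Q.measurableSet_toSet).1 h3] with x hx hxQ
      have := hx hxQ
      rw [hmx] at this
      exact sub_eq_zero.1 this
    filter_upwards [ae_all_iff.2 key] with x hx hxQ
    ext j
    exact hx j hxQ

end Bodies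

/-! ### Whitney stopping collections -/

/-- The maximal dyadic cubes `L` with `9L ⊆ U`, as far as they lie in `3Q`. -/
def whitney {d : ℕ} (α : Fin d → Fin 3) (U : Set (Rd d)) (Q : DyadicCube d) :
    Set (DyadicCube d) :=
  {L | (L.toCube α).dilate 9 ⊆ U ∧ (L.toCube α).toSet ⊆ (Q.toCube α).dilate 3 ∧
    ∀ P : DyadicCube d, L.scale < P.scale → (L.toCube α).toSet ⊆ (P.toCube α).toSet →
      ¬ (P.toCube α).dilate 9 ⊆ U}

section Whitney

variable {d : ℕ} {α : Fin d → Fin 3} {U : Set (Rd d)} {Q : DyadicCube d}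

/-- Compare the volume of `9L` with that of `U`. The factor `16` leaves room to keep `9L` inside
`3Q` whenever `3L` meets `2Q`. -/
theorem side_lt_of_dilate_subset (hd : 0 < d)
    (hvol : volume U < ENNReal.ofReal (1 / 16) ^ d * volume (Q.toCube α).toSet)
    {L : DyadicCube d} (hL : (L.toCube α).dilate 9 ⊆ U) :
    9 * (2 : ℝ) ^ L.scale < 2 ^ Q.scale / 16 := by
  have h := (measure_mono (μ := volume) hL).trans_lt hvol
  have h2 : (0 : ℝ) < (2 : ℝ) ^ Q.scale := zpow_pos two_pos _
  rw [Cube.volume_dilate (by norm_num), DyadicCube.volume_toSet, DyadicCube.volume_toSet,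
    ← mul_pow, ← mul_pow, ← ENNReal.ofReal_mul (by norm_num), ← ENNReal.ofReal_mul (by norm_num),
    ENNReal.pow_lt_pow_left_iff hd.ne', ENNReal.ofReal_lt_ofReal_iff (by positivity)] at h
  linarith

theorem scale_lt_of_dilate_subset (hd : 0 < d)
    (hvol : volume U < ENNReal.ofReal (1 / 16) ^ d * volume (Q.toCube α).toSet)
    {L : DyadicCube d} (hL : (L.toCube α).dilate 9 ⊆ U) : L.scale < Q.scale := by
  have h := side_lt_of_dilate_subset hd hvol hL
  rw [DyadicCube.scale_lt_iff]
  have h1 : (0 : ℝ) < (2 : ℝ) ^ Q.scale := zpow_pos two_pos _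
  have h2 : (0 : ℝ) < (2 : ℝ) ^ L.scale := zpow_pos two_pos _
  linarith

theorem exists_dilate_nine_subset (hU : IsOpen U) {x : Rd d} (hx : x ∈ U) (α : Fin d → Fin 3) :
    ∃ L : DyadicCube d, x ∈ (L.toCube α).toSet ∧ (L.toCube α).dilate 9 ⊆ U := by
  obtain ⟨δ, hδ, hb⟩ := Metric.isOpen_iff.1 hU x hx
  obtain ⟨n, hn⟩ := exists_pow_lt_of_lt_one (show (0 : ℝ) < δ / 9 by positivity)
    (show (1 / 2 : ℝ) < 1 by norm_num)
  obtain ⟨L, hs, hxL⟩ := DyadicCube.exists_mem α (-n) x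
  have h1 : (2 : ℝ) ^ L.scale = (1 / 2) ^ n := by
    rw [hs, zpow_neg, zpow_natCast]; simp
  have h2 : (0 : ℝ) < (2 : ℝ) ^ L.scale := zpow_pos two_pos _
  refine ⟨L, hxL, fun y hy => hb ?_⟩
  rw [Metric.mem_ball, dist_pi_lt_iff hδ]
  intro i
  have hyi := hy i
  have hxi := hxL i
  rw [DyadicCube.center_eq, DyadicCube.side_eq] at hyi
  rw [DyadicCube.side_eq] at hxi
  rw [Real.dist_eq, abs_lt]
  constructor <;> linarith

theorem exists_mem_whitney (hd : 0 < d) (hU : IsOpen U)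
    (hvol : volume U < ENNReal.ofReal (1 / 16) ^ d * volume (Q.toCube α).toSet)
    {x : Rd d} (hx : x ∈ U) (hxQ : x ∈ (Q.toCube α).dilate 3) :
    ∃ L ∈ whitney α U Q, x ∈ (L.toCube α).toSet := by
  obtain ⟨L₀, hxL₀, hL₀⟩ := exists_dilate_nine_subset hU hx α
  -- Maximal cubes exist because the smallness of `U` bounds the admissible scales by that of `Q`.
  obtain ⟨s, ⟨L, hs, hxL, hL⟩, hmax⟩ := Int.exists_greatest_of_bdd
    (P := fun s => ∃ L : DyadicCube d, L.scale = s ∧ x ∈ (L.toCube α).toSet ∧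
      (L.toCube α).dilate 9 ⊆ U)
    ⟨Q.scale, fun s ⟨L, hs, _, hL⟩ => hs ▸ (scale_lt_of_dilate_subset hd hvol hL).le⟩
    ⟨_, L₀, rfl, hxL₀, hL₀⟩
  refine ⟨L, ⟨hL, ?_, fun P hP hLP hPU => ?_⟩, hxL⟩
  · exact DyadicCube.toSet_subset_dilate_three_of_mem
      (scale_lt_of_dilate_subset hd hvol hL).le hxL hxQ
  · have := hmax _ ⟨P, rfl, hLP hxL, hPU⟩
    omega

theorem toSet_subset_of_mem_whitney {L : DyadicCube d} (hL : L ∈ whitney α U Q) :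
    (L.toCube α).toSet ⊆ U :=
  (Cube.toSet_subset_dilate (by norm_num) _).trans hL.1

theorem shadow_whitney (hd : 0 < d) (hU : IsOpen U)
    (hvol : volume U < ENNReal.ofReal (1 / 16) ^ d * volume (Q.toCube α).toSet) :
    shadow α (whitney α U Q) = U ∩ (Q.toCube α).dilate 3 := by
  ext x
  simp only [shadow, mem_iUnion, exists_prop]
  constructor
  · rintro ⟨L, hL, hx⟩
    exact ⟨toSet_subset_of_mem_whitney hL hx, hL.2.1 hx⟩
  · rintro ⟨hx, hxQ⟩
    exact exists_mem_whitney hd hU hvol hx hxQ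

/-- If `L` were much larger than its neighbour `L'`, then `9L` would contain `9P` for the parent `P`
of `L'`, against the maximality of `L'`. A gap of three scales would already suffice. -/
theorem whitney_scale_le {L L' : DyadicCube d} (hL : L ∈ whitney α U Q)
    (hL' : L' ∈ whitney α U Q)
    (hi : ((L.toCube α).dilate 3 ∩ (L'.toCube α).dilate 3).Nonempty) :
    L.scale ≤ L'.scale + 8 := by
  by_contra hc
  obtain ⟨P, hP, hLP⟩ := DyadicCube.exists_parent α L'
  refine hL'.2.2 P (by omega) hLP fun y hy => hL.1 fun i => ?_
  obtain ⟨z, hz, hz'⟩ := hi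
  have h1 := hz i
  have h2 := hz' i
  have h3 := hy i
  have h4 := hLP (Cube.corner_mem_toSet _) i
  have hp : (2 : ℝ) ^ P.scale = 2 * 2 ^ L'.scale := by
    rw [hP, zpow_add₀ two_ne_zero]; ring
  have hl : 8 * (2 : ℝ) ^ L'.scale ≤ 2 ^ L.scale := by
    calc 8 * (2 : ℝ) ^ L'.scale = 2 ^ (L'.scale + 3) := by
          rw [zpow_add₀ two_ne_zero]; norm_num; ring
      _ ≤ 2 ^ L.scale := zpow_le_zpow_right₀ one_le_two (by omega)
  have h0 : (0 : ℝ) < (2 : ℝ) ^ L'.scale := zpow_pos two_pos _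
  rw [DyadicCube.center_eq, DyadicCube.side_eq] at h1 h2 h3 ⊢
  rw [DyadicCube.side_eq] at h4
  rw [hp] at h3 h4
  constructor <;> linarith

theorem eq_of_mem_whitney {L L' : DyadicCube d} (hL : L ∈ whitney α U Q)
    (hL' : L' ∈ whitney α U Q)
    (hi : ((L.toCube α).toSet ∩ (L'.toCube α).toSet).Nonempty) : L = L' := by
  obtain ⟨x, hx, hx'⟩ := hi
  rcases lt_trichotomy L.scale L'.scale with h | h | h
  · exact absurd hL'.1 (hL.2.2 L' h (DyadicCube.toSet_subset_of_mem h.le hx hx'))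
  · exact DyadicCube.eq_of_mem h hx hx'
  · exact absurd hL.1 (hL'.2.2 L h (DyadicCube.toSet_subset_of_mem h.le hx' hx))

theorem isStoppingCollection_whitney (hd : 0 < d) (hU : IsOpen U)
    (hvol : volume U < ENNReal.ofReal (1 / 16) ^ d * volume (Q.toCube α).toSet) :
    IsStoppingCollection α Q (whitney α U Q) where
  shadow_subset := by
    rw [shadow_whitney hd hU hvol]; exact inter_subset_right
  dilate_subset := by
    intro L hL hi
    rw [shadow_whitney hd hU hvol]
    refine subset_inter hL.1 fun y hy i => ?_
    obtain ⟨z, hz, hz'⟩ := hi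
    have h := side_lt_of_dilate_subset hd hvol hL.1
    have h1 := hz i
    have h2 := hz' i
    have h3 := hy i
    rw [DyadicCube.side_eq] at h1 h2 h3 ⊢
    have h0 : (0 : ℝ) < (2 : ℝ) ^ L.scale := zpow_pos two_pos _
    constructor <;> linarith
  eq_of_inter := fun L hL L' hL' hi => eq_of_mem_whitney hL hL' hi
  whitney := by
    intro L hL L' hL' hi
    have h1 := whitney_scale_le hL hL' hi
    have h2 := whitney_scale_le hL' hL (by rwa [inter_comm])
    rw [abs_le]
    constructor <;> omega

/-- By maximality `9P` leaves `U` for the parent `P` of `L`, and `9P` is contained in `32L`. -/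
theorem exists_notMem_of_mem_whitney {L : DyadicCube d} (hL : L ∈ whitney α U Q) :
    ∃ x ∈ (L.toCube α).dilate (2 ^ 5), x ∉ U := by
  obtain ⟨P, hP, hLP⟩ := DyadicCube.exists_parent α L
  have h := hL.2.2 P (by omega) hLP
  rw [not_subset] at h
  obtain ⟨x, hx, hxU⟩ := h
  refine ⟨x, fun i => ?_, hxU⟩
  have h3 := hx i
  have h4 := hLP (Cube.corner_mem_toSet _) i
  have hp : (2 : ℝ) ^ P.scale = 2 * 2 ^ L.scale := by
    rw [hP, zpow_add₀ two_ne_zero]; ring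
  have h0 : (0 : ℝ) < (2 : ℝ) ^ L.scale := zpow_pos two_pos _
  rw [DyadicCube.center_eq, DyadicCube.side_eq] at h3 ⊢
  rw [DyadicCube.side_eq] at h4
  rw [hp] at h3 h4
  constructor <;> linarith

end Whitney

/-! ### Selection of sparse subfamilies -/

section SparseSelection

variable {d : ℕ} {α : Fin d → Fin 3}

theorem volume_triple (L : DyadicCube d) :
    volume (L.triple α).toSet = 3 ^ d * volume (L.toCube α).toSet := by
  rw [L.toSet_triple, Cube.volume_dilate (by norm_num)]; norm_num

/-- Unlike in `dilate_three_subset`, no residue condition is needed: tripling enlarges `L` on each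
side by no more than it enlarges `Q`. -/
theorem triple_subset_of_subset {L Q : DyadicCube d} (hs : L.scale ≤ Q.scale)
    (h : (L.toCube α).toSet ⊆ (Q.toCube α).toSet) :
    (L.triple α).toSet ⊆ (Q.triple α).toSet := by
  rw [L.toSet_triple, Q.toSet_triple]
  intro x hx
  rw [Cube.mem_dilate_three] at hx ⊢
  intro i
  obtain ⟨k, hk⟩ := DyadicCube.exists_corner_add (α := α) hs i 1
  obtain ⟨k₀, hk₀⟩ := DyadicCube.exists_corner_add (α := α) hs i 0
  have h0 := h (Cube.corner_mem_toSet _) i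
  have h1 : (0 : ℝ) < (2 : ℝ) ^ L.scale := zpow_pos two_pos _
  have h2 : (2 : ℝ) ^ L.scale ≤ 2 ^ Q.scale := zpow_le_zpow_right₀ one_le_two hs
  have h3 := hx i
  simp only [DyadicCube.side_eq] at h0 h3 ⊢
  simp only [Int.cast_one, one_mul, Int.cast_zero, zero_mul, add_zero] at hk hk₀
  rw [hk] at h0
  rw [hk₀] at h0
  have h4 := cell_subset h1 le_rfl (by linarith) h0.1 h0.2
  constructor <;> linarith [h4.1, h4.2]

theorem triple_nested {L Q : DyadicCube d} (hr : L.residue α = Q.residue α)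
    {x : Rd d} (hL : x ∈ (L.triple α).toSet) (hQ : x ∈ (Q.triple α).toSet) :
    (L.triple α).toSet ⊆ (Q.triple α).toSet ∨ (Q.triple α).toSet ⊆ (L.triple α).toSet := by
  rw [L.toSet_triple] at *
  rw [Q.toSet_triple] at *
  rcases le_total L.scale Q.scale with h | h
  · exact Or.inl (DyadicCube.dilate_three_subset h hr ⟨x, hL, hQ⟩)
  · exact Or.inr (DyadicCube.dilate_three_subset h hr.symm ⟨x, hQ, hL⟩)

theorem eq_of_triple_subset (hd : 0 < d) {L Q : DyadicCube d}
    (h : (L.triple α).toSet ⊆ (Q.triple α).toSet)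
    (h' : (Q.triple α).toSet ⊆ (L.triple α).toSet) : L = Q := by
  have e := congrArg volume (h.antisymm h')
  have hs : (L.triple α).side = (Q.triple α).side := by
    rw [Cube.volume_toSet, Cube.volume_toSet] at e
    refine le_antisymm ?_ ?_
    · have := (ENNReal.pow_le_pow_left_iff hd.ne').1 e.le
      exact (ENNReal.ofReal_le_ofReal_iff (Cube.side_pos _).le).1 this
    · have := (ENNReal.pow_le_pow_left_iff hd.ne').1 e.ge
      exact (ENNReal.ofReal_le_ofReal_iff (Cube.side_pos _).le).1 this
  refine DyadicCube.triple_injective (α := α) (Cube.ext (funext fun i => ?_) hs)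
  exact le_antisymm (h' (Cube.corner_mem_toSet _) i).1 (h (Cube.corner_mem_toSet _) i).1

open Classical in
/-- The members of `S` in the residue class of `R` whose triples properly contain that of `R`. -/
noncomputable def ancestors (α : Fin d → Fin 3) (S : Finset (DyadicCube d)) (R : DyadicCube d) :
    Finset (DyadicCube d) :=
  S.filter fun P => P.residue α = R.residue α ∧ P ≠ R ∧
    (R.triple α).toSet ⊆ (P.triple α).toSet

theorem mem_ancestors {S : Finset (DyadicCube d)} {R P : DyadicCube d} :
    P ∈ ancestors α S R ↔ P ∈ S ∧ P.residue α = R.residue α ∧ P ≠ R ∧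
      (R.triple α).toSet ⊆ (P.triple α).toSet := by
  simp [ancestors]

open Classical in
/-- Within one residue class and one congruence class of levels, the triples of the cubes of a
Carleson family are sparse. -/
theorem isSparse_triple_image (hd : 0 < d) {S : Finset (DyadicCube d)}
    (hS : ∀ A : Set (Rd d), MeasurableSet A →
      ∑ R ∈ S with (R.toCube α).toSet ⊆ A, volume (R.toCube α).toSet ≤ 2 * volume A)
    {S' : Finset (DyadicCube d)} (hS' : S' ⊆ S)
    (hres : ∀ R ∈ S', ∀ P ∈ S', R.residue α = P.residue α)
    (hlev : ∀ R ∈ S', ∀ P ∈ S',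
      (ancestors α S R).card ≡ (ancestors α S P).card [MOD 4 * 3 ^ d]) :
    IsSparse (1 / 2) (DyadicCube.triple α '' (S' : Set (DyadicCube d))) := by
  -- The set to be removed from a cube is the union of the strictly smaller selected triples inside
  -- it.
  set U : Cube d → Set (Rd d) := fun I =>
    ⋃ P ∈ S'.filter (fun P => P.triple α ≠ I ∧ (P.triple α).toSet ⊆ I.toSet),
      (P.triple α).toSet with hU
  have hUm : ∀ I, MeasurableSet (U I) := fun I =>
    Finset.measurableSet_biUnion _ fun P _ => Cube.measurableSet_toSet _
  have hUsub : ∀ I, U I ⊆ I.toSet := fun I => iUnion₂_subset fun P hP =>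
    (Finset.mem_filter.1 hP).2.2
  have hUvol : ∀ R ∈ S', volume (U (R.triple α)) ≤ 1 / 2 * volume (R.triple α).toSet := by
    intro R hR
    -- The overlap is counted over the whole family `S`, not only over `S'`: the levels skipped by
    -- the selection are what makes it large.
    set D := S.filter (fun P => (P.triple α).toSet ⊆ (R.triple α).toSet) with hD
    set F : Rd d → ℝ≥0∞ := fun x => ∑ P ∈ D, (P.triple α).toSet.indicator 1 x with hF
    have hFm : Measurable F := Finset.measurable_fun_sum _ fun P _ =>
      measurable_one.indicator (Cube.measurableSet_toSet _)
    have hge : U (R.triple α) ⊆ {x | ((4 * 3 ^ d : ℕ) : ℝ≥0∞) ≤ F x} := by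
      intro x hx
      simp only [hU, mem_iUnion, Finset.mem_filter, exists_prop] at hx
      obtain ⟨P, ⟨hP, hne, hsub⟩, hxP⟩ := hx
      have hPR : P ≠ R := fun h => hne (h ▸ rfl)
      have hsub' : ancestors α S R ⊆ ancestors α S P := by
        intro k hk
        rw [mem_ancestors] at hk ⊢
        refine ⟨hk.1, hk.2.1.trans (hres R hR P hP), ?_, hsub.trans hk.2.2.2⟩
        rintro rfl
        exact hPR (eq_of_triple_subset hd hsub hk.2.2.2)
      have hRP : R ∈ ancestors α S P :=
        mem_ancestors.2 ⟨hS' hR, hres R hR P hP, hPR.symm, hsub⟩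
      have hRR : R ∉ ancestors α S R := fun h => (mem_ancestors.1 h).2.2.1 rfl
      have hlt : (ancestors α S R).card < (ancestors α S P).card :=
        Finset.card_lt_card ⟨hsub', fun h => hRR (h hRP)⟩
      -- The ancestors of `P` strictly include those of `R`, and the two numbers are congruent
      -- modulo `4 * 3 ^ d`, so at least that many ancestors of `P` are not ancestors of `R`. By
      -- nesting, their triples lie between those of `P` and `R`.
      have hcard := (hlev R hR P hP).add_le_of_lt hlt
      have hle : 4 * 3 ^ d ≤ (ancestors α S P \ ancestors α S R).card := by
        rw [Finset.card_sdiff_of_subset hsub']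
        omega
      have hDsub : ancestors α S P \ ancestors α S R ⊆
          D.filter (fun k => x ∈ (k.triple α).toSet) := by
        intro k hk
        rw [Finset.mem_sdiff] at hk
        have hkP := mem_ancestors.1 hk.1
        have hxk := hkP.2.2.2 hxP
        refine Finset.mem_filter.2 ⟨Finset.mem_filter.2 ⟨hkP.1, ?_⟩, hxk⟩
        have hkR : k.residue α = R.residue α := hkP.2.1.trans (hres P hP R hR)
        rcases triple_nested hkR hxk (hsub hxP) with h | h
        · exact h
        · rcases eq_or_ne k R with rfl | hne'
          · exact Subset.rfl
          · exact absurd (mem_ancestors.2 ⟨hkP.1, hkR, hne', h⟩) hk.2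
      have hFx : F x = ((D.filter (fun k => x ∈ (k.triple α).toSet)).card : ℝ≥0∞) := by
        simp only [hF, indicator_apply, Pi.one_apply]
        rw [Finset.sum_boole]
      rw [mem_ofPred_eq, hFx]
      exact_mod_cast hle.trans (Finset.card_le_card hDsub)
    have hint : ∫⁻ x, F x ≤ 3 ^ d * (2 * volume (R.triple α).toSet) := by
      rw [lintegral_finsetSum _ fun P _ =>
        (measurable_one.indicator (Cube.measurableSet_toSet _))]
      calc ∑ P ∈ D, ∫⁻ x, (P.triple α).toSet.indicator 1 x
          = ∑ P ∈ D, 3 ^ d * volume (P.toCube α).toSet := by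
            refine Finset.sum_congr rfl fun P _ => ?_
            rw [lintegral_indicator_one (Cube.measurableSet_toSet _), volume_triple]
        _ = 3 ^ d * ∑ P ∈ D, volume (P.toCube α).toSet := (Finset.mul_sum _ _ _).symm
        _ ≤ 3 ^ d * ∑ P ∈ S with (P.toCube α).toSet ⊆ (R.triple α).toSet,
              volume (P.toCube α).toSet := by
            refine mul_le_mul_right (Finset.sum_le_sum_of_subset fun P hP => ?_) _
            rw [Finset.mem_filter] at hP ⊢
            refine ⟨hP.1, Subset.trans ?_ hP.2⟩
            rw [P.toSet_triple]
            exact Cube.toSet_subset_dilate (by norm_num) _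
        _ ≤ _ := by
            gcongr
            exact hS _ (Cube.measurableSet_toSet _)
    -- Chebyshev's inequality: the overlap is at least `4 * 3 ^ d` on the removed set and has
    -- integral at most `2 * 3 ^ d` times the volume of the triple, so at most half is removed.
    have h1 := (mul_meas_ge_le_lintegral hFm ((4 * 3 ^ d : ℕ) : ℝ≥0∞)).trans hint
    have h2 : (4 * 3 ^ d) * volume (U (R.triple α)) ≤
        (4 * 3 ^ d) * (1 / 2 * volume (R.triple α).toSet) := by
      calc (4 * 3 ^ d) * volume (U (R.triple α))
          ≤ ((4 * 3 ^ d : ℕ) : ℝ≥0∞) * volume {x | ((4 * 3 ^ d : ℕ) : ℝ≥0∞) ≤ F x} := by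
            push_cast
            gcongr
            exact_mod_cast hge
        _ ≤ 3 ^ d * (2 * volume (R.triple α).toSet) := h1
        _ = 3 ^ d * ((4 * (1 / 2)) * volume (R.triple α).toSet) := by
            congr 2
            rw [mul_one_div, show (4 : ℝ≥0∞) = 2 * 2 by norm_num,
              ENNReal.mul_div_cancel_right (by norm_num) (by norm_num)]
        _ = _ := by ring
    exact (ENNReal.mul_le_mul_iff_right (by simp) (ENNReal.mul_ne_top (by simp) (by simp))).1 h2
  refine ⟨S'.countable_toSet.image _, fun I => I.toSet \ U I, ?_, ?_⟩
  · rintro _ ⟨R, hR, rfl⟩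
    refine ⟨(Cube.measurableSet_toSet _).diff (hUm _), sdiff_subset, ?_⟩
    have ht := (R.triple α).volume_toSet_ne_top
    have hUt : volume (U (R.triple α)) ≠ ∞ :=
      ((measure_mono (hUsub _)).trans_lt ht.lt_top).ne
    rw [measure_sdiff (hUsub _) (hUm _).nullMeasurableSet hUt]
    refine ENNReal.le_sub_of_add_le_right hUt ?_
    calc _ ≤ 1 / 2 * volume (R.triple α).toSet + 1 / 2 * volume (R.triple α).toSet := by
          gcongr
          exact hUvol R hR
      _ = volume (R.triple α).toSet := by
          rw [← add_mul, ENNReal.add_halves, one_mul]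
  · rintro _ ⟨R, hR, rfl⟩ _ ⟨P, hP, rfl⟩ hne
    rw [eq_empty_iff_forall_notMem]
    rintro x ⟨⟨hxR, hxR'⟩, hxP, hxP'⟩
    rcases triple_nested (hres R hR P hP) hxR hxP with h | h
    · refine hxP' (mem_iUnion₂.2 ⟨R, Finset.mem_filter.2 ⟨hR, hne, h⟩, hxR⟩)
    · refine hxR' (mem_iUnion₂.2 ⟨P, Finset.mem_filter.2 ⟨hP, hne.symm, h⟩, hxP⟩)

open Classical in
/-- A Carleson family of dyadic cubes contains a subfamily with sparse triples that carries a
fixed proportion of any given sum. -/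
theorem exists_sparse_subfamily (hd : 0 < d) {S : Finset (DyadicCube d)}
    (hS : ∀ A : Set (Rd d), MeasurableSet A →
      ∑ R ∈ S with (R.toCube α).toSet ⊆ A, volume (R.toCube α).toSet ≤ 2 * volume A)
    (w : DyadicCube d → ℝ≥0∞) :
    ∃ S' ⊆ S, IsSparse (1 / 2) (DyadicCube.triple α '' (S' : Set (DyadicCube d))) ∧
      ∑ R ∈ S, w R ≤ (3 ^ d * (4 * 3 ^ d)) * ∑ R ∈ S', w R := by
  have : NeZero (4 * 3 ^ d) := ⟨by positivity⟩
  set κ : DyadicCube d → (Fin d → ZMod 3) × ZMod (4 * 3 ^ d) := fun R =>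
    (R.residue α, ((ancestors α S R).card : ZMod (4 * 3 ^ d))) with hκ
  -- Pigeonhole over the `3 ^ d` residues and the `4 * 3 ^ d` classes of levels: keep the class
  -- carrying the largest sum.
  obtain ⟨c, -, hc⟩ := Finset.exists_max_image Finset.univ
    (fun c => ∑ R ∈ S with κ R = c, w R) Finset.univ_nonempty
  refine ⟨S.filter (fun R => κ R = c), Finset.filter_subset _ _, ?_, ?_⟩
  · refine isSparse_triple_image hd hS (Finset.filter_subset _ _) ?_ ?_
    · intro R hR P hP
      exact congrArg Prod.fst ((Finset.mem_filter.1 hR).2.trans (Finset.mem_filter.1 hP).2.symm)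
    · intro R hR P hP
      exact (ZMod.natCast_eq_natCast_iff _ _ _).1
        (congrArg Prod.snd ((Finset.mem_filter.1 hR).2.trans (Finset.mem_filter.1 hP).2.symm))
  · rw [← Finset.sum_fiberwise S κ w]
    refine (Finset.sum_le_card_nsmul _ _ _ hc).trans_eq ?_
    rw [Finset.card_univ, Fintype.card_prod, Fintype.card_fun, ZMod.card, ZMod.card,
      Fintype.card_fin, nsmul_eq_mul]
    push_cast
    rfl

end SparseSelection

/-! ### The stopping step -/

section StoppingStep

variable {d n : ℕ} {α : Fin d → Fin 3} {p : ℝ≥0∞}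

/-- The weak type inequality contributes `4 ^ d` and Chebyshev's inequality the extra `1`. Including
the set where `|h|` itself is large bounds `h` pointwise off the exceptional set without Lebesgue
differentiation. -/
theorem measure_large_le (hd : 0 < d) (hp : 1 ≤ p) (hpt : p ≠ ∞) {h : Rd d → ℝ}
    (hh : MemLp h p volume) {T : Cube d} (hs : ∀ x, x ∉ T.toSet → h x = 0) {Λ : ℝ≥0∞}
    (hΛ : 1 ≤ Λ) (hΛt : Λ ≠ ∞) :
    volume ({x | Λ * avg p h T < maxFn p h x} ∪ {x | Λ * avg p h T < ‖h x‖ₑ}) ≤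
      (4 ^ d + 1) / Λ * volume T.toSet := by
  have hp0 : p ≠ 0 := (zero_lt_one.trans_le hp).ne'
  have hpr := ENNReal.toReal_pos hp0 hpt
  have hpr1 : 1 ≤ p.toReal := by simpa using ENNReal.toReal_mono hpt hp
  have hind : T.toSet.indicator h = h := by
    ext x
    by_cases hx : x ∈ T.toSet
    · simp [hx]
    · simp [hx, hs x hx]
  have hnorm : eLpNorm h p volume = avg p h T * volume T.toSet ^ (p⁻¹).toReal := by
    rw [avg_mul_volume_rpow, ← eLpNorm_indicator_eq_eLpNorm_restrict T.measurableSet_toSet, hind]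
  set A := avg p h T with hA
  rcases eq_or_ne A 0 with hA0 | hA0
  · rw [hA0, zero_mul, eLpNorm_eq_zero_iff hh.1 hp0] at hnorm
    have h1 : {x | Λ * A < maxFn p h x} = ∅ := by
      refine eq_empty_of_forall_notMem fun x => ?_
      have : maxFn p h x = 0 := by
        refine nonpos_iff_eq_zero.1 (iSup₂_le fun Q _ => ?_)
        rw [avg_congr (g := 0) (ae_restrict_of_ae hnorm), avg_eq]
        simp
      simp [this]
    have h2 : volume {x | Λ * A < ‖h x‖ₑ} = 0 := by
      refine measure_mono_null (fun x hx => ?_) hnorm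
      intro h0
      simp only [mem_ofPred_eq] at hx
      rw [h0] at hx
      simp at hx
    rw [h1, empty_union, h2]
    exact zero_le
  · have hAt : A ≠ ∞ := by
      intro h
      have := hh.2
      rw [hnorm, h, ENNReal.top_mul (volume_rpow_ne_zero _ _)] at this
      exact this.ne rfl
    have hΛ0 : Λ ≠ 0 := (zero_lt_one.trans_le hΛ).ne'
    have ht0 : Λ * A ≠ 0 := mul_ne_zero hΛ0 hA0
    have htt : Λ * A ≠ ∞ := ENNReal.mul_ne_top hΛt hAt
    -- The support of `h` in `T` makes its norm a multiple of its average over `T`. Then `Λ ^ p` is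
    -- replaced by the smaller `Λ`, uniformly in `p`.
    have hkey : (eLpNorm h p volume / (Λ * A)) ^ p.toReal ≤ volume T.toSet / Λ := by
      rw [hnorm, mul_comm A, ENNReal.mul_div_mul_right _ _ hA0 hAt,
        ENNReal.div_rpow_of_nonneg _ _ hpr.le, ← ENNReal.rpow_mul, ENNReal.toReal_inv,
        inv_mul_cancel₀ hpr.ne', ENNReal.rpow_one]
      gcongr
      calc Λ = Λ ^ (1 : ℝ) := (ENNReal.rpow_one _).symm
        _ ≤ Λ ^ p.toReal := ENNReal.rpow_le_rpow_of_exponent_le hΛ hpr1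
    have h1 := measure_lt_maxFn_le hd hp0 hpt hh ht0 htt
    have h2 : volume {x | Λ * A < ‖h x‖ₑ} ≤ (eLpNorm h p volume / (Λ * A)) ^ p.toReal := by
      refine (measure_mono fun x (hx : Λ * A < ‖h x‖ₑ) => hx.le).trans
        ((meas_ge_le_mul_pow_eLpNorm_enorm volume hp0 hpt hh.1 ht0 fun h => absurd h htt).trans_eq ?_)
      rw [div_eq_mul_inv, ENNReal.mul_rpow_of_nonneg _ _ hpr.le, mul_comm]
    calc _ ≤ volume {x | Λ * A < maxFn p h x} + volume {x | Λ * A < ‖h x‖ₑ} := measure_union_le _ _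
      _ ≤ 4 ^ d * (volume T.toSet / Λ) + volume T.toSet / Λ :=
          add_le_add (h1.trans (by gcongr)) (h2.trans hkey)
      _ = _ := by
          simp only [div_eq_mul_inv]
          ring

/-- Each Whitney cube has a point of its `32`-fold dilate outside `U`, where the maximal function is
small. A point off the shadow lies outside `U` or outside `3Q`, where `h` vanishes. -/
theorem memY_whitney (hd : 0 < d) (hpt : p ≠ ∞) {U : Set (Rd d)} (hU : IsOpen U)
    {Q : DyadicCube d}
    (hvol : volume U < ENNReal.ofReal (1 / 16) ^ d * volume (Q.toCube α).toSet)
    {h : Rd d → ℝ} (hh : MemLp h p volume) (hs : ∀ x, x ∉ (Q.toCube α).dilate 3 → h x = 0)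
    {N : ℝ≥0∞} (hN : N ≠ ∞) (h1 : ∀ x, x ∉ U → maxFn p h x ≤ N) (h2 : ∀ x, x ∉ U → ‖h x‖ₑ ≤ N) :
    MemY α Q (whitney α U Q) p h ∧ normY α (whitney α U Q) p h ≤ N := by
  have hn : normY α (whitney α U Q) p h ≤ N := by
    rw [normY, if_neg hpt, shadow_whitney hd hU hvol]
    refine max_le ?_ (iSup₂_le fun L hL => ?_)
    · rw [eLpNorm_exponent_top]
      refine essSup_le_of_ae_le _ (Filter.Eventually.of_forall fun x => ?_)
      simp only
      by_cases hxU : x ∈ U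
      · by_cases hxQ : x ∈ (Q.toCube α).dilate 3
        · rw [indicator_of_notMem (by simp [hxU, hxQ])]; simp
        · rw [indicator_of_mem (by simp [hxQ]), hs x hxQ]; simp
      · rw [indicator_of_mem (by simp [hxU])]
        exact h2 x hxU
    · obtain ⟨x, hx, hxU⟩ := exists_notMem_of_mem_whitney hL
      exact iInf₂_le_of_le x hx (h1 x hxU)
  exact ⟨⟨hh, Filter.Eventually.of_forall hs, hn.trans_lt hN.lt_top⟩, hn⟩

/-- The vector valued pairing over a dyadic cube. -/
noncomputable def vecPair (K : KernelFamily d) (α : Fin d → Fin 3) (t₁ t₂ : Rd d → ℤ)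
    (f₁ f₂ : Rd d → Rn n) (L : DyadicCube d) : ℝ :=
  ∑ j, locPair K α t₁ t₂ L (fun x => f₁ x j) (fun x => f₂ x j)

variable {K : KernelFamily d} {t₁ t₂ : Rd d → ℤ} {f₁ f₂ : Rd d → Rn n}

/-- Expansion of the vector valued pairing along a frame valid on `3Q`. -/
theorem vecPair_eq_sum (hK : IsKernelFamily K) (h₁ : IsTruncation t₁) (h₂ : IsTruncation t₂)
    (hf₁ : Integrable f₁) (hf₂ : Integrable f₂) {T : Set (Rd d)} (hT : MeasurableSet T)
    {k : ℕ} {a : Fin k → Rn n} {l : Fin k → (Rn n →L[ℝ] ℝ)}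
    (hal : ∀ᵐ x, x ∈ T → f₁ x = ∑ i, l i (f₁ x) • a i) {L : DyadicCube d}
    (hL : (L.toCube α).dilate 3 ⊆ T) :
    vecPair K α t₁ t₂ f₁ f₂ L = ∑ i, locPair K α t₁ t₂ L (T.indicator fun x => l i (f₁ x))
      (T.indicator fun x => inner ℝ (a i) (f₂ x)) := by
  have hLT : (L.toCube α).toSet ⊆ T := (Cube.toSet_subset_dilate (by norm_num) _).trans hL
  set u : Fin k → Rd d → ℝ := fun i => T.indicator fun x => l i (f₁ x) with hu
  have hui : ∀ i, Integrable (u i) := fun i => ((l i).integrable_comp hf₁).indicator hT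
  have hfj : ∀ j, Integrable fun x => f₂ x j := fun j =>
    (EuclideanSpace.proj (𝕜 := ℝ) j).integrable_comp hf₂
  have e1 : ∀ j, locPair K α t₁ t₂ L (fun x => f₁ x j) (fun x => f₂ x j) =
      ∑ i, a i j * locPair K α t₁ t₂ L (u i) (fun x => f₂ x j) := by
    intro j
    rw [locPair_congr_left (u' := ∑ i, a i j • u i) _, locPair_sum_left hK h₁ h₂ _
      (fun i => (hui i).smul (a i j)) (hfj j)]
    · simp only [locPair_smul_left]
    · filter_upwards [hal] with x hx hxL
      have h3 := congrArg (fun v : Rn n => v j) (hx (hLT hxL))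
      simp only [Finset.sum_apply, Pi.smul_apply, hu, indicator_of_mem (hLT hxL), smul_eq_mul]
      simpa [mul_comm] using h3
  -- The second entry matters only on `3L`, where the cut-off to `T` has no effect; on the left only
  -- `L` matters.
  have e2 : ∀ i, locPair K α t₁ t₂ L (u i) (T.indicator fun x => inner ℝ (a i) (f₂ x)) =
      ∑ j, a i j * locPair K α t₁ t₂ L (u i) (fun x => f₂ x j) := by
    intro i
    rw [locPair_congr_right hK (v' := ∑ j, a i j • fun x => f₂ x j) _,
      locPair_sum_right hK h₁ h₂ _ (hui i) (fun j => (hfj j).smul (a i j))]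
    · simp only [locPair_smul_right]
    · refine Filter.Eventually.of_forall fun x hx => ?_
      rw [indicator_of_mem (hL hx)]
      simp [PiLp.inner_apply, mul_comm]
  rw [vecPair, Finset.sum_congr rfl fun j _ => e1 j, Finset.sum_comm]
  exact Finset.sum_congr rfl fun i _ => (e2 i).symm

/-- The endpoint of the product of the convex body averages over the triple of a cube. -/
noncomputable def bodyProd (α : Fin d → Fin 3) (p₁ p₂ : ℝ≥0∞) (f₁ f₂ : Rd d → Rn n)
    (Q : DyadicCube d) : ℝ≥0∞ :=
  rightEndpoint (minkowskiProd (bodyAvg p₁ f₁ (Q.triple α)) (bodyAvg p₂ f₂ (Q.triple α)))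

/-- The ratio defining the stopping cubes. -/
noncomputable def stoppingRatio (d n : ℕ) : ℝ≥0∞ :=
  4 * (2 * n + 1) * (4 ^ d + 1) * 3 ^ d * 16 ^ d

theorem one_le_stoppingRatio (d n : ℕ) : 1 ≤ stoppingRatio d n := by
  have h : ((1 : ℕ) : ℝ≥0∞) ≤ ((4 * (2 * n + 1) * (4 ^ d + 1) * 3 ^ d * 16 ^ d : ℕ) : ℝ≥0∞) := by
    exact_mod_cast Nat.one_le_iff_ne_zero.2 (by positivity)
  simpa [stoppingRatio] using h

theorem stoppingRatio_ne_top (d n : ℕ) : stoppingRatio d n ≠ ∞ := by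
  have h : ((4 * (2 * n + 1) * (4 ^ d + 1) * 3 ^ d * 16 ^ d : ℕ) : ℝ≥0∞) ≠ ∞ :=
    ENNReal.natCast_ne_top _
  simpa [stoppingRatio] using h

/-- There are `2k` scalar functions, each with an exceptional set of measure at most `(4 ^ d + 1) /
Λ * 3 ^ d` times `|Q|`. The `+ 1` in `2n + 1` keeps the ratio positive when `n = 0`. -/
theorem stoppingRatio_bound (d : ℕ) {n k : ℕ} (hk : k ≤ n) :
    2 * (k : ℝ≥0∞) * ((4 ^ d + 1) / stoppingRatio d n * 3 ^ d) <
      1 / 2 * ENNReal.ofReal (1 / 16) ^ d := by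
  obtain ⟨R, hR⟩ : ∃ R : ℝ, R = 4 * (2 * n + 1) * (4 ^ d + 1) * 3 ^ d * 16 ^ d := ⟨_, rfl⟩
  have h0 : 0 < R := by rw [hR]; positivity
  have e : stoppingRatio d n = ENNReal.ofReal R := by
    have : R = ((4 * (2 * n + 1) * (4 ^ d + 1) * 3 ^ d * 16 ^ d : ℕ) : ℝ) := by
      rw [hR]; push_cast; ring
    rw [this, ENNReal.ofReal_natCast, stoppingRatio]
    push_cast; ring
  have e2 : 2 * (k : ℝ≥0∞) * ((4 ^ d + 1) / stoppingRatio d n * 3 ^ d) =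
      ENNReal.ofReal (2 * k * ((4 ^ d + 1) / R * 3 ^ d)) := by
    rw [e, ENNReal.ofReal_mul (by positivity), ENNReal.ofReal_mul (by positivity),
      ENNReal.ofReal_mul (by positivity), ENNReal.ofReal_div_of_pos h0, ENNReal.ofReal_natCast,
      ENNReal.ofReal_add (by positivity) (by positivity), ENNReal.ofReal_pow (by positivity),
      ENNReal.ofReal_pow (by positivity)]
    norm_num
  have e3 : 1 / 2 * ENNReal.ofReal (1 / 16) ^ d = ENNReal.ofReal (1 / 2 * (1 / 16) ^ d) := by
    rw [ENNReal.ofReal_mul (by positivity), ENNReal.ofReal_pow (by positivity)]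
    congr 1
    rw [ENNReal.ofReal_div_of_pos two_pos]
    norm_num
  rw [e2, e3, ENNReal.ofReal_lt_ofReal_iff (by positivity)]
  have hk' : (k : ℝ) ≤ n := by exact_mod_cast hk
  have e4 : 2 * (k : ℝ) * ((4 ^ d + 1) / R * 3 ^ d) =
      (2 * k / (4 * (2 * n + 1))) * (1 / 16) ^ d := by
    rw [div_pow, one_pow, hR]
    field_simp
  rw [e4]
  refine mul_lt_mul_of_pos_right ?_ (by positivity)
  rw [div_lt_div_iff₀ (by positivity) two_pos]
  linarith

/-- The constant of the stopping step. -/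
noncomputable def stepConst (d n : ℕ) : ℝ≥0∞ :=
  n * (2 * 3 ^ d * (1 + 32 ^ d) ^ 2) * (2 * stoppingRatio d n ^ 2)

theorem stepConst_ne_top (d n : ℕ) : stepConst d n ≠ ∞ := by
  have := stoppingRatio_ne_top d n
  refine ENNReal.mul_ne_top (ENNReal.mul_ne_top (by simp) ?_) (ENNReal.mul_ne_top (by simp) ?_)
  · exact ENNReal.mul_ne_top (ENNReal.mul_ne_top (by simp) (by simp))
      (ENNReal.pow_ne_top (by simp))
  · exact ENNReal.pow_ne_top this

/-- One frame, that of the body over `3Q`, serves `Q` and all its children. The difference of vector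
pairings is thus `|Q|` times a sum of scalar localized forms, to which `ofReal_abs_locForm_le`
applies. -/
theorem exists_children (hd : 0 < d) (hK : IsKernelFamily K) {r : ℝ} (hr : 1 < r)
    (hN : maxNorm K r < ∞) {p₁ p₂ : ℝ≥0∞} (hp₁ : 1 ≤ p₁) (hpt₁ : p₁ ≠ ∞) (hp₂ : 1 ≤ p₂)
    (hpt₂ : p₂ ≠ ∞) (h₁ : IsTruncation t₁) (h₂ : IsTruncation t₂)
    (hf₁ : MemLp f₁ ∞ volume) (hf₁' : Integrable f₁)
    (hf₂ : MemLp f₂ ∞ volume) (hf₂' : Integrable f₂) (Q : DyadicCube d) :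
    ∃ ch : Finset (DyadicCube d),
      (∀ L ∈ ch, L.scale < Q.scale ∧ (L.toCube α).toSet ⊆ (Q.toCube α).toSet) ∧
      (∀ L ∈ ch, ∀ L' ∈ ch,
        ((L.toCube α).toSet ∩ (L'.toCube α).toSet).Nonempty → L = L') ∧
      ∑ L ∈ ch, volume (L.toCube α).toSet ≤ 1 / 2 * volume (Q.toCube α).toSet ∧
      ENNReal.ofReal |vecPair K α t₁ t₂ f₁ f₂ Q - ∑ L ∈ ch, vecPair K α t₁ t₂ f₁ f₂ L| ≤
        stepConst d n * (maxNorm K r + locConst K p₁ p₂) *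
          (volume (Q.toCube α).toSet * bodyProd α p₁ p₂ f₁ f₂ Q) := by
  set T := Q.triple α with hT
  have hTs : T.toSet = (Q.toCube α).dilate 3 := Q.toSet_triple
  have hTm : MeasurableSet T.toSet := T.measurableSet_toSet
  have hTv : volume T.toSet = 3 ^ d * volume (Q.toCube α).toSet := volume_triple Q
  set V := volume (Q.toCube α).toSet with hV
  have hV0 : V ≠ 0 := Cube.volume_toSet_ne_zero _
  have hVt : V ≠ ∞ := Cube.volume_toSet_ne_top _
  set Λ := stoppingRatio d n with hΛ
  have hΛ1 : 1 ≤ Λ := one_le_stoppingRatio d n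
  have hΛt : Λ ≠ ∞ := stoppingRatio_ne_top d n
  set E := bodyProd α p₁ p₂ f₁ f₂ Q with hE
  have hEt : E ≠ ∞ := (rightEndpoint_minkowskiProd_lt_top p₁ p₂ hf₁ hf₂ T).ne
  obtain ⟨k, hk, a, l, hl, ha, hal⟩ := exists_frame hp₁ hpt₁ hp₂ hpt₂ hf₁ hf₂ T
  set u : Fin k → Rd d → ℝ := fun i => T.toSet.indicator fun x => l i (f₁ x) with hu
  set v : Fin k → Rd d → ℝ := fun i => T.toSet.indicator fun x => inner ℝ (a i) (f₂ x) with hv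
  have hus : ∀ i x, x ∉ T.toSet → u i x = 0 := fun i x hx => indicator_of_notMem hx _
  have hvs : ∀ i x, x ∉ T.toSet → v i x = 0 := fun i x hx => indicator_of_notMem hx _
  have hup : ∀ i, MemLp (u i) p₁ volume := fun i =>
    ((memLp_top_clm hf₁ (l i)).indicator hTm).of_le_of_support le_top hTm T.volume_toSet_ne_top
      (Filter.Eventually.of_forall (hus i))
  have hvp : ∀ i, MemLp (v i) p₂ volume := fun i =>
    ((memLp_top_clm hf₂ (innerSL ℝ (a i))).indicator hTm).of_le_of_support le_top hTm
      T.volume_toSet_ne_top (Filter.Eventually.of_forall (hvs i))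
  have hua : ∀ i, avg p₁ (u i) T ≤ 2 := fun i => by
    refine le_trans (le_of_eq ?_) (hl i)
    rw [avg, avg, hu, indicator_indicator, inter_self]
  have hva : ∀ i, avg p₂ (v i) T ≤ E := fun i => by
    refine le_trans (le_of_eq ?_) (ha i)
    rw [avg, avg, hv, indicator_indicator, inter_self]
  set B : Set (Rd d) := ⋃ i, (({x | Λ * avg p₁ (u i) T < maxFn p₁ (u i) x} ∪
    {x | Λ * avg p₁ (u i) T < ‖u i x‖ₑ}) ∪ ({x | Λ * avg p₂ (v i) T < maxFn p₂ (v i) x} ∪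
    {x | Λ * avg p₂ (v i) T < ‖v i x‖ₑ})) with hB
  have hBv : volume B < 1 / 2 * ENNReal.ofReal (1 / 16) ^ d * V := by
    calc volume B ≤ ∑' i : Fin k, ((4 ^ d + 1) / Λ * volume T.toSet +
            (4 ^ d + 1) / Λ * volume T.toSet) := by
          refine (measure_iUnion_le _).trans (ENNReal.tsum_le_tsum fun i => ?_)
          exact (measure_union_le _ _).trans (add_le_add
            (measure_large_le hd hp₁ hpt₁ (hup i) (hus i) hΛ1 hΛt)
            (measure_large_le hd hp₂ hpt₂ (hvp i) (hvs i) hΛ1 hΛt))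
      _ = 2 * (k : ℝ≥0∞) * ((4 ^ d + 1) / Λ * 3 ^ d) * V := by
          rw [tsum_fintype, Finset.sum_const, Finset.card_univ, Fintype.card_fin, nsmul_eq_mul,
            hTv]
          ring
      _ < _ := by
          rw [ENNReal.mul_lt_mul_iff_left hV0 hVt]
          exact stoppingRatio_bound d hk
  -- Outer regularity supplies an open set of almost the same measure, as the Whitney construction
  -- requires. The factor `16⁻ᵈ` yields a stopping collection, the factor `1/2` the packing of the
  -- children.
  obtain ⟨U, hBU, hU, hUv⟩ := B.exists_isOpen_lt_of_lt _ hBv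
  have h16 : ENNReal.ofReal (1 / 16) ^ d ≤ 1 :=
    pow_le_one' (by rw [← ENNReal.ofReal_one]; exact ENNReal.ofReal_le_ofReal (by norm_num)) d
  have hhalf : (1 / 2 : ℝ≥0∞) ≤ 1 := by
    rw [one_div]; exact ENNReal.inv_le_one.2 (by norm_num)
  have hUv1 : volume U < ENNReal.ofReal (1 / 16) ^ d * V := by
    refine hUv.trans_le ?_
    gcongr
    exact mul_le_of_le_one_left zero_le hhalf
  have hUv2 : volume U ≤ 1 / 2 * V := by
    refine hUv.le.trans ?_
    gcongr
    exact mul_le_of_le_one_right zero_le h16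
  set 𝒬 := whitney α U Q with h𝒬
  have hst : IsStoppingCollection α Q 𝒬 := isStoppingCollection_whitney hd hU hUv1
  obtain ⟨M, hM⟩ := h₁.2
  have hm : ∀ x, -M ≤ t₁ x := fun x => (abs_le.1 (hM x)).1
  have hch := fun L => (finite_dyadic_subset (Q := Q) (-M) hst.eq_of_inter).mem_toFinset (a := L)
  -- Only Whitney cubes inside `Q` and above the lower truncation are kept: no others contribute to
  -- the localized form.
  set ch := (finite_dyadic_subset (Q := Q) (-M) hst.eq_of_inter).toFinset with hchd
  have hchs : ∀ L ∈ ch, L.scale < Q.scale := fun L hL =>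
    scale_lt_of_dilate_subset hd hUv1 ((hch L).1 hL).1.1
  have hdisj : ∀ L ∈ ch, ∀ L' ∈ ch,
      ((L.toCube α).toSet ∩ (L'.toCube α).toSet).Nonempty → L = L' := fun L hL L' hL' =>
    hst.eq_of_inter L ((hch L).1 hL).1 L' ((hch L').1 hL').1
  refine ⟨ch, fun L hL => ⟨hchs L hL, ((hch L).1 hL).2.1⟩, hdisj, ?_, ?_⟩
  · exact (sum_volume_le (fun L hL => toSet_subset_of_mem_whitney ((hch L).1 hL).1) hdisj).trans
      hUv2
  have huY : ∀ i, MemY α Q 𝒬 p₁ (u i) ∧ normY α 𝒬 p₁ (u i) ≤ Λ * 2 := fun i => by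
    refine memY_whitney hd hpt₁ hU hUv1 (hup i) (by rw [← hTs]; exact hus i)
      (ENNReal.mul_ne_top hΛt (by norm_num)) (fun x hx => ?_) (fun x hx => ?_)
    · have : ¬ Λ * avg p₁ (u i) T < maxFn p₁ (u i) x := fun h =>
        hx (hBU (mem_iUnion.2 ⟨i, Or.inl (Or.inl h)⟩))
      exact (not_lt.1 this).trans (mul_le_mul_right (hua i) _)
    · have : ¬ Λ * avg p₁ (u i) T < ‖u i x‖ₑ := fun h =>
        hx (hBU (mem_iUnion.2 ⟨i, Or.inl (Or.inr h)⟩))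
      exact (not_lt.1 this).trans (mul_le_mul_right (hua i) _)
  have hvY : ∀ i, MemY α Q 𝒬 p₂ (v i) ∧ normY α 𝒬 p₂ (v i) ≤ Λ * E := fun i => by
    refine memY_whitney hd hpt₂ hU hUv1 (hvp i) (by rw [← hTs]; exact hvs i)
      (ENNReal.mul_ne_top hΛt hEt) (fun x hx => ?_) (fun x hx => ?_)
    · have : ¬ Λ * avg p₂ (v i) T < maxFn p₂ (v i) x := fun h =>
        hx (hBU (mem_iUnion.2 ⟨i, Or.inr (Or.inl h)⟩))
      exact (not_lt.1 this).trans (mul_le_mul_right (hva i) _)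
    · have : ¬ Λ * avg p₂ (v i) T < ‖v i x‖ₑ := fun h =>
        hx (hBU (mem_iUnion.2 ⟨i, Or.inr (Or.inr h)⟩))
      exact (not_lt.1 this).trans (mul_le_mul_right (hva i) _)
  have hloc : ∀ i, ENNReal.ofReal |locForm K α Q 𝒬 t₁ t₂ (u i) (v i)| ≤
      (2 * 3 ^ d * (1 + 32 ^ d) ^ 2) * (maxNorm K r + locConst K p₁ p₂) * (Λ * 2) * (Λ * E) :=
    fun i => by
      refine (ofReal_abs_locForm_le hK hr hN hp₁ hp₂ hpt₁ hpt₂ h₁ h₂ hst (huY i).1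
        (hvY i).1).trans ?_
      gcongr
      · exact (huY i).2
      · exact (hvY i).2
  have hVr : volume.real (Q.toCube α).toSet ≠ 0 := (volume_real_pos _).ne'
  have hid : vecPair K α t₁ t₂ f₁ f₂ Q - ∑ L ∈ ch, vecPair K α t₁ t₂ f₁ f₂ L =
      volume.real (Q.toCube α).toSet * ∑ i, locForm K α Q 𝒬 t₁ t₂ (u i) (v i) := by
    rw [vecPair_eq_sum hK h₁ h₂ hf₁' hf₂' hTm hal hTs.ge, Finset.sum_congr rfl fun L hL =>
      vecPair_eq_sum hK h₁ h₂ hf₁' hf₂' hTm hal (L := L) (by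
        rw [← L.toSet_triple]
        exact triple_subset_of_subset (hchs L hL).le ((hch L).1 hL).2.1), Finset.sum_comm,
      ← Finset.sum_sub_distrib, Finset.mul_sum]
    refine Finset.sum_congr rfl fun i _ => ?_
    rw [locForm_eq_sum hm hch, mul_inv_cancel_left₀ hVr]
  rw [hid, abs_mul, ENNReal.ofReal_mul (abs_nonneg _), abs_of_pos (volume_real_pos _),
    Measure.real, ENNReal.ofReal_toReal hVt]
  calc V * ENNReal.ofReal |∑ i, locForm K α Q 𝒬 t₁ t₂ (u i) (v i)|
      ≤ V * ∑ i : Fin k, ((2 * 3 ^ d * (1 + 32 ^ d) ^ 2) *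
        (maxNorm K r + locConst K p₁ p₂) * (Λ * 2) * (Λ * E)) := by
        gcongr
        refine (ENNReal.ofReal_le_ofReal (Finset.abs_sum_le_sum_abs _ _)).trans ?_
        rw [ENNReal.ofReal_sum_of_nonneg fun _ _ => abs_nonneg _]
        exact Finset.sum_le_sum fun i _ => hloc i
    _ = V * ((k : ℝ≥0∞) * ((2 * 3 ^ d * (1 + 32 ^ d) ^ 2) *
        (maxNorm K r + locConst K p₁ p₂) * (Λ * 2) * (Λ * E))) := by
        rw [Finset.sum_const, Finset.card_univ, Fintype.card_fin, nsmul_eq_mul]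
    _ ≤ V * ((n : ℝ≥0∞) * ((2 * 3 ^ d * (1 + 32 ^ d) ^ 2) *
        (maxNorm K r + locConst K p₁ p₂) * (Λ * 2) * (Λ * E))) := by gcongr
    _ = _ := by rw [stepConst, ← hΛ]; ring

end StoppingStep

/-! ### Iteration and conclusion -/

section Iteration

variable {d n : ℕ} {α : Fin d → Fin 3} {p : ℝ≥0∞} {K : KernelFamily d} {t₁ t₂ : Rd d → ℤ}
  {f₁ f₂ : Rd d → Rn n}

open Classical in
/-- Iteration of the stopping step: domination by a finite Carleson family of dyadic cubes. -/
theorem exists_carleson_domination (hd : 0 < d) (hK : IsKernelFamily K) {r : ℝ} (hr : 1 < r)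
    (hN : maxNorm K r < ∞) {p₁ p₂ : ℝ≥0∞} (hp₁ : 1 ≤ p₁) (hpt₁ : p₁ ≠ ∞) (hp₂ : 1 ≤ p₂)
    (hpt₂ : p₂ ≠ ∞) (h₁ : IsTruncation t₁) (h₂ : IsTruncation t₂)
    (hf₁ : MemLp f₁ ∞ volume) (hf₁' : Integrable f₁)
    (hf₂ : MemLp f₂ ∞ volume) (hf₂' : Integrable f₂) {m : ℤ} (hm : ∀ x, m ≤ t₁ x) (N : ℕ)
    (Q : DyadicCube d) (hQ : Q.scale ≤ m + N) :
    ∃ S : Finset (DyadicCube d),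
      (∀ R ∈ S, R.scale ≤ Q.scale ∧ (R.toCube α).toSet ⊆ (Q.toCube α).toSet) ∧
      (∀ A : Set (Rd d), MeasurableSet A →
        ∑ R ∈ S, (if (R.toCube α).toSet ⊆ A then volume (R.toCube α).toSet else 0) ≤
          2 * volume (A ∩ (Q.toCube α).toSet)) ∧
      ENNReal.ofReal |vecPair K α t₁ t₂ f₁ f₂ Q| ≤
        ∑ R ∈ S, stepConst d n * (maxNorm K r + locConst K p₁ p₂) *
          (volume (R.toCube α).toSet * bodyProd α p₁ p₂ f₁ f₂ R) := by
  induction N generalizing Q with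
  | zero =>
    -- At scale at most `m` the pairing vanishes, so no cube is needed.
    refine ⟨∅, by simp, by simp, ?_⟩
    have : vecPair K α t₁ t₂ f₁ f₂ Q = 0 := Finset.sum_eq_zero fun j _ =>
      locPair_eq_zero_of_scale_le (fun x => (by simpa using hQ : Q.scale ≤ m).trans (hm x)) _ _
    simp [this]
  | succ N ih =>
    obtain ⟨ch, hsub, hdisj, hvol, hbd⟩ := exists_children (α := α) hd hK hr hN hp₁ hpt₁ hp₂
      hpt₂ h₁ h₂ hf₁ hf₁' hf₂ hf₂' Q
    have hchoice : ∀ L : DyadicCube d, ∃ S : Finset (DyadicCube d), L ∈ ch →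
        (∀ R ∈ S, R.scale ≤ L.scale ∧ (R.toCube α).toSet ⊆ (L.toCube α).toSet) ∧
        (∀ A : Set (Rd d), MeasurableSet A →
          ∑ R ∈ S, (if (R.toCube α).toSet ⊆ A then volume (R.toCube α).toSet else 0) ≤
            2 * volume (A ∩ (L.toCube α).toSet)) ∧
        ENNReal.ofReal |vecPair K α t₁ t₂ f₁ f₂ L| ≤
          ∑ R ∈ S, stepConst d n * (maxNorm K r + locConst K p₁ p₂) *
            (volume (R.toCube α).toSet * bodyProd α p₁ p₂ f₁ f₂ R) := by
      intro L
      by_cases hL : L ∈ ch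
      · obtain ⟨S, hS⟩ := ih L (by
          have := (hsub L hL).1
          push_cast at hQ
          omega)
        exact ⟨S, fun _ => hS⟩
      · exact ⟨∅, fun h => absurd h hL⟩
    choose S hS using hchoice
    have hQn : Q ∉ ch.biUnion S := by
      intro h
      obtain ⟨L, hL, hQL⟩ := Finset.mem_biUnion.1 h
      have h1 := ((hS L hL).1 Q hQL).1
      have h2 := (hsub L hL).1
      omega
    have hpd : (ch : Set (DyadicCube d)).PairwiseDisjoint S := by
      intro L hL L' hL' hne
      rw [Function.onFun, Finset.disjoint_left]
      intro R hR hR'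
      refine hne (hdisj L hL L' hL' ⟨(R.toCube α).corner, ?_, ?_⟩)
      · exact ((hS L hL).1 R hR).2 (Cube.corner_mem_toSet _)
      · exact ((hS L' hL').1 R hR').2 (Cube.corner_mem_toSet _)
    have hsum : ∀ w : DyadicCube d → ℝ≥0∞,
        ∑ R ∈ insert Q (ch.biUnion S), w R = w Q + ∑ L ∈ ch, ∑ R ∈ S L, w R := by
      intro w
      rw [Finset.sum_insert hQn, Finset.sum_biUnion hpd]
    refine ⟨insert Q (ch.biUnion S), ?_, ?_, ?_⟩
    · intro R hR
      rcases Finset.mem_insert.1 hR with rfl | hR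
      · exact ⟨le_rfl, Subset.rfl⟩
      · obtain ⟨L, hL, hRL⟩ := Finset.mem_biUnion.1 hR
        have h1 := (hS L hL).1 R hRL
        exact ⟨h1.1.trans (hsub L hL).1.le, h1.2.trans (hsub L hL).2⟩
    · intro A hA
      rw [hsum]
      -- Packing passes through the induction. If `Q ⊆ A`, the children fill half of `Q` and the
      -- bound is `|Q| + 2 · |Q|/2`. Otherwise `Q` is not counted, and the bounds localized to the
      -- disjoint children add up; this is why the claim involves `A ∩ Q`.
      by_cases hQA : (Q.toCube α).toSet ⊆ A
      · rw [if_pos hQA, inter_eq_self_of_subset_right hQA]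
        calc _ ≤ volume (Q.toCube α).toSet + ∑ L ∈ ch, 2 * volume (L.toCube α).toSet := by
              gcongr with L hL
              exact ((hS L hL).2.1 A hA).trans (by gcongr; exact inter_subset_right)
          _ ≤ volume (Q.toCube α).toSet + 2 * (1 / 2 * volume (Q.toCube α).toSet) := by
              rw [← Finset.mul_sum]
              gcongr
          _ = _ := by
              rw [← mul_assoc, mul_one_div, ENNReal.div_self (by norm_num) (by norm_num)]
              ring
      · rw [if_neg hQA, zero_add]
        calc _ ≤ ∑ L ∈ ch, 2 * volume (A ∩ (L.toCube α).toSet) :=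
              Finset.sum_le_sum fun L hL => (hS L hL).2.1 A hA
          _ = 2 * volume (⋃ L ∈ ch, A ∩ (L.toCube α).toSet) := by
              rw [measure_biUnion_finset, Finset.mul_sum]
              · intro L hL L' hL' hne
                rw [Function.onFun, disjoint_iff_inter_eq_empty, ← not_nonempty_iff_eq_empty]
                rintro ⟨x, hx, hx'⟩
                exact hne (hdisj L hL L' hL' ⟨x, hx.2, hx'.2⟩)
              · exact fun L _ => hA.inter (Cube.measurableSet_toSet _)
          _ ≤ _ := by
              gcongr
              exact iUnion₂_subset fun L hL => inter_subset_inter_right _ (hsub L hL).2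
    · rw [hsum]
      have e : vecPair K α t₁ t₂ f₁ f₂ Q =
          (vecPair K α t₁ t₂ f₁ f₂ Q - ∑ L ∈ ch, vecPair K α t₁ t₂ f₁ f₂ L) +
            ∑ L ∈ ch, vecPair K α t₁ t₂ f₁ f₂ L := by ring
      rw [e]
      refine (ENNReal.ofReal_le_ofReal (abs_add_le _ _)).trans
        (ENNReal.ofReal_add_le.trans (add_le_add hbd ?_))
      refine (ENNReal.ofReal_le_ofReal (Finset.abs_sum_le_sum_abs _ _)).trans ?_
      rw [ENNReal.ofReal_sum_of_nonneg fun _ _ => abs_nonneg _]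
      exact Finset.sum_le_sum fun L hL => (hS L hL).2.2

/-- Cubes of the standard system never contain a neighbourhood of the origin. With shift `1/3`, even
scale and position `-1`, the cube is `2^s [-2/3, 1/3)^d`, which contains any given ball once `s` is
large. -/
theorem exists_large_cube (d : ℕ) (R : ℝ) (M : ℤ) :
    ∃ Q : DyadicCube d, M ≤ Q.scale ∧
      Metric.closedBall 0 R ⊆ (Q.toCube fun _ => (1 : Fin 3)).toSet := by
  obtain ⟨N, hN⟩ := pow_unbounded_of_one_lt (3 * R) (one_lt_two (α := ℝ))
  obtain ⟨s, hsM, hsN, hev⟩ : ∃ s : ℤ, M ≤ s ∧ (N : ℤ) ≤ s ∧ Even s := by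
    refine ⟨2 * max |M| N, ?_, ?_, even_two_mul _⟩
    · have h1 := le_max_left |M| (N : ℤ)
      have h2 := le_abs_self M
      have h3 := abs_nonneg M
      omega
    · have h1 := le_max_right |M| (N : ℤ)
      omega
  refine ⟨⟨s, fun _ => -1⟩, hsM, fun x hx i => ?_⟩
  have h1 : 3 * R < (2 : ℝ) ^ s := by
    refine hN.trans_le ?_
    rw [← zpow_natCast]
    exact zpow_le_zpow_right₀ one_le_two hsN
  rw [mem_closedBall_zero_iff] at hx
  have h2 := (norm_le_pi_norm x i).trans hx
  rw [Real.norm_eq_abs, abs_le] at h2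
  have h3 : (0 : ℝ) < (2 : ℝ) ^ s := zpow_pos two_pos _
  simp only [DyadicCube.toCube, hev.neg_one_zpow]
  norm_num
  constructor <;> linarith

/-! ### The vector-valued operator and its sparse form. -/

theorem MemLinf0.integrable {f : Rd d → Rn n} (hf : MemLinf0 f) : Integrable f := by
  have h1 : IntegrableOn f (tsupport f) := by
    have : IsFiniteMeasure (volume.restrict (tsupport f)) :=
      ⟨by simpa using hf.2.measure_lt_top⟩
    exact memLp_one_iff_integrable.1 ((hf.1.restrict _).mono_exponent le_top)
  exact (integrableOn_iff_integrable_of_support_subset (subset_tsupport f)).1 h1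

theorem integrable_component {f : Rd d → Rn n} (hf : Integrable f) (j : Fin n) :
    Integrable fun x => f x j :=
  (EuclideanSpace.proj (𝕜 := ℝ) j).integrable_comp hf

theorem locallyIntegrable_vecExt_linT (hK : IsKernelFamily K) (h₁ : IsTruncation t₁)
    (h₂ : IsTruncation t₂) {f : Rd d → Rn n} (hf : MemLinf0 f) :
    LocallyIntegrable (vecExt n (linT K t₁ t₂) f) volume := by
  have h1 : MemLp (fun x (j : Fin n) => linT K t₁ t₂ (fun y => f y j) x) ∞ volume := by
    rw [memLp_pi_iff]
    intro j
    have hj := integrable_component hf.integrable j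
    obtain ⟨B, hB⟩ := exists_bound_linT hK hj h₁ h₂
    exact memLp_top_of_bound (measurable_linT hK hj.1 h₁ h₂).aestronglyMeasurable B
      (Filter.Eventually.of_forall hB)
  have h2 := (PiLp.continuousLinearEquiv 2 ℝ (fun _ : Fin n => ℝ)).symm.toContinuousLinearMap.comp_memLp' h1
  exact MemLp.locallyIntegrable h2 le_top

/-- For a cube that contains the support of `f₁` and has scale above `t₂`, neither the cut-off nor
the extra truncation has any effect. -/
theorem integral_inner_vecExt_eq_vecPair (hK : IsKernelFamily K) (h₁ : IsTruncation t₁)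
    (h₂ : IsTruncation t₂) (hf₁ : Integrable f₁) (hf₂ : Integrable f₂) {Q : DyadicCube d}
    (hs : ∀ x, t₂ x ≤ Q.scale) (hQ : ∀ x, x ∉ (Q.toCube α).toSet → f₁ x = 0) :
    ∫ x, inner ℝ (vecExt n (linT K t₁ t₂) f₁ x) (f₂ x) = vecPair K α t₁ t₂ f₁ f₂ Q := by
  have e1 : (fun z => min (t₂ z) Q.scale) = t₂ := funext fun z => min_eq_left (hs z)
  have e2 : ∀ j, ((Q.toCube α).toSet.indicator fun x => f₁ x j) = fun x => f₁ x j := by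
    intro j
    ext x
    by_cases hx : x ∈ (Q.toCube α).toSet
    · simp [hx]
    · simp [hx, hQ x hx]
  have hint := fun j => integrable_locPair (L := Q) (α := α) hK h₁ h₂
    (integrable_component hf₁ j) (integrable_component hf₂ j)
  simp only [e1, e2] at hint
  simp only [vecPair, locPair, e1, e2]
  rw [← integral_finsetSum _ fun j _ => hint j]
  congr 1
  ext x
  simp [vecExt, PiLp.inner_apply, mul_comm]

theorem sparseForm_image_triple (p₁ p₂ : ℝ≥0∞) (S : Finset (DyadicCube d))
    (f₁ f₂ : Rd d → Rn n) :
    sparseForm p₁ p₂ (DyadicCube.triple α '' (S : Set (DyadicCube d))) f₁ f₂ =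
      ∑ R ∈ S, volume (R.triple α).toSet * bodyProd α p₁ p₂ f₁ f₂ R := by
  rw [sparseForm, tsum_image (fun Q : Cube d => volume Q.toSet *
      rightEndpoint (minkowskiProd (bodyAvg p₁ f₁ Q) (bodyAvg p₂ f₂ Q)))
    DyadicCube.triple_injective.injOn]
  exact Finset.tsum_subtype S fun R => volume (R.triple α).toSet * bodyProd α p₁ p₂ f₁ f₂ R

-- Start the iteration from a cube containing the support of `f₁` with scale above both truncations,
-- and pass from the resulting Carleson family to sparse triples. The family is finite, so the
-- sparse sum converges.
open Classical in
theorem exists_sparse_domination (hd : 0 < d) (hK : IsKernelFamily K) {r : ℝ} (hr : 1 < r)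
    (hN : maxNorm K r < ∞) {p₁ p₂ : ℝ≥0∞} (hp₁ : 1 ≤ p₁) (hpt₁ : p₁ ≠ ∞) (hp₂ : 1 ≤ p₂)
    (hpt₂ : p₂ ≠ ∞) (h₁ : IsTruncation t₁) (h₂ : IsTruncation t₂)
    (hf₁ : MemLinf0 f₁) (hf₂ : MemLinf0 f₂) :
    ∃ S : Set (Cube d), IsSparse (1 / 2) S ∧ sparseForm p₁ p₂ S f₁ f₂ < ∞ ∧
      ENNReal.ofReal |∫ x, inner ℝ (vecExt n (linT K t₁ t₂) f₁ x) (f₂ x)| ≤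
        (3 ^ d * (4 * 3 ^ d)) * stepConst d n * (maxNorm K r + locConst K p₁ p₂) *
          sparseForm p₁ p₂ S f₁ f₂ := by
  obtain ⟨M, hM⟩ := h₁.exists_bound h₂
  obtain ⟨R, hR⟩ := hf₁.2.isCompact.isBounded.subset_closedBall 0
  obtain ⟨Q, hQM, hQ⟩ := exists_large_cube d R M
  set α : Fin d → Fin 3 := fun _ => 1
  have hm : ∀ x, -M ≤ t₁ x := fun x => (abs_le.1 (hM x).1).1
  have hQ0 : ∀ x, x ∉ (Q.toCube α).toSet → f₁ x = 0 := fun x hx =>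
    image_eq_zero_of_notMem_tsupport fun h => hx (hQ (hR h))
  obtain ⟨S, -, hS, hbd⟩ := exists_carleson_domination (α := α) hd hK hr hN hp₁ hpt₁ hp₂ hpt₂
    h₁ h₂ hf₁.1 hf₁.integrable hf₂.1 hf₂.integrable hm (Q.scale + M).toNat Q (by omega)
  obtain ⟨S', -, hsp, hle⟩ := exists_sparse_subfamily (α := α) hd (S := S)
    (fun A hA => by
      rw [Finset.sum_filter]
      exact (hS A hA).trans (by gcongr; exact inter_subset_left))
    (fun R => volume (R.toCube α).toSet * bodyProd α p₁ p₂ f₁ f₂ R)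
  refine ⟨_, hsp, ?_, ?_⟩
  · rw [sparseForm_image_triple]
    refine ENNReal.sum_lt_top.2 fun R _ => ENNReal.mul_lt_top
      (Cube.volume_toSet_ne_top _).lt_top ?_
    exact rightEndpoint_minkowskiProd_lt_top p₁ p₂ hf₁.1 hf₂.1 _
  · rw [integral_inner_vecExt_eq_vecPair hK h₁ h₂ hf₁.integrable hf₂.integrable
      (fun x => (abs_le.1 (hM x).2).2.trans hQM) hQ0, sparseForm_image_triple]
    refine hbd.trans ?_
    rw [← Finset.mul_sum]
    calc _ ≤ stepConst d n * (maxNorm K r + locConst K p₁ p₂) * ((3 ^ d * (4 * 3 ^ d)) *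
          ∑ R ∈ S', volume (R.toCube α).toSet * bodyProd α p₁ p₂ f₁ f₂ R) := by gcongr
      _ ≤ stepConst d n * (maxNorm K r + locConst K p₁ p₂) * ((3 ^ d * (4 * 3 ^ d)) *
          ∑ R ∈ S', volume (R.triple α).toSet * bodyProd α p₁ p₂ f₁ f₂ R) := by
          gcongr with R hR
          rw [R.toSet_triple]
          exact Cube.toSet_subset_dilate (by norm_num) _
      _ = _ := by ring

end Iteration

theorem theorem5 (d n : ℕ) (hd : 0 < d) (r p₁ p₂ : ℝ) (hr : 1 < r) (hp₁ : 1 ≤ p₁)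
    (hp₂ : 1 ≤ p₂) :
    ∃ C : ℝ≥0, ∀ K : KernelFamily d, IsKernelFamily K → maxNorm K r < ∞ →
      locConst K (ENNReal.ofReal p₁) (ENNReal.ofReal p₂) < ∞ →
      ∀ t₁ t₂ : Rd d → ℤ, IsTruncation t₁ → IsTruncation t₂ →
        sparseNorm (vecExt n (linT K t₁ t₂)) (ENNReal.ofReal p₁) (ENNReal.ofReal p₂) ≤
          (C : ℝ≥0∞) *
            (maxNorm K r + locConst K (ENNReal.ofReal p₁) (ENNReal.ofReal p₂)) := by
  have hCt : (3 ^ d * (4 * 3 ^ d)) * stepConst d n ≠ ∞ :=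
    ENNReal.mul_ne_top (ENNReal.mul_ne_top (by simp) (ENNReal.mul_ne_top (by simp) (by simp)))
      (stepConst_ne_top d n)
  refine ⟨((3 ^ d * (4 * 3 ^ d)) * stepConst d n).toNNReal, ?_⟩
  intro K hK hN hL t₁ t₂ h₁ h₂
  rw [ENNReal.coe_toNNReal hCt]
  -- The sparse norm is an infimum over finite constants, so the bound must be finite before it can
  -- be used as a competitor; the finiteness of the two norms provides this.
  have hDt : (3 ^ d * (4 * 3 ^ d)) * stepConst d n *
      (maxNorm K r + locConst K (ENNReal.ofReal p₁) (ENNReal.ofReal p₂)) ≠ ∞ :=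
    ENNReal.mul_ne_top hCt (ENNReal.add_lt_top.2 ⟨hN, hL⟩).ne
  rw [← ENNReal.coe_toNNReal hDt]
  refine iInf₂_le _ ⟨fun f hf => locallyIntegrable_vecExt_linT hK h₁ h₂ hf, fun f₁ f₂ hf₁ hf₂ => ?_⟩
  rw [ENNReal.coe_toNNReal hDt]
  exact exists_sparse_domination hd hK hr hN (ENNReal.one_le_ofReal.2 hp₁) ENNReal.ofReal_ne_top
    (ENNReal.one_le_ofReal.2 hp₂) ENNReal.ofReal_ne_top h₁ h₂ hf₁ hf₂
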